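/- Corollary 1.1 (cor:decidable). Infinitesimal ultrarigidity of periodic frameworks is a decidable property. In detail: A \emph{periodic framework} in dimension $d$ consists of a graph $\tilde G$, a free action of $\mathbb Z^d$ on $\tilde G$ by automorphisms with finitely many orbits of vertices and edges, and a realization $(\mathbf p,\mathbf L)$: a map $\mathbf p:V(\tilde G)\to\mathbb R^d$ and a matrix $\mathbf L\in\mathbb R^{d\times d}$ with $\mathbf p(\gamma\cdot i)=\mathbf p(i)+\mathbf L\gamma$ for all $i\in V(\tilde G)$, $\gamma\in\mathbb Z^d$, and $\mathbf p(i)\neq\mathbf p(j)$ for every edge $ij$. For a subgroup $\Lambda\le\mathbb Z^d$ of finite index, a \emph{$\Lambda$-periodic infinitesimal motion} is a pair $(\mathbf v,\mathbf M)$ of a map $\mathbf v:V(\tilde G)\to\mathbb R^d$ and a matrix $\mathbf M\in\mathbb R^{d\times d}$ such that $\mathbf v(\lambda\cdot i)=\mathbf v(i)+\mathbf M\lambda$ for all $i\in V(\tilde G)$, $\lambda\in\Lambda$, and $\langle \mathbf p(j)-\mathbf p(i),\mathbf v(j)-\mathbf v(i)\rangle=0$ for every edge $ij$. The framework is \emph{infinitesimally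 ultrarigid} if for every subgroup $\Lambda\le\mathbb Z^d$ of finite index (including $\mathbb Z^d$ itself) the space of $\Lambda$-periodic infinitesimal motions has dimension $\binom{d+1}{2}$. A \emph{finite description} of a framework consists of the following data. \begin{itemize} \item The dimension $d$ and the colored quotient graph: the number $n$ of vertex orbits and a finite list of triples $(i,j,\gamma)$ with $1\le i,j\le n$ and $\gamma\in\mathbb Z^d$, such that for some choice of representatives $r_1,\dots,r_n$ of the vertex orbits the edges of $\tilde G$ are exactly the translates of the pairs $\{r_i,\gamma\cdot r_j\}$. \item An explicit presentation of finitely many real numbers $y_1,\dots,y_s$: for each $k$ in turn it is recorded either that $y_k$ is transcendental over $\mathbb Q(y_1,\dots,y_{k-1})$, or that $y_k$ is algebraic over this field, together with a polynomial $f_k\in\mathbb Z[Y_1,\dots,Y_k]$ such that $f_k(y_1,\dots,y_{k-1},Y)$ is a nonzero scalar multiple of the minimal polynomial of $y_k$ over $\mathbb Q(y_1,\dots,y_{k-1})$. \item For each coordinate of $\mathbf p(r_1),\dots,\mathbf p(r_n)$ and each entry of $\mathbf L$, an index $k$ such that this coordinate or entry equals $y_k$. \end{itemize} Every periodic framework,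 in every dimension $d$, has a finite description, and there is a single algorithm (a total computable $\{0,1\}$-valued function on finite descriptions, uniform in $d$, the graph and the realization) which, given any finite description of any periodic framework, decides whether the framework is infinitesimally ultrarigid. -/

import Mathlib

open Polynomial

/-! ## Periodic frameworks and infinitesimal ultrarigidity -/

/-- A periodic framework in dimension `d`: a graph on the (infinite) vertex set `V`, a free action of
`ℤ^d` on it by graph automorphisms with finitely many orbits of vertices and of edges, and a
realization `(p, L)`: positions `p` of the vertices, equivariant with respect to the lattice generated
by the columns of the matrix `L`, such that all bars have positive length.  (The bar lengths are those
of the realization; they are invariant under the action because `p` is equivariant.) -/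
structure PeriodicFramework (d : ℕ) (V : Type*) [AddAction (Fin d → ℤ) V] where
  graph : SimpleGraph V
  adj_vadd : ∀ (γ : Fin d → ℤ) (u v : V), graph.Adj (γ +ᵥ u) (γ +ᵥ v) ↔ graph.Adj u v
  free : ∀ (γ : Fin d → ℤ) (v : V), γ +ᵥ v = v → γ = 0
  finite_vertex_orbits : Finite (AddAction.orbitRel.Quotient (Fin d → ℤ) V)
  finite_edge_orbits : ∃ T : Set (V × V), T.Finite ∧
    ∀ u v : V, graph.Adj u v → ∃ t ∈ T, ∃ γ : Fin d → ℤ, u = γ +ᵥ t.1 ∧ v = γ +ᵥ t.2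
  p : V → EuclideanSpace ℝ (Fin d)
  L : Matrix (Fin d) (Fin d) ℝ
  p_vadd : ∀ (γ : Fin d → ℤ) (v : V),
    p (γ +ᵥ v) = p v + WithLp.toLp 2 (L.mulVec fun k => (γ k : ℝ))
  length_pos : ∀ u v : V, graph.Adj u v → 0 < ‖p v - p u‖

namespace PeriodicFramework

variable {d : ℕ} {V : Type*} [AddAction (Fin d → ℤ) V]

/-- The infinitesimal motions of the framework when only periodicity with respect to the subgroup
`Λ` of `ℤ^d` is imposed: pairs `(v, M)` of a velocity field `v` on the vertices and a velocity `M` of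
the lattice representation, satisfying the derivative at `(p, L)` of the `Λ`-equivariance condition and
of the conditions that the squared lengths of the bars stay constant. -/
def infinitesimalMotions (Φ : PeriodicFramework d V) (Λ : AddSubgroup (Fin d → ℤ)) :
    Submodule ℝ ((V → EuclideanSpace ℝ (Fin d)) × Matrix (Fin d) (Fin d) ℝ) where
  carrier := {x |
    (∀ γ ∈ Λ, ∀ u : V, x.1 (γ +ᵥ u) = x.1 u + WithLp.toLp 2 (x.2.mulVec fun k => (γ k : ℝ))) ∧
    ∀ u v : V, Φ.graph.Adj u v → inner ℝ (Φ.p v - Φ.p u) (x.1 v - x.1 u) = 0}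
  zero_mem' := by
    constructor
    · intro γ _ u
      simp
    · intro u v _
      simp
  add_mem' := by
    rintro x y ⟨hx, hx'⟩ ⟨hy, hy'⟩
    constructor
    · intro γ hγ u
      simp only [Prod.fst_add, Prod.snd_add, Pi.add_apply, hx γ hγ u, hy γ hγ u,
        Matrix.add_mulVec, WithLp.toLp_add]
      abel
    · intro u v h
      have e : (x + y).1 v - (x + y).1 u = (x.1 v - x.1 u) + (y.1 v - y.1 u) := by
        simp only [Prod.fst_add, Pi.add_apply]
        abel
      rw [e, inner_add_right, hx' u v h, hy' u v h, add_zero]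
  smul_mem' := by
    rintro c x ⟨hx, hx'⟩
    constructor
    · intro γ hγ u
      simp only [Prod.smul_fst, Prod.smul_snd, Pi.smul_apply, hx γ hγ u, Matrix.smul_mulVec,
        WithLp.toLp_smul, smul_add]
    · intro u v h
      have e : (c • x).1 v - (c • x).1 u = c • (x.1 v - x.1 u) := by
        simp only [Prod.smul_fst, Pi.smul_apply, smul_sub]
      rw [e, inner_smul_right, hx' u v h, mul_zero]

/-- The framework is infinitesimally rigid as a `Λ`-periodic framework: the space of infinitesimal
motions has the dimension of the group of Euclidean isometries. -/
def InfinitesimallyRigidFor (Φ : PeriodicFramework d V) (Λ : AddSubgroup (Fin d → ℤ)) : Prop :=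
  Module.finrank ℝ (Φ.infinitesimalMotions Λ) = (d + 1).choose 2

/-- Infinitesimal ultrarigidity: the framework is infinitesimally rigid and remains so after the
periodicity constraint is relaxed to an arbitrary sublattice (subgroup of finite index) of `ℤ^d`. -/
def InfinitesimallyUltrarigid (Φ : PeriodicFramework d V) : Prop :=
  ∀ Λ : AddSubgroup (Fin d → ℤ), Λ.FiniteIndex → Φ.InfinitesimallyRigidFor Λ

end PeriodicFramework

/-! ## Finite descriptions of frameworks, as inputs of algorithms

All codes below are built from natural numbers and integers by products, lists and options, so that
Mathlib's notion of computability applies to them.  -/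

/-- A polynomial with integer coefficients, as a list of terms `(c, [e₀, e₁, …])` that stand for
`c * z₀ ^ e₀ * z₁ ^ e₁ * ⋯`. -/
abbrev PolyCode := List (ℤ × List ℕ)

/-- The value of a coded polynomial at a list `[z₀, z₁, …]` (missing exponents count as `0`, and
exponents without a corresponding value are ignored). -/
def PolyCode.eval {R : Type*} [CommRing R] (f : PolyCode) (z : List R) : R :=
  (f.map fun t => (t.1 : R) * (List.zipWith (fun a e => a ^ e) z t.2).prod).sum

/-- The code of a finitely generated field with chosen generators, adjoined one after another; the
generator adjoined LAST stands at the head of the list.  An entry `none` stands for a transcendental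
generator, `some f` for an algebraic one with minimal polynomial given by `f`. -/
abbrev FieldCode := List (Option PolyCode)

/-- The code `F` presents the list `y` of real numbers (again the last generator first): each entry
`none` corresponds to a number that is transcendental over the field generated over `ℚ` by the
numbers after it in the list, and each `some f` to a number that is algebraic over that field and whose
minimal polynomial is, up to a nonzero factor, the polynomial `f(X, y₁, y₂, …)`, where `y₁, y₂, …`
are the numbers after it in the list. -/
def FieldCode.Presents : FieldCode → List ℝ → Prop
  | [], [] => True
  | none :: F, x :: y =>
      FieldCode.Presents F y ∧ Transcendental (IntermediateField.adjoin ℚ {z : ℝ | z ∈ y}) x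
  | some f :: F, x :: y =>
      FieldCode.Presents F y ∧
        IsAlgebraic (IntermediateField.adjoin ℚ {z : ℝ | z ∈ y}) x ∧
        ∃ a : ℝ, a ≠ 0 ∧
          PolyCode.eval f ((X : ℝ[X]) :: y.map (fun r => (C r : ℝ[X]))) =
            C a * (minpoly (IntermediateField.adjoin ℚ {z : ℝ | z ∈ y}) x).map
              (algebraMap (IntermediateField.adjoin ℚ {z : ℝ | z ∈ y}) ℝ)
  | [], _ :: _ => False
  | _ :: _, [] => False

/-- A colored edge `(i, j, γ)` of the quotient graph: it goes from `i` to `j` and has color `γ`. -/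
abbrev EdgeCode := ℕ × ℕ × List ℤ

/-- The color of a coded edge as a vector in `ℤ^d`. -/
def EdgeCode.color (e : EdgeCode) (d : ℕ) : Fin d → ℤ := fun k => e.2.2.getD k 0

/-- The code `(d, n, E, F, P, A)` of a framework: the dimension `d`, the number `n` of vertices of the
colored quotient graph, its colored edges `E`, a field code `F`, and two tables of positions in the
list of generators coded by `F`, which say where to find the coordinates of the `n` vertex
representatives (`P`, with `n` rows) and the entries of the lattice matrix (`A`, with `d` rows). -/
abbrev FrameworkCode :=
  ℕ × ℕ × List EdgeCode × FieldCode × List (List ℕ) × List (List ℕ)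

/-- The real number to which the entry in row `i` and column `k` of the table `A` points, in the
list `y` of real numbers (if there is one). -/
def lookupReal (y : List ℝ) (A : List (List ℕ)) (i k : ℕ) : Option ℝ :=
  A[i]?.bind fun row => row[k]?.bind fun t => y[t]?

/-- The code `(d, n, E, F, P, A)` describes the framework `Φ`: for some choice `rep` of one
representative for each vertex orbit, numbered by `Fin n`, the edges of the graph are exactly the
translates of the edges joining `rep i` to `γ + rep j` for `(i, j, γ)` in `E`, and the coordinates of
the representatives and of the lattice matrix are real numbers presented by `F`, at the places given
by `P` and `A`. -/
def FrameworkCode.Describes {d : ℕ} {V : Type*} [AddAction (Fin d → ℤ) V] :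
    FrameworkCode → PeriodicFramework d V → Prop
  | (d', n, E, F, P, A), Φ => d' = d ∧
      ∃ rep : Fin n → V,
        Function.Bijective (fun x : Fin n × (Fin d → ℤ) => x.2 +ᵥ rep x.1) ∧
        (∀ e ∈ E, e.1 < n ∧ e.2.1 < n ∧ e.2.2.length = d) ∧
        (∀ u v : V, Φ.graph.Adj u v ↔
          ∃ i j : Fin n, ∃ e ∈ E, e.1 = i ∧ e.2.1 = j ∧ ∃ δ : Fin d → ℤ,
            (u = δ +ᵥ rep i ∧ v = (δ + EdgeCode.color e d) +ᵥ rep j) ∨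
            (v = δ +ᵥ rep i ∧ u = (δ + EdgeCode.color e d) +ᵥ rep j)) ∧
        ∃ y : List ℝ, FieldCode.Presents F y ∧
          (∀ (i : Fin n) (k : Fin d), lookupReal y P i k = some (Φ.p (rep i) k)) ∧
          (∀ i k : Fin d, lookupReal y A i k = some (Φ.L i k))

/-! Fourier analysis on `(ℤ/N)^d` splits a motion that is periodic under `N ℤ^d`. The lattice
velocity contributes nothing at a nontrivial character, so the component there lies in the kernel of
the rigidity matrix at a nontrivial torsion point of the complex torus. Conversely, a kernel vector
at such a point yields, through its real and imaginary parts, a motion that is not `ℤ^d`-periodic.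
Every subgroup of finite index contains some `N ℤ^d`. Hence ultrarigidity means rigidity for `ℤ^d`
together with the absence of nontrivial torsion points in `flexLocus`, the common zero set of the
maximal minors (`motions_le_of_flexLocus`, `eq_one_of_mem_flexLocus`).

The torsion orders to be tested are bounded by a descent (`exists_torsion_of_bounded_order`) that
uses two properties of `flexLocus`. Along a curve `κ * τ ^ c` the minors are Laurent polynomials of
degree linear in the size of `c`, so sufficiently many points of the curve force all of it into the
locus. Over the field of the coordinates the degree of a root of unity drops by at most a computable
factor `D`, so `ω ↦ ω ^ (g ^ D!)` preserves the torsion points of the locus. If the order `N` is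
divisible by a large square or a large prime, these conjugates of `ω` give many points on a curve
whose exponents are small by Dirichlet approximation. The whole curve then lies in the locus and
supplies a nontrivial torsion point of smaller order. The orders that escape this reduction divide
`torsionBound`.

What remains is two rank computations, for `ℤ^d` and for one explicit sublattice
(`forall_finrank_motions_iff`). They are exact: ranks come from a division-free Gram–Schmidt
process, and a zero test eliminates the generators of the coordinate field one at a time. Since the
inner product on real vectors is definite, a vector vanishes iff a single number, its sum of
squares, does. All steps are primitive recursive. Descriptions exist because each real number is
either transcendental or algebraic over the field generated by the others already listed, and
denominators in a minimal polynomial can be cleared. -/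

/-! ## Torsion points of bounded order -/

/-- The one-parameter curve `τ ↦ (τ ^ c₁, …, τ ^ c_d)` in the algebraic torus. -/
def torusCurve {d : ℕ} (τ : ℂˣ) (c : Fin d → ℤ) : Fin d → ℂˣ := fun i => τ ^ c i

/-- A subset of the torus contains a translate of a one-parameter curve as soon as it contains
sufficiently many of its points, in terms of the exponents of the curve. -/
def CurveClosed {d : ℕ} (V : Set (Fin d → ℂˣ)) (W : ℕ) : Prop :=
  ∀ (κ : Fin d → ℂˣ) (c : Fin d → ℤ) (X : ℕ), (∀ i, |c i| ≤ X) → ∀ S : Finset ℂˣ, W * X < S.card →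
    (∀ τ ∈ S, κ * torusCurve τ c ∈ V) → ∀ τ, κ * torusCurve τ c ∈ V

/-- The torsion points of a subset of the torus are stable under the automorphisms
`ω ↦ ω ^ (g ^ k)`. -/
def PowerClosed {d : ℕ} (V : Set (Fin d → ℂˣ)) (k : ℕ) : Prop :=
  ∀ N > 0, ∀ ω ∈ V, ω ^ N = 1 → ∀ g : ℕ, g.Coprime N → ω ^ (g ^ k) ∈ V

theorem exists_isPrimitiveRoot_units (n : ℕ) (hn : n ≠ 0) : ∃ ζ : ℂˣ, IsPrimitiveRoot ζ n := by
  have h := Complex.isPrimitiveRoot_exp n hn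
  refine ⟨(h.isUnit hn).unit, ?_⟩
  rw [← IsPrimitiveRoot.coe_units_iff]
  exact h

theorem exists_zpow_eq_of_pow_eq_one {d N : ℕ} (hN : N ≠ 0) {ζ : ℂˣ} (hζ : IsPrimitiveRoot ζ N)
    {ω : Fin d → ℂˣ} (hω : ω ^ N = 1) : ∃ t : Fin d → ℤ, ω = torusCurve ζ t := by
  have : NeZero N := ⟨hN⟩
  have h : ∀ i, ∃ t : ℤ, ζ ^ t = ω i := by
    intro i
    have : ω i ∈ rootsOfUnity N ℂ := by
      rw [mem_rootsOfUnity]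
      exact congrFun hω i
    rw [← hζ.zpowers_eq] at this
    exact this
  choose t ht using h
  exact ⟨t, funext fun i => (ht i).symm⟩

/-- Simultaneous Diophantine approximation modulo `q`. -/
theorem exists_small_multiple {d : ℕ} (t : Fin d → ℤ) {q h : ℕ} (hh : 0 < h) (hq : h ^ d < q) :
    ∃ (s : ℕ) (c : Fin d → ℤ) (X : ℕ), 0 < s ∧ s < q ∧ (∀ i, (q : ℤ) ∣ s * t i - c i) ∧
      (∀ i, |c i| ≤ X) ∧ X * h < q := by
  have hq0 : (0 : ℤ) < q := by exact_mod_cast lt_of_le_of_lt (Nat.zero_le _) hq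
  have hh0 : (0 : ℤ) < h := by exact_mod_cast hh
  have key : ∀ (s : ℕ) (i : Fin d), ((h * ((s * t i) % q)) / q : ℤ).toNat < h := by
    intro s i
    have h1 := Int.emod_lt_of_pos (s * t i) hq0
    have h2 := Int.emod_nonneg (s * t i) hq0.ne'
    have : ((h * ((s * t i) % q)) / q : ℤ) < h := by
      apply Int.ediv_lt_of_lt_mul hq0
      exact mul_lt_mul_of_pos_left h1 hh0
    omega
  -- Dirichlet's pigeonhole: the `q` multiples of `t` modulo `q` fall into `h ^ d` boxes of side `q
  -- / h`, and two multiples in one box differ by a small vector.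
  let f : Fin q → (Fin d → Fin h) := fun s i => ⟨_, key s i⟩
  obtain ⟨a, b, hab, hf⟩ := Fintype.exists_ne_map_eq_of_card_lt f (by simpa using hq)
  wlog hlt : a < b generalizing a b
  · exact this b a hab.symm hf.symm (lt_of_le_of_ne (not_lt.mp hlt) hab.symm)
  have hbound : ∀ i, |((b : ℕ) * t i) % q - ((a : ℕ) * t i) % q| * h < (q : ℤ) := by
    intro i
    have hfi := congrArg Fin.val (congrFun hf i)
    simp only [f] at hfi
    have ha2 := Int.emod_nonneg ((a : ℕ) * t i) hq0.ne'
    have hb2 := Int.emod_nonneg ((b : ℕ) * t i) hq0.ne'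
    set x := ((a : ℕ) * t i) % (q : ℤ)
    set y := ((b : ℕ) * t i) % (q : ℤ)
    have hx : 0 ≤ (h * x) / (q : ℤ) := Int.ediv_nonneg (by positivity) hq0.le
    have hy : 0 ≤ (h * y) / (q : ℤ) := Int.ediv_nonneg (by positivity) hq0.le
    have e : (h * x) / (q : ℤ) = (h * y) / (q : ℤ) := by omega
    have e1 := Int.mul_ediv_add_emod (h * x) q
    have e2 := Int.mul_ediv_add_emod (h * y) q
    rw [e] at e1
    have m1 := Int.emod_lt_of_pos (h * x) hq0
    have m2 := Int.emod_nonneg (h * x) hq0.ne'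
    have m3 := Int.emod_lt_of_pos (h * y) hq0
    have m4 := Int.emod_nonneg (h * y) hq0.ne'
    have e3 : |y - x| * h = |(y - x) * h| := by rw [abs_mul, abs_of_pos hh0]
    rw [e3, abs_lt]
    constructor <;> nlinarith
  -- The largest integer `X` with `X * h < q` is `(q - 1) / h`.
  refine ⟨b - a, fun i => ((b : ℕ) * t i) % q - ((a : ℕ) * t i) % q, (q - 1) / h, ?_, ?_, ?_, ?_, ?_⟩
  · have : (a : ℕ) < b := hlt
    omega
  · have := b.2
    omega
  · intro i
    have hle : (a : ℕ) ≤ b := le_of_lt hlt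
    rw [Nat.cast_sub hle]
    have e1 := Int.mul_ediv_add_emod ((a : ℕ) * t i) q
    have e2 := Int.mul_ediv_add_emod ((b : ℕ) * t i) q
    refine ⟨((b : ℕ) * t i) / q - ((a : ℕ) * t i) / q, ?_⟩
    linear_combination (-1 : ℤ) * e2 + e1
  · intro i
    have hb := hbound i
    rw [Int.natCast_div, Int.le_ediv_iff_mul_le hh0]
    have : 1 ≤ q := by omega
    push_cast [Nat.cast_sub this]
    omega
  · have := Nat.div_mul_le_self (q - 1) h
    omega

/-! ### Descent on the order of a torsion point -/

section Descent

variable {d : ℕ} {V : Set (Fin d → ℂˣ)} {W k : ℕ}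

/-- A root of unity of order `|c i| + 1` is not killed by the smaller nonzero exponent `c i`, so it
parametrizes a nontrivial point of the curve. -/
theorem exists_torsion_on_curve {c : Fin d → ℤ} {X : ℕ} (hc : c ≠ 0) (hX : ∀ i, |c i| ≤ X)
    (hV : ∀ τ, torusCurve τ c ∈ V) : ∃ ω ∈ V, ω ≠ 1 ∧ ∃ N, 0 < N ∧ N ≤ X + 1 ∧ ω ^ N = 1 := by
  obtain ⟨i, hi⟩ := Function.ne_iff.mp hc
  obtain ⟨ζ, hζ⟩ := exists_isPrimitiveRoot_units ((c i).natAbs + 1) (by omega)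
  refine ⟨torusCurve ζ c, hV ζ, ?_, (c i).natAbs + 1, by omega, ?_, ?_⟩
  · intro h
    have h1 : ζ ^ c i = 1 := congrFun h i
    rw [hζ.zpow_eq_one_iff_dvd] at h1
    have h2 : 0 < |c i| := abs_pos.mpr hi
    have := Int.le_of_dvd h2 ((dvd_abs _ _).mpr h1)
    rw [Int.abs_eq_natAbs] at this
    omega
  · have := hX i
    rw [Int.abs_eq_natAbs] at this
    omega
  · funext j
    change (ζ ^ c j) ^ ((c i).natAbs + 1) = 1
    rw [← zpow_natCast, ← zpow_mul, mul_comm, zpow_mul, zpow_natCast, hζ.pow_eq_one, one_zpow]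

/-- Write `N = q * M` with `q ∣ M`. The conjugations `g = 1 + M * s * j` multiply `ω` by powers of a
`q`-th root of unity, and since `s * t ≡ c` modulo `q` these conjugates lie on the curve through `ω`
with the small exponents `c`. There are at least `q / k` of them, enough to put the whole curve into
`V`; a suitable point of it has order dividing `M * s < N`. -/
theorem exists_smaller_of_sq_dvd (hcurve : CurveClosed V W) (hpow : PowerClosed V k) {h : ℕ}
    (hh : 0 < h) (hk : 0 < k) (hWk : W * k ≤ h) {N q : ℕ} (hN : 0 < N) (hqN : q ^ 2 ∣ N)
    (hq : h ^ d < q) {ω : Fin d → ℂˣ} (hω : ω ∈ V) (hω1 : ω ≠ 1) (hωN : ω ^ N = 1) :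
    ∃ ω' ∈ V, ω' ≠ 1 ∧ ∃ N', 0 < N' ∧ N' < N ∧ ω' ^ N' = 1 := by
  obtain ⟨ζ, hζ⟩ := exists_isPrimitiveRoot_units N hN.ne'
  obtain ⟨t, rfl⟩ := exists_zpow_eq_of_pow_eq_one hN.ne' hζ hωN
  obtain ⟨s, c, X, hs0, hsq, hsc, hcX, hXq⟩ := exists_small_multiple t hh hq
  have hq0 : 0 < q := by omega
  have hqdvd : q ∣ N := (Dvd.intro_left _ (by ring : q * q = q ^ 2)).trans hqN
  obtain ⟨M, hM⟩ := hqdvd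
  have hM0 : 0 < M := Nat.pos_of_ne_zero (by rintro rfl; omega)
  have hqM : q ∣ M := by
    obtain ⟨r, hr⟩ := hqN
    refine ⟨r, ?_⟩
    apply Nat.eq_of_mul_eq_mul_left hq0
    rw [← hM, hr]
    ring
  have hθ : IsPrimitiveRoot (ζ ^ M) q := hζ.pow hN (by rw [hM, mul_comm])
  have hall : ∀ τ, torusCurve ζ t * torusCurve τ c ∈ V := by
    have hord : orderOf ((ζ ^ M) ^ k) = q / q.gcd k := by
      rw [orderOf_pow' _ hk.ne', ← hθ.eq_orderOf]
    refine hcurve _ c X hcX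
      ((Finset.range (orderOf ((ζ ^ M) ^ k))).image fun j => ((ζ ^ M) ^ k) ^ j) ?_ ?_
    · rw [Finset.card_image_of_injOn, Finset.card_range, hord]
      · have hg0 : 0 < q.gcd k := Nat.gcd_pos_of_pos_left _ hq0
        rw [Nat.lt_div_iff_mul_lt' (Nat.gcd_dvd_left q k)]
        have h1 : q.gcd k ≤ k := Nat.gcd_le_right _ hk
        calc q.gcd k * (W * X) ≤ k * (W * X) := Nat.mul_le_mul_right _ h1
          _ = X * (W * k) := by ring
          _ ≤ X * h := Nat.mul_le_mul_left _ hWk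
          _ < q := hXq
      · intro a ha b hb hab
        exact pow_injOn_Iio_orderOf (by simpa using ha) (by simpa using hb) hab
    · intro τ hτ
      obtain ⟨j, -, rfl⟩ := Finset.mem_image.mp hτ
      have hcop : (1 + M * (s * j)).Coprime N := by
        apply Nat.Coprime.symm
        rw [hM]
        have h1 : M.Coprime (1 + M * (s * j)) := by simp
        exact Nat.Coprime.mul_left (Nat.Coprime.coprime_dvd_left hqM h1) h1
      have h1 := hpow N hN _ hω hωN _ hcop
      convert h1 using 1
      funext i
      change ζ ^ t i * (((ζ ^ M) ^ k) ^ j) ^ c i = (ζ ^ t i) ^ ((1 + M * (s * j)) ^ k)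
      -- The square of `M` vanishes modulo `N`, so the binomial expansion stops after the linear
      -- term.
      have hmod : ∀ n : ℕ, (N : ℤ) ∣ (1 + M * (s * j : ℤ)) ^ n - (1 + M * (s * j) * n) := by
        intro n
        induction n with
        | zero => simp
        | succ n ih =>
          obtain ⟨a, ha⟩ := ih
          obtain ⟨b, hb⟩ := hqM
          refine ⟨a * (1 + M * (s * j)) + b * (s * j) ^ 2 * n, ?_⟩
          rw [pow_succ, sub_eq_iff_eq_add.mp ha, hM]
          push_cast
          have hb' : (M : ℤ) = q * b := by exact_mod_cast hb
          linear_combination (s * j : ℤ) ^ 2 * n * M * hb'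
      obtain ⟨a, ha⟩ := hmod k
      obtain ⟨b, hb⟩ := hsc i
      have hN' : (N : ℤ) = q * M := by exact_mod_cast hM
      simp only [← zpow_natCast, ← zpow_mul, ← zpow_add]
      rw [← mul_inv_eq_one, ← zpow_neg, ← zpow_add, hζ.zpow_eq_one_iff_dvd]
      refine ⟨-(t i * a) - k * j * b, ?_⟩
      push_cast
      rw [sub_eq_iff_eq_add.mp ha, hN']
      linear_combination (-(M * k * j) : ℤ) * hb
  -- With `ζ = ξ ^ (-s)` the point at parameter `ξ` has coordinates `ξ ^ (c i - s * t i)`, whose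
  -- exponents are divisible by `q`; this is what lowers the order.
  obtain ⟨ξ, hξ⟩ : ∃ ξ : ℂˣ, ξ ^ s = ζ⁻¹ := by
    obtain ⟨z, hz⟩ := IsAlgClosed.exists_pow_nat_eq ((ζ⁻¹ : ℂˣ) : ℂ) hs0
    have hz0 : z ≠ 0 := by
      rintro rfl
      rw [zero_pow hs0.ne'] at hz
      exact (ζ⁻¹).ne_zero hz.symm
    exact ⟨Units.mk0 z hz0, Units.ext (by simpa using hz)⟩
  -- If the new point is trivial, the translated curve passes through `1`, hence is the
  -- one-parameter subgroup itself, and a torsion point of small order is taken there.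
  by_cases h1 : torusCurve ζ t * torusCurve ξ c = 1
  · have hc0 : c ≠ 0 := by
      rintro rfl
      apply hω1
      rw [← h1]
      funext i
      simp [torusCurve]
    have hV : ∀ τ, torusCurve τ c ∈ V := by
      intro τ
      convert hall (ξ * τ) using 1
      have e : torusCurve (ξ * τ) c = torusCurve ξ c * torusCurve τ c := by
        funext i
        simp [torusCurve, mul_zpow]
      rw [e, ← mul_assoc, h1, one_mul]
    obtain ⟨ω', hω'V, hω'1, N', hN'0, hN'X, hω'N'⟩ := exists_torsion_on_curve hc0 hcX hV
    refine ⟨ω', hω'V, hω'1, N', hN'0, ?_, hω'N'⟩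
    have hX : X < q := lt_of_le_of_lt (Nat.le_mul_of_pos_right X hh) hXq
    have hq1 : 1 < q := by
      have := Nat.one_le_pow d h hh
      omega
    have := Nat.le_of_dvd hN hqN
    nlinarith
  · refine ⟨_, hall ξ, h1, M * s, by positivity, ?_, ?_⟩
    · rw [hM, mul_comm]
      exact Nat.mul_lt_mul_of_pos_right hsq hM0
    · funext i
      change (ζ ^ t i * ξ ^ c i) ^ (M * s) = 1
      obtain ⟨b, hb⟩ := hsc i
      have hζξ : ζ = ξ ^ (-(s : ℤ)) := by
        rw [zpow_neg, zpow_natCast, hξ, inv_inv]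
      have hξN : ξ ^ ((s : ℤ) * N) = 1 := by
        rw [zpow_mul, zpow_natCast ξ, hξ, zpow_natCast, inv_pow, hζ.pow_eq_one, inv_one]
      have e : (ζ ^ t i * ξ ^ c i) ^ (M * s) = (ξ ^ ((s : ℤ) * N)) ^ (-b) := by
        rw [hζξ]
        simp only [← zpow_natCast, ← zpow_mul, ← zpow_add]
        congr 1
        rw [hM]
        push_cast
        linear_combination (-(M * s) : ℤ) * hb
      rw [e, hξN, one_zpow]

/-- Split `ω` into a part of order dividing `m` and a part of order dividing `p`. Conjugations that
are trivial modulo `m` act on the `p`-part alone, by `k`-th powers modulo `p`. The resulting points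
lie on a curve with small exponents, which is therefore contained in `V`; its point at parameter `1`
is the part of order dividing `m`. -/
theorem exists_smaller_of_prime_dvd (hcurve : CurveClosed V W) (hpow : PowerClosed V k) {h : ℕ}
    (hh : 2 ≤ h) (hk : 0 < k) (hWk : 2 * (W * k) ≤ h) {m p : ℕ} (hp : p.Prime) (hm : 0 < m)
    (hpm : p.Coprime m) (hq : h ^ d < p) {ω : Fin d → ℂˣ} (hω : ω ∈ V) (hω1 : ω ≠ 1)
    (hωN : ω ^ (p * m) = 1) :
    ∃ ω' ∈ V, ω' ≠ 1 ∧ ∃ N', 0 < N' ∧ N' < p * m ∧ ω' ^ N' = 1 := by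
  have : Fact p.Prime := ⟨hp⟩
  have hp0 := hp.pos
  -- The exponents `a` and `b` are the two idempotents modulo `p * m`, so `ω = ω ^ a * ω ^ b`.
  obtain ⟨a, ha1, ha0⟩ := Nat.chineseRemainder hpm.symm 1 0
  obtain ⟨b, hb0, hb1⟩ := Nat.chineseRemainder hpm.symm 0 1
  have hpowmod : ∀ x y : ℕ, x ≡ y [MOD m] → x ≡ y [MOD p] → ω ^ x = ω ^ y := by
    intro x y h1 h2
    have h3 : x ≡ y [MOD p * m] := (Nat.modEq_and_modEq_iff_modEq_mul hpm).mp ⟨h2, h1⟩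
    rw [pow_eq_pow_iff_modEq]
    exact h3.of_dvd (orderOf_dvd_of_pow_eq_one hωN)
  have hβ : (ω ^ b) ^ p = 1 := by
    rw [← pow_mul, ← pow_zero ω]
    apply hpowmod
    · simpa using hb0.mul_right p
    · simp [Nat.ModEq]
  have hκ : (ω ^ a) ^ m = 1 := by
    rw [← pow_mul, ← pow_zero ω]
    apply hpowmod
    · simp [Nat.ModEq]
    · simpa using ha0.mul_right m
  obtain ⟨η, hη⟩ := exists_isPrimitiveRoot_units p hp0.ne'
  obtain ⟨t, ht⟩ := exists_zpow_eq_of_pow_eq_one hp0.ne' hη hβ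
  obtain ⟨s, c, X, hs0, hsq, hsc, hcX, hXq⟩ := exists_small_multiple t (by omega) hq
  have hsp : s.Coprime p := (Nat.coprime_of_lt_prime hs0.ne' hsq hp).symm
  -- Inverting `s` modulo `p` gives `t ≡ r * c`, so the `p`-part of `ω` is the point of the curve at
  -- parameter `η ^ r`.
  obtain ⟨r, hr⟩ : ∃ r : ℕ, r * s ≡ 1 [MOD p] := by
    obtain ⟨r, hr⟩ := Nat.exists_mul_mod_eq_one_of_coprime hsp hp.one_lt
    refine ⟨r, ?_⟩
    rw [Nat.ModEq, mul_comm, hr.2, Nat.mod_eq_of_lt hp.one_lt]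
  have hrp : IsCoprime (r : ℤ) (p : ℤ) := by
    rw [Nat.isCoprime_iff_coprime]
    have : (r * s).Coprime p := by
      rw [Nat.Coprime, hr.gcd_eq]
      simp
    exact Nat.Coprime.coprime_mul_right this
  have hmem : ∀ y : (ZMod p)ˣ, ω ^ a * torusCurve (η ^ (r * ((y ^ k : (ZMod p)ˣ) : ZMod p).val)) c ∈ V := by
    intro y
    obtain ⟨g, hg1, hgy⟩ := Nat.chineseRemainder hpm.symm 1 (y : ZMod p).val
    have hgc : g.Coprime (p * m) := by
      apply Nat.Coprime.mul_right
      · rw [Nat.Coprime, hgy.gcd_eq]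
        exact ZMod.val_coe_unit_coprime y
      · rw [Nat.Coprime, hg1.gcd_eq]
        simp
    have h1 := hpow _ (by positivity) _ hω hωN g hgc
    have e : ω ^ (g ^ k) = ω ^ a * (ω ^ b) ^ ((y ^ k : (ZMod p)ˣ) : ZMod p).val := by
      rw [← pow_mul, ← pow_add]
      apply hpowmod
      · have h2 := (ha1.add (hb0.mul_right ((y ^ k : (ZMod p)ˣ) : ZMod p).val)).symm
        exact (hg1.pow k).trans (by simpa using h2)
      · have h2 : g ^ k ≡ ((y ^ k : (ZMod p)ˣ) : ZMod p).val [MOD p] := by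
          rw [← ZMod.natCast_eq_natCast_iff]
          have h3 := (ZMod.natCast_eq_natCast_iff _ _ _).mpr hgy
          push_cast
          rw [h3]
          simp
        exact h2.trans (by simpa using (ha0.add (hb1.mul_right _)).symm)
    rw [e, ht] at h1
    convert h1 using 2
    funext i
    change (η ^ (r * ((y ^ k : (ZMod p)ˣ) : ZMod p).val)) ^ c i =
      (η ^ t i) ^ ((y ^ k : (ZMod p)ˣ) : ZMod p).val
    obtain ⟨u, hu⟩ := hsc i
    obtain ⟨v, hv⟩ := Nat.modEq_iff_dvd.mp hr
    simp only [← zpow_natCast, ← zpow_mul]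
    rw [← mul_inv_eq_one, ← zpow_neg, ← zpow_add, hη.zpow_eq_one_iff_dvd]
    generalize ((y ^ k : (ZMod p)ˣ) : ZMod p).val = e'
    push_cast at hv ⊢
    refine ⟨-(r * e' * u) - e' * t i * v, ?_⟩
    linear_combination (-(r * e')) * hu - e' * t i * hv
  have hall : ∀ τ, ω ^ a * torusCurve τ c ∈ V := by
    classical
    -- There are `(p - 1) / gcd (p - 1) k` many `k`-th powers; the factor `2` in `hWk` absorbs the
    -- loss from `p` to `p - 1`.
    let R := (powMonoidHom k : (ZMod p)ˣ →* (ZMod p)ˣ).range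
    have : Fintype R := Fintype.ofFinite _
    refine hcurve _ c X hcX
      ((Finset.univ : Finset R).image fun x : R => η ^ (r * ((x : (ZMod p)ˣ) : ZMod p).val)) ?_ ?_
    · rw [Finset.card_image_of_injective, Finset.card_univ, ← Nat.card_eq_fintype_card,
        IsCyclic.card_powMonoidHom_range, Nat.card_eq_fintype_card, ZMod.card_units]
      · rw [Nat.lt_div_iff_mul_lt' (Nat.gcd_dvd_left _ _)]
        have h1 : (p - 1).gcd k ≤ k := Nat.gcd_le_right _ hk
        have h2 : 2 * ((p - 1).gcd k * (W * X)) < p :=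
          calc 2 * ((p - 1).gcd k * (W * X)) ≤ 2 * (k * (W * X)) := by gcongr
            _ = X * (2 * (W * k)) := by ring
            _ ≤ X * h := Nat.mul_le_mul_left _ hWk
            _ < p := hXq
        have := hp.two_le
        omega
      · intro x y hxy
        simp only [← zpow_natCast] at hxy
        rw [← mul_inv_eq_one, ← zpow_neg, ← zpow_add, hη.zpow_eq_one_iff_dvd] at hxy
        push_cast at hxy
        rw [← sub_eq_add_neg, ← mul_sub] at hxy
        have h2 := hrp.symm.dvd_of_dvd_mul_left hxy
        apply Subtype.ext
        apply Units.ext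
        apply ZMod.val_injective
        exact (Nat.ModEq.eq_of_lt_of_lt (Nat.modEq_iff_dvd.mpr h2) (ZMod.val_lt _)
          (ZMod.val_lt _)).symm
    · intro τ hτ
      obtain ⟨⟨x, y, rfl⟩, -, rfl⟩ := Finset.mem_image.mp hτ
      exact hmem y
  have hκV : ω ^ a ∈ V := by
    have h1 := hall 1
    have e : torusCurve 1 c = 1 := by
      funext i
      simp [torusCurve]
    rwa [e, mul_one] at h1
  by_cases h1 : ω ^ a = 1
  -- If `c` were zero, the `p`-part of `ω` would be trivial too, contradicting `ω ≠ 1`.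
  · have hc0 : c ≠ 0 := by
      rintro rfl
      apply hω1
      have h2 : ω ^ b = 1 := by
        rw [ht]
        funext i
        obtain ⟨u, hu⟩ := hsc i
        obtain ⟨v, hv⟩ := Nat.modEq_iff_dvd.mp hr
        change η ^ t i = 1
        rw [hη.zpow_eq_one_iff_dvd]
        refine ⟨r * u + t i * v, ?_⟩
        push_cast at hv
        simp only [Pi.zero_apply] at hu
        linear_combination r * hu + t i * hv
      have h3 : ω ^ (a + b) = ω ^ 1 := by
        apply hpowmod
        · simpa using ha1.add hb0
        · simpa using ha0.add hb1
      rw [pow_one, pow_add, h1, h2, one_mul] at h3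
      exact h3.symm
    obtain ⟨ω', hω'V, hω'1, N', hN'0, hN'X, hω'N'⟩ :=
      exists_torsion_on_curve hc0 hcX (fun τ => by simpa [h1] using hall τ)
    refine ⟨ω', hω'V, hω'1, N', hN'0, ?_, hω'N'⟩
    have hX0 : 0 < X := by
      obtain ⟨i, hi⟩ := Function.ne_iff.mp hc0
      have h2 := hcX i
      have h3 : 0 < |c i| := abs_pos.mpr hi
      omega
    have : p ≤ p * m := Nat.le_mul_of_pos_right _ hm
    have : X * 2 ≤ X * h := Nat.mul_le_mul_left _ hh
    omega
  · refine ⟨_, hκV, h1, m, hm, ?_, hκ⟩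
    have := hp.two_le
    nlinarith

/-- The order up to which torsion points have to be inspected. -/
def torsionBound (d W k : ℕ) : ℕ := (((2 * (W * k) + 2) ^ d).factorial) ^ 3

theorem torsionBound_pos (d W k : ℕ) : 0 < torsionBound d W k :=
  pow_pos (Nat.factorial_pos _) _

/-- Write `N = q ^ 2 * r` with `r` squarefree. Both `q` and `r`, a product of distinct primes up to
`B`, divide `B!`, whence the exponent three. -/
theorem dvd_factorial_pow_three {N B : ℕ} (hN : 0 < N) (hsq : ∀ q, q ^ 2 ∣ N → q ≤ B)
    (hp : ∀ p, p.Prime → p ∣ N → p ≤ B) : N ∣ B.factorial ^ 3 := by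
  obtain ⟨r, q, hqr, hr⟩ := Nat.sq_mul_squarefree N
  have hq0 : 0 < q := Nat.pos_of_ne_zero (by rintro rfl; simp at hqr; omega)
  have h1 : q ∣ B.factorial :=
    Nat.dvd_factorial hq0 (hsq q (Dvd.intro r hqr))
  have h2 : r ∣ B.factorial := by
    rw [← Nat.prod_primeFactors_of_squarefree hr]
    apply Finset.prod_primes_dvd
    · intro p hp'
      exact (Nat.prime_of_mem_primeFactors hp').prime
    · intro p hp'
      have hpp := Nat.prime_of_mem_primeFactors hp'
      exact Nat.dvd_factorial hpp.pos
        (hp p hpp ((Nat.dvd_of_mem_primeFactors hp').trans (Dvd.intro_left _ hqr)))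
  rw [← hqr, pow_succ]
  exact mul_dvd_mul (pow_dvd_pow_of_dvd h1 2) h2

/-- Torsion points of bounded order: if a suitable subset of the torus contains a nontrivial torsion
point, then it contains one of bounded order. -/
theorem exists_torsion_of_bounded_order (hcurve : CurveClosed V W) (hpow : PowerClosed V k)
    (hk : 0 < k) {N : ℕ} (hN : 0 < N) {ω : Fin d → ℂˣ} (hω : ω ∈ V) (hω1 : ω ≠ 1)
    (hωN : ω ^ N = 1) : ∃ ω ∈ V, ω ≠ 1 ∧ ω ^ torsionBound d W k = 1 := by
  induction N using Nat.strong_induction_on generalizing ω with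
  | _ N ih =>
    by_cases hsq : ∃ q, q ^ 2 ∣ N ∧ (2 * (W * k) + 2) ^ d < q
    · obtain ⟨q, hqN, hq⟩ := hsq
      obtain ⟨ω', hω', hω'1, N', hN'0, hN', h⟩ := exists_smaller_of_sq_dvd hcurve hpow
        (by omega) hk (by omega) hN hqN hq hω hω1 hωN
      exact ih N' hN' hN'0 hω' hω'1 h
    by_cases hpr : ∃ p, p.Prime ∧ p ∣ N ∧ (2 * (W * k) + 2) ^ d < p
    · obtain ⟨p, hpp, ⟨m, rfl⟩, hpB⟩ := hpr
      -- A large prime whose square divides the order belongs to the previous case.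
      have hpm : p.Coprime m := by
        rw [hpp.coprime_iff_not_dvd]
        intro hdvd
        exact hsq ⟨p, by rw [sq]; exact mul_dvd_mul_left p hdvd, hpB⟩
      obtain ⟨ω', hω', hω'1, N', hN'0, hN', h⟩ := exists_smaller_of_prime_dvd hcurve hpow
        (by omega) hk (by omega) hpp (Nat.pos_of_mul_pos_left hN) hpm hpB hω hω1 hωN
      exact ih N' hN' hN'0 hω' hω'1 h
    push Not at hsq hpr
    obtain ⟨e, he⟩ := dvd_factorial_pow_three hN hsq hpr
    exact ⟨ω, hω, hω1, by rw [torsionBound, he, pow_mul, hωN, one_pow]⟩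

end Descent

/-! ## Galois action on roots of unity over finitely generated real fields -/

/-- If the cyclotomic degree drops at most by the factor `D` over the field `K`, then the substitution
`ζ ↦ ζ ^ (g ^ D!)` preserves the algebraic relations over `K`. -/
theorem aeval_pow_factorial_eq_zero {K : Type*} [Field K] [Algebra K ℂ] {N D : ℕ} (hN : 0 < N)
    {ζ : ℂ} (hζ : IsPrimitiveRoot ζ N) (hD : N.totient ≤ D * (minpoly K ζ).natDegree)
    {g : ℕ} (hg : g.Coprime N) {P : K[X]} (hP : aeval ζ P = 0) :
    aeval (ζ ^ (g ^ D.factorial)) P = 0 := by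
  have : NeZero N := ⟨hN.ne'⟩
  have : CharZero K := ((algebraMap K ℂ).charZero_iff (algebraMap K ℂ).injective).mpr inferInstance
  have hint : IsIntegral K ζ := (hζ.isIntegral hN).tower_top
  have hval : ∀ m n : ℕ, (m : ZMod N) = n → ζ ^ m = ζ ^ n := by
    intro m n h
    rw [ZMod.natCast_eq_natCast_iff] at h
    rw [← pow_mod_orderOf, ← pow_mod_orderOf ζ n, ← hζ.eq_orderOf, h]
  have hdvd : ∀ m n : ℕ, aeval (ζ ^ m) (minpoly K ζ) = 0 → aeval (ζ ^ n) (minpoly K ζ) = 0 →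
      aeval (ζ ^ (m * n)) (minpoly K ζ) = 0 := by
    intro m n h1 h2
    have h3 : minpoly K ζ ∣ expand K m (minpoly K ζ) := by
      apply minpoly.dvd K ζ
      rw [expand_aeval, h1]
    obtain ⟨q, hq⟩ := h3
    have h4 : aeval (ζ ^ n) (expand K m (minpoly K ζ)) = 0 := by
      rw [hq, map_mul, h2, zero_mul]
    rwa [expand_aeval, ← pow_mul, mul_comm] at h4
  -- These are the exponents that send `ζ` to a conjugate over `K`, that is, the image of the Galois
  -- group in `(ℤ/N)ˣ`. Closure under products holds because `ζ ^ m` is a root of the minimal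
  -- polynomial only if that polynomial divides its own expansion by `m`.
  let G₀ : Submonoid (ZMod N)ˣ :=
    { carrier := {u | aeval (ζ ^ (u : ZMod N).val) (minpoly K ζ) = 0}
      one_mem' := by
        have : ζ ^ ((1 : (ZMod N)ˣ) : ZMod N).val = ζ := by
          conv_rhs => rw [← pow_one ζ]
          apply hval
          simp
        simp only [Set.mem_ofPred_eq]
        rw [this, minpoly.aeval]
      mul_mem' := by
        intro a b ha hb
        have h := hdvd _ _ ha hb
        have e : ζ ^ ((a : ZMod N).val * (b : ZMod N).val) = ζ ^ ((a * b : (ZMod N)ˣ) : ZMod N).val := by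
          apply hval
          simp
        simp only [Set.mem_ofPred_eq]
        rwa [e] at h }
  let G : Subgroup (ZMod N)ˣ :=
    { G₀ with
      inv_mem' := by
        intro x hx
        have h1 : x⁻¹ = x ^ (orderOf x - 1) := by
          rw [inv_eq_iff_mul_eq_one, ← pow_succ', Nat.sub_add_cancel (orderOf_pos x),
            pow_orderOf_eq_one]
        change x⁻¹ ∈ G₀
        rw [h1]
        exact G₀.pow_mem hx _ }
  have hcyc : ∀ z : ℂ, aeval z (minpoly K ζ) = 0 → IsPrimitiveRoot z N := by
    intro z hz
    have h1 : minpoly K ζ ∣ cyclotomic N K := by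
      apply minpoly.dvd K ζ
      rw [aeval_def, eval₂_eq_eval_map, map_cyclotomic]
      exact hζ.isRoot_cyclotomic hN
    obtain ⟨q, hq⟩ := h1
    have h2 : aeval z (cyclotomic N K) = 0 := by rw [hq, map_mul, hz, zero_mul]
    rw [aeval_def, eval₂_eq_eval_map, map_cyclotomic] at h2
    exact isRoot_cyclotomic_iff.mp h2
  have hcard : (minpoly K ζ).natDegree ≤ Nat.card G := by
    classical
    have h1 : Fintype.card ((minpoly K ζ).rootSet ℂ) = (minpoly K ζ).natDegree :=
      card_rootSet_eq_natDegree (minpoly.irreducible hint).separable (IsAlgClosed.splits _)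
    rw [← h1, ← Nat.card_eq_fintype_card]
    apply Nat.card_le_card_of_surjective (fun u : G => (⟨ζ ^ ((u : (ZMod N)ˣ) : ZMod N).val, by
      rw [mem_rootSet]
      exact ⟨minpoly.ne_zero hint, u.2⟩⟩ : (minpoly K ζ).rootSet ℂ))
    rintro ⟨z, hz⟩
    rw [mem_rootSet] at hz
    obtain ⟨i, -, hi, rfl⟩ := hζ.isPrimitiveRoot_iff.mp (hcyc z hz.2)
    have e : ζ ^ ((ZMod.unitOfCoprime i hi : (ZMod N)ˣ) : ZMod N).val = ζ ^ i := by
      apply hval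
      simp
    refine ⟨⟨ZMod.unitOfCoprime i hi, ?_⟩, ?_⟩
    · change aeval (ζ ^ ((ZMod.unitOfCoprime i hi : (ZMod N)ˣ) : ZMod N).val) (minpoly K ζ) = 0
      rw [e]
      exact hz.2
    · exact Subtype.ext e
  have hindex : G.index ≤ D := by
    have h1 := G.card_mul_index
    rw [Nat.card_eq_fintype_card (α := (ZMod N)ˣ), ZMod.card_units_eq_totient] at h1
    have h2 : 0 < Nat.card G := Nat.card_pos
    have h3 : Nat.card G * G.index ≤ Nat.card G * D := by
      rw [h1, mul_comm _ D]
      exact hD.trans (Nat.mul_le_mul_left _ hcard)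
    exact Nat.le_of_mul_le_mul_left h3 h2
  -- The index of `G` is unknown but at most `D`, so it divides `D!`; this explains the factorial.
  have hmem : (ZMod.unitOfCoprime g hg) ^ D.factorial ∈ G := by
    obtain ⟨r, hr⟩ := Nat.dvd_factorial (Nat.pos_of_ne_zero G.index_ne_zero_of_finite) hindex
    rw [hr, pow_mul]
    exact G.pow_mem (G.pow_index_mem _) _
  have hroot : aeval (ζ ^ (g ^ D.factorial)) (minpoly K ζ) = 0 := by
    have h1 : aeval (ζ ^ (((ZMod.unitOfCoprime g hg) ^ D.factorial : (ZMod N)ˣ) : ZMod N).val)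
      (minpoly K ζ) = 0 := hmem
    have e : ζ ^ (((ZMod.unitOfCoprime g hg) ^ D.factorial : (ZMod N)ˣ) : ZMod N).val =
        ζ ^ (g ^ D.factorial) := by
      apply hval
      simp
    rwa [e] at h1
  obtain ⟨q, hq⟩ := minpoly.dvd K ζ hP
  rw [hq, map_mul, hroot, zero_mul]

/-- The degree of `ζ` over `K` is at most `[K(x, ζ) : K]`, which is multiplicative in the tower over
`K(x)`. -/
theorem natDegree_minpoly_le_of_algebraic {K : Type*} [Field K] [Algebra K ℝ] {x : ℝ}
    (hx : IsIntegral K x) {ζ : ℂ} [Algebra K ℂ] [IsScalarTower K ℝ ℂ] (hζ : IsIntegral K ζ) :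
    (minpoly K ζ).natDegree ≤
      (minpoly K x).natDegree * (minpoly (IntermediateField.adjoin K {x}) ζ).natDegree := by
  let A := IntermediateField.adjoin K {x}
  have hζA : IsIntegral A ζ := hζ.tower_top
  let B := IntermediateField.adjoin A {ζ}
  have : FiniteDimensional K A := IntermediateField.adjoin.finiteDimensional hx
  have : FiniteDimensional A B := IntermediateField.adjoin.finiteDimensional hζA
  have : FiniteDimensional K B := FiniteDimensional.trans K A B
  have : Module.Free A B := Module.Free.of_divisionRing A B
  rw [← IntermediateField.adjoin.finrank hx, ← IntermediateField.adjoin.finrank hζA]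
  change _ ≤ Module.finrank K A * Module.finrank A B
  rw [Module.finrank_mul_finrank]
  have h1 := minpoly.natDegree_le (A := K) (IntermediateField.AdjoinSimple.gen A ζ)
  have : IsScalarTower K B ℂ := IsScalarTower.of_algebraMap_eq fun z => rfl
  have h2 : minpoly K ζ = minpoly K (IntermediateField.AdjoinSimple.gen A ζ) := by
    rw [← minpoly.algebraMap_eq (B' := ℂ) (A := K) (algebraMap B ℂ).injective]
    rw [IntermediateField.AdjoinSimple.algebraMap_gen]
  rwa [h2]

/-- Clear denominators in the equation of `ζ` over `K(x)` and regard it as a polynomial in `x` over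
`K(ζ)`. Since `x` stays transcendental over `K(ζ)`, every coefficient vanishes, and one of them is a
nonzero equation for `ζ` over `K` of no larger degree. -/
theorem natDegree_minpoly_le_of_transcendental {K : Type*} [Field K] [Algebra K ℝ] {x : ℝ}
    (hx : Transcendental K x) {ζ : ℂ} [Algebra K ℂ] [IsScalarTower K ℝ ℂ] (hζ : IsIntegral K ζ) :
    (minpoly K ζ).natDegree ≤ (minpoly (IntermediateField.adjoin K {x}) ζ).natDegree := by
  set A := IntermediateField.adjoin K {x} with hA
  have hζA : IsIntegral A ζ := hζ.tower_top
  set q := minpoly A ζ with hq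
  have hfrac : ∀ i : ℕ, ∃ a b : K[X], b ≠ 0 ∧ aeval x a = (q.coeff i : ℝ) * aeval x b := by
    intro i
    obtain ⟨r, s, hrs⟩ := (IntermediateField.mem_adjoin_simple_iff K _).mp (q.coeff i).2
    by_cases hs : s = 0
    · refine ⟨0, 1, one_ne_zero, ?_⟩
      rw [hrs, hs]
      simp
    · have : aeval x s ≠ 0 := fun h => hs ((transcendental_iff.mp hx) s h)
      exact ⟨r, s, hs, by rw [hrs, div_mul_cancel₀ _ this]⟩
  choose a b hb hab using hfrac
  set n := q.natDegree
  let Q := ∏ i ∈ Finset.range (n + 1), b i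
  have hQ : Q ≠ 0 := Finset.prod_ne_zero_iff.mpr fun i _ => hb i
  let p : ℕ → K[X] := fun i => a i * ∏ j ∈ (Finset.range (n + 1)).erase i, b j
  have hp : ∀ i ∈ Finset.range (n + 1), aeval x (p i) = (q.coeff i : ℝ) * aeval x Q := by
    intro i hi
    simp only [p, Q]
    rw [map_mul, hab, ← Finset.mul_prod_erase _ _ hi, map_mul, mul_assoc]
  have hsum : ∑ i ∈ Finset.range (n + 1), ((aeval x (p i) : ℝ) : ℂ) * ζ ^ i = 0 := by
    have h1 : aeval ζ q = 0 := minpoly.aeval A ζ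
    rw [aeval_eq_sum_range] at h1
    have h2 : ∑ i ∈ Finset.range (n + 1), ((aeval x (p i) : ℝ) : ℂ) * ζ ^ i =
        ((aeval x Q : ℝ) : ℂ) * ∑ i ∈ Finset.range (q.natDegree + 1), q.coeff i • ζ ^ i := by
      rw [Finset.mul_sum]
      apply Finset.sum_congr rfl
      intro i hi
      rw [hp i hi, Algebra.smul_def]
      have : (algebraMap A ℂ) (q.coeff i) = ((q.coeff i : ℝ) : ℂ) := rfl
      rw [this]
      push_cast
      ring
    rw [h2, h1, mul_zero]
  have hlead : p n ≠ 0 := by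
    intro h0
    have h1 := hp n (Finset.self_mem_range_succ n)
    rw [h0, map_zero, (show q.coeff n = 1 from minpoly.monic hζA)] at h1
    simp only [OneMemClass.coe_one, one_mul] at h1
    exact hQ ((transcendental_iff.mp hx) Q h1.symm)
  -- Extracting this power of `x` keeps the term in `ζ ^ n`, so the resulting equation over `K` is
  -- not trivial.
  obtain ⟨k, hk⟩ : ∃ k, (p n).coeff k ≠ 0 := by
    by_contra! h
    exact hlead (Polynomial.ext h)
  let B := IntermediateField.adjoin K {ζ}
  have hfin : FiniteDimensional K B := IntermediateField.adjoin.finiteDimensional hζ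
  have hxB : Transcendental B (x : ℂ) := by
    intro h
    have h1 : IsAlgebraic K ((algebraMap ℝ ℂ) x) := IsAlgebraic.restrictScalars K h
    exact hx ((isAlgebraic_algebraMap_iff (algebraMap ℝ ℂ).injective).mp h1)
  let R : B[X] := ∑ i ∈ Finset.range (n + 1),
    (p i).map (algebraMap K B) * C (IntermediateField.AdjoinSimple.gen K ζ ^ i)
  have hR : aeval (x : ℂ) R = 0 := by
    rw [← hsum]
    simp only [R, map_sum, map_mul]
    apply Finset.sum_congr rfl
    intro i _
    have h1 : aeval (x : ℂ) ((p i).map (algebraMap K B)) = ((aeval x (p i) : ℝ) : ℂ) := by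
      rw [aeval_map_algebraMap]
      exact (aeval_algebraMap_apply ℂ x (p i))
    rw [h1, aeval_C, map_pow, IntermediateField.AdjoinSimple.algebraMap_gen]
  have hR0 : R = 0 := (transcendental_iff.mp hxB) R hR
  have hcoef : ∑ i ∈ Finset.range (n + 1), algebraMap K ℂ ((p i).coeff k) * ζ ^ i = 0 := by
    have h1 : algebraMap B ℂ (R.coeff k) = 0 := by rw [hR0]; simp
    rw [← h1]
    simp only [R, finsetSum_coeff, coeff_mul_C, coeff_map, map_sum]
    apply Finset.sum_congr rfl
    intro i _
    rw [map_mul, map_pow, IntermediateField.AdjoinSimple.algebraMap_gen]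
    rfl
  let S : K[X] := ∑ i ∈ Finset.range (n + 1), C ((p i).coeff k) * X ^ i
  have hS0 : S ≠ 0 := by
    intro h
    have h1 : S.coeff n = (p n).coeff k := by
      simp [S, coeff_X_pow]
    rw [h] at h1
    exact hk h1.symm
  have hSζ : aeval ζ S = 0 := by
    rw [← hcoef]
    simp [S, map_sum]
  have hSdeg : S.natDegree ≤ n := by
    apply natDegree_sum_le_of_forall_le
    intro i hi
    exact (natDegree_C_mul_X_pow_le _ _).trans (by simpa [Nat.lt_succ_iff] using hi)
  exact (natDegree_le_of_dvd (minpoly.dvd K ζ hSζ) hS0).trans hSdeg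

/-- The sum of the exponents of the first variable in a coded polynomial. -/
def PolyCode.headDegree (f : PolyCode) : ℕ := (f.map fun t => t.2.headI).sum

theorem prod_zipWith_pow_C {R : Type*} [CommRing R] (y : List R) (es : List ℕ) :
    (List.zipWith (fun a e => a ^ e) (y.map fun r => (C r : R[X])) es).prod =
      C (List.zipWith (fun a e => a ^ e) y es).prod := by
  induction y generalizing es with
  | nil => simp
  | cons a y ihy =>
    cases es with
    | nil => simp
    | cons e es => simp [ihy es]

theorem PolyCode.natDegree_eval_le (f : PolyCode) (y : List ℝ) :
    (PolyCode.eval f ((X : ℝ[X]) :: y.map fun r => C r)).natDegree ≤ f.headDegree := by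
  induction f with
  | nil => simp [PolyCode.eval, PolyCode.headDegree]
  | cons t f ih =>
    have e : PolyCode.eval (t :: f) ((X : ℝ[X]) :: y.map fun r => C r) =
      (t.1 : ℝ[X]) * (List.zipWith (fun a e => a ^ e) ((X : ℝ[X]) :: y.map fun r => C r) t.2).prod +
        PolyCode.eval f ((X : ℝ[X]) :: y.map fun r => C r) := by
      simp [PolyCode.eval]
    have e' : PolyCode.headDegree (t :: f) = t.2.headI + PolyCode.headDegree f := by
      simp [PolyCode.headDegree]
    rw [e, e']
    refine (natDegree_add_le _ _).trans (max_le ?_ (ih.trans (by omega)))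
    obtain ⟨c, es⟩ := t
    cases es with
    | nil => simp
    | cons e es =>
      have hr := prod_zipWith_pow_C y es
      set r := (List.zipWith (fun a e => a ^ e) y es).prod
      simp only [List.zipWith_cons_cons, List.prod_cons, hr, List.headI_cons]
      rw [← map_intCast (C : ℝ →+* ℝ[X]), mul_left_comm, ← C_mul]
      refine (natDegree_mul_C_le _ _).trans ?_
      rw [natDegree_X_pow]
      omega

/-- A bound for the degree of a presented field over a purely transcendental subfield. -/
def FieldCode.degreeBound (F : FieldCode) : ℕ :=
  (F.map fun o => o.elim 1 fun f => f.headDegree + 1).prod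

/-- Both fields are the same subset of `ℝ` but distinct types; restriction of scalars identifies
them. -/
theorem natDegree_minpoly_adjoin_insert (S : Set ℝ) (x : ℝ) (ζ : ℂ) :
    (minpoly (IntermediateField.adjoin (IntermediateField.adjoin ℚ S) {x}) ζ).natDegree =
      (minpoly (IntermediateField.adjoin ℚ (insert x S)) ζ).natDegree := by
  have h : ∀ (A : IntermediateField (IntermediateField.adjoin ℚ S) ℝ) (B : IntermediateField ℚ ℝ),
      A.restrictScalars ℚ = B → (minpoly A ζ).natDegree = (minpoly B ζ).natDegree := by
    rintro A B rfl
    rfl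
  apply h
  rw [← Set.union_singleton]
  exact IntermediateField.adjoin_adjoin_left ℚ S {x}

/-- Over `ℚ` the degree of `ζ` is `φ(N)` by irreducibility of the cyclotomic polynomial. A
transcendental generator does not lower it, and an algebraic one divides it by at most its own
degree, which the exponents in its code bound. -/
theorem FieldCode.Presents.totient_le {F : FieldCode} {y : List ℝ} (h : F.Presents y) {N : ℕ}
    (hN : 0 < N) {ζ : ℂ} (hζ : IsPrimitiveRoot ζ N) :
    N.totient ≤ F.degreeBound *
      (minpoly (IntermediateField.adjoin ℚ {z : ℝ | z ∈ y}) ζ).natDegree := by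
  induction F generalizing y with
  | nil =>
    cases y with
    | nil =>
      have hint : IsIntegral ℚ ζ := (hζ.isIntegral hN).tower_top
      have hbot : IntermediateField.adjoin ℚ {z : ℝ | z ∈ ([] : List ℝ)} = ⊥ := by simp
      rw [hbot, ← natDegree_cyclotomic N ℚ, cyclotomic_eq_minpoly_rat hζ hN]
      simp only [FieldCode.degreeBound, List.map_nil, List.prod_nil, one_mul]
      set q := minpoly (⊥ : IntermediateField ℚ ℝ) ζ
      have hq : q.natDegree =
        (q.map ((IntermediateField.botEquiv ℚ ℝ : _ ≃ₐ[ℚ] ℚ) : _ →+* ℚ)).natDegree :=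
        (natDegree_map _).symm
      rw [hq]
      apply natDegree_le_of_dvd
      · apply minpoly.dvd
        rw [aeval_def, eval₂_map]
        have e : (algebraMap ℚ ℂ).comp ((IntermediateField.botEquiv ℚ ℝ : _ ≃ₐ[ℚ] ℚ) :
          (⊥ : IntermediateField ℚ ℝ) →+* ℚ) = algebraMap _ ℂ := by
          ext z
          obtain ⟨w, rfl⟩ := (IntermediateField.botEquiv ℚ ℝ).symm.surjective z
          simp
        rw [e]
        exact minpoly.aeval _ ζ
      · rw [Polynomial.map_ne_zero_iff (RingHom.injective _)]
        exact minpoly.ne_zero hint.tower_top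
    | cons _ _ => exact h.elim
  | cons o F ih =>
    cases y with
    | nil => cases o <;> exact h.elim
    | cons x y =>
      have hset : {z : ℝ | z ∈ x :: y} = insert x {z : ℝ | z ∈ y} := by
        ext z
        simp
      have hint : IsIntegral (IntermediateField.adjoin ℚ {z : ℝ | z ∈ y}) ζ :=
        (hζ.isIntegral hN).tower_top
      rw [hset, ← natDegree_minpoly_adjoin_insert]
      cases o with
      | none =>
        obtain ⟨hF, hx⟩ := h
        refine (ih hF).trans ?_
        have := natDegree_minpoly_le_of_transcendental hx hint
        simpa [FieldCode.degreeBound] using Nat.mul_le_mul_left _ this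
      | some f =>
        obtain ⟨hF, hx, a, ha, hf⟩ := h
        refine (ih hF).trans ?_
        have h1 := natDegree_minpoly_le_of_algebraic hx.isIntegral hint
        have h2 := PolyCode.natDegree_eval_le f y
        rw [hf, natDegree_C_mul ha, natDegree_map] at h2
        have e : FieldCode.degreeBound (some f :: F) = (f.headDegree + 1) * FieldCode.degreeBound F := by
          simp [FieldCode.degreeBound]
        rw [e, mul_comm _ (FieldCode.degreeBound F), mul_assoc]
        apply Nat.mul_le_mul_left
        exact h1.trans (Nat.mul_le_mul_right _ (by omega))

/-! ## Colored quotient graphs and their rigidity matrices on the torus -/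

/-- A colored graph with `n` vertices and `m` edges, and a direction vector for every edge. -/
structure ColoredBars (d n m : ℕ) where
  src : Fin m → Fin n
  tgt : Fin m → Fin n
  color : Fin m → Fin d → ℤ
  dir : Fin m → Fin d → ℝ

/-- The value of the character `ω` of `ℤ^d` at `γ`. -/
def torusChar {d : ℕ} (ω : Fin d → ℂˣ) (γ : Fin d → ℤ) : ℂˣ := ∏ l, ω l ^ γ l

theorem torusChar_add {d : ℕ} (ω : Fin d → ℂˣ) (γ δ : Fin d → ℤ) :
    torusChar ω (γ + δ) = torusChar ω γ * torusChar ω δ := by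
  simp [torusChar, zpow_add, Finset.prod_mul_distrib]

theorem torusChar_mul {d : ℕ} (ω κ : Fin d → ℂˣ) (γ : Fin d → ℤ) :
    torusChar (ω * κ) γ = torusChar ω γ * torusChar κ γ := by
  simp [torusChar, mul_zpow, Finset.prod_mul_distrib]

theorem torusChar_pow {d : ℕ} (ω : Fin d → ℂˣ) (k : ℕ) (γ : Fin d → ℤ) :
    torusChar (ω ^ k) γ = torusChar ω γ ^ k := by
  simp only [torusChar, Pi.pow_apply, ← Finset.prod_pow]
  refine Finset.prod_congr rfl fun l _ => ?_
  rw [← zpow_natCast, ← zpow_natCast, zpow_comm]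

theorem torusChar_torusCurve {d : ℕ} (τ : ℂˣ) (c γ : Fin d → ℤ) :
    torusChar (torusCurve τ c) γ = τ ^ (∑ l, c l * γ l) := by
  simp only [torusChar, torusCurve, ← zpow_mul]
  exact (map_sum (zpowersHom ℂˣ τ).toAdditiveRight (fun l => c l * γ l) Finset.univ).symm

theorem torusChar_single {d : ℕ} (ω : Fin d → ℂˣ) (l : Fin d) :
    torusChar ω (Pi.single l 1) = ω l := by
  rw [torusChar, Finset.prod_eq_single l]
  · simp
  · intro b _ hb
    simp [hb]
  · simp

theorem torusChar_zero {d : ℕ} (ω : Fin d → ℂˣ) : torusChar ω 0 = 1 := by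
  simp [torusChar]

theorem torusChar_eq_one {d N : ℕ} {ω : Fin d → ℂˣ} (hω : ω ^ N = 1) {γ : Fin d → ℤ}
    (hγ : ∀ l, (N : ℤ) ∣ γ l) : torusChar ω γ = 1 := by
  apply Finset.prod_eq_one
  intro l _
  obtain ⟨a, ha⟩ := hγ l
  have h : ω l ^ N = 1 := congrFun hω l
  rw [ha, zpow_mul, zpow_natCast, h, one_zpow]

/-- A rectangular matrix over a field has a nonzero kernel iff all its maximal minors vanish. -/
theorem exists_mulVec_eq_zero_iff_minors {F : Type*} [Field F] {m n : Type*} [Fintype m]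
    [Fintype n] [DecidableEq n] (A : Matrix m n F) :
    (∃ z ≠ 0, A.mulVec z = 0) ↔ ∀ s : n → m, (A.submatrix s id).det = 0 := by
  constructor
  · rintro ⟨z, hz, hAz⟩ s
    rw [← Matrix.exists_mulVec_eq_zero_iff]
    refine ⟨z, hz, funext fun i => ?_⟩
    exact congrFun hAz (s i)
  · intro h
    by_contra! hker
    -- A trivial kernel forces full row rank, and independent rows spanning the row space then give
    -- a nonzero maximal minor.
    have hrank : Module.finrank F (Submodule.span F (Set.range A.row)) = Fintype.card n := by
      rw [← Matrix.rank_eq_finrank_span_row]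
      have hinj : Function.Injective A.mulVecLin := by
        rw [← LinearMap.ker_eq_bot, LinearMap.ker_eq_bot']
        intro z hz
        by_contra h0
        exact hker z h0 hz
      rw [Matrix.rank, LinearMap.finrank_range_of_inj hinj, Module.finrank_fintype_fun_eq_card]
    obtain ⟨f, hf, -, hli⟩ := Submodule.exists_fun_fin_finrank_span_eq F (Set.range A.row)
    choose s hs using hf
    let e : n ≃ Fin (Module.finrank F (Submodule.span F (Set.range A.row))) :=
      (Fintype.equivFin n).trans (finCongr hrank.symm)
    have hli' : LinearIndependent F (A.submatrix (s ∘ e) id).row := by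
      have h1 : (A.submatrix (s ∘ e) id).row = f ∘ e := funext fun i => hs (e i)
      rw [h1]
      exact hli.comp e e.injective
    rw [Matrix.linearIndependent_rows_iff_isUnit, Matrix.isUnit_iff_isUnit_det, h] at hli'
    exact not_isUnit_zero hli'

namespace ColoredBars

variable {d n m : ℕ} (B : ColoredBars d n m)

/-- The rigidity matrix with weights `u e` and `v e` at the target and source of the edge `e`, and
edge directions `w e`. -/
def rigidityMatrix {A : Type*} [CommRing A] (u v : Fin m → A) (w : Fin m → Fin d → A) :
    Matrix (Fin m) (Fin n × Fin d) A :=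
  fun e c => w e c.2 * ((if B.tgt e = c.1 then u e else 0) - if B.src e = c.1 then v e else 0)

theorem rigidityMatrix_mulVec {A : Type*} [CommRing A] (u v : Fin m → A) (w : Fin m → Fin d → A)
    (z : Fin n × Fin d → A) (e : Fin m) :
    (B.rigidityMatrix u v w).mulVec z e =
      ∑ k, w e k * (u e * z (B.tgt e, k) - v e * z (B.src e, k)) := by
  simp only [Matrix.mulVec, dotProduct, rigidityMatrix, Fintype.sum_prod_type]
  rw [Finset.sum_comm]
  refine Finset.sum_congr rfl fun k _ => ?_
  simp only [mul_sub, sub_mul, mul_ite, ite_mul, mul_zero, zero_mul, Finset.sum_sub_distrib,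
    Finset.sum_ite_eq, Finset.mem_univ, if_true, mul_assoc]

theorem map_det_rigidityMatrix {A A' : Type*} [CommRing A] [CommRing A'] (f : A →+* A')
    (u v : Fin m → A) (w : Fin m → Fin d → A) (s : Fin n × Fin d → Fin m) :
    f ((B.rigidityMatrix u v w).submatrix s id).det =
      ((B.rigidityMatrix (fun e => f (u e)) (fun e => f (v e))
        (fun e k => f (w e k))).submatrix s id).det := by
  rw [RingHom.map_det]
  congr 1
  ext a b
  simp only [RingHom.mapMatrix_apply, Matrix.map_apply, Matrix.submatrix_apply, rigidityMatrix,
    map_mul, map_sub, id]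
  split_ifs <;> simp

/-- The points of the torus at which the framework has a nontrivial motion with that monodromy. -/
def flexLocus : Set (Fin d → ℂˣ) :=
  {ω | ∃ z : Fin n × Fin d → ℂ, z ≠ 0 ∧ ∀ e, ∑ k, (B.dir e k : ℂ) *
    ((torusChar ω (B.color e) : ℂ) * z (B.tgt e, k) - z (B.src e, k)) = 0}

/-- Rescaling the rows by the nonzero weights `v e` leaves the kernel unchanged; this freedom serves
to clear negative powers along a curve. -/
theorem mem_flexLocus_iff {ω : Fin d → ℂˣ} (v : Fin m → ℂ) (hv : ∀ e, v e ≠ 0) :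
    ω ∈ B.flexLocus ↔ ∀ s : Fin n × Fin d → Fin m,
      ((B.rigidityMatrix (fun e => v e * (torusChar ω (B.color e) : ℂ)) v
        (fun e k => (B.dir e k : ℂ))).submatrix s id).det = 0 := by
  rw [← exists_mulVec_eq_zero_iff_minors]
  have key : ∀ z : Fin n × Fin d → ℂ, (B.rigidityMatrix (fun e => v e * (torusChar ω (B.color e) : ℂ))
      v (fun e k => (B.dir e k : ℂ))).mulVec z = 0 ↔ ∀ e, ∑ k, (B.dir e k : ℂ) *
        ((torusChar ω (B.color e) : ℂ) * z (B.tgt e, k) - z (B.src e, k)) = 0 := by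
    intro z
    rw [funext_iff]
    refine forall_congr' fun e => ?_
    rw [rigidityMatrix_mulVec, Pi.zero_apply]
    have : ∑ k, (B.dir e k : ℂ) * (v e * (torusChar ω (B.color e) : ℂ) * z (B.tgt e, k) -
        v e * z (B.src e, k)) = v e * ∑ k, (B.dir e k : ℂ) *
          ((torusChar ω (B.color e) : ℂ) * z (B.tgt e, k) - z (B.src e, k)) := by
      rw [Finset.mul_sum]
      refine Finset.sum_congr rfl fun k _ => ?_
      ring
    rw [this, mul_eq_zero, or_iff_right (hv e)]
  simp only [key]
  rfl

/-- The sum of the absolute values of the color components. -/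
def colorSize : ℕ := ∑ e, ∑ l, (B.color e l).natAbs

theorem natAbs_sum_mul_color_le {c : Fin d → ℤ} {X : ℕ} (hX : ∀ i, |c i| ≤ X) (e : Fin m) :
    (∑ l, c l * B.color e l).natAbs ≤ X * B.colorSize := by
  calc (∑ l, c l * B.color e l).natAbs ≤ ∑ l, (c l * B.color e l).natAbs :=
        Int.natAbs_sum_le _ _
    _ ≤ ∑ l, X * (B.color e l).natAbs := by
        refine Finset.sum_le_sum fun l _ => ?_
        rw [Int.natAbs_mul]
        apply Nat.mul_le_mul_right
        have := hX l
        rw [Int.abs_eq_natAbs] at this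
        omega
    _ = X * ∑ l, (B.color e l).natAbs := by rw [Finset.mul_sum]
    _ ≤ X * B.colorSize := by
        apply Nat.mul_le_mul_left
        exact Finset.single_le_sum (f := fun e => ∑ l, (B.color e l).natAbs)
          (fun _ _ => Nat.zero_le _) (Finset.mem_univ e)

theorem natDegree_det_rigidityMatrix_le {A : Type*} [CommRing A] (u v : Fin m → A[X])
    (w : Fin m → Fin d → A[X]) (s : Fin n × Fin d → Fin m) {b : ℕ} (hu : ∀ e, (u e).natDegree ≤ b)
    (hv : ∀ e, (v e).natDegree ≤ b) (hw : ∀ e k, (w e k).natDegree = 0) :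
    ((B.rigidityMatrix u v w).submatrix s id).det.natDegree ≤ n * d * b := by
  have hentry : ∀ e c, (B.rigidityMatrix u v w e c).natDegree ≤ b := by
    intro e c
    refine natDegree_mul_le.trans ?_
    rw [hw, zero_add]
    refine (natDegree_sub_le _ _).trans (max_le ?_ ?_)
    · split_ifs
      · exact hu e
      · simp
    · split_ifs
      · exact hv e
      · simp
  rw [Matrix.det_apply']
  apply natDegree_sum_le_of_forall_le
  intro σ _
  refine natDegree_mul_le.trans ?_
  rw [natDegree_intCast, zero_add]
  refine (natDegree_prod_le _ _).trans ?_
  refine (Finset.sum_le_card_nsmul _ _ b fun c _ => hentry _ _).trans ?_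
  simp

/-- Along the curve each maximal minor becomes, after rescaling its rows, a polynomial in `τ` of
degree at most `n * d` times the largest exponent in an entry. With more roots than that it vanishes
identically. -/
theorem curveClosed_flexLocus : CurveClosed B.flexLocus (n * d * B.colorSize) := by
  intro κ c Y hX S hS hmem τ
  let a : Fin m → ℤ := fun e => ∑ l, c l * B.color e l
  -- The weights `τ ^ a` and `1` are both multiplied by `τ ^ (-a).toNat`, which turns them into
  -- genuine monomials for either sign of `a`.
  let u : Fin m → ℂ[X] := fun e => C (torusChar κ (B.color e) : ℂ) * X ^ (a e).toNat
  let v : Fin m → ℂ[X] := fun e => X ^ (-a e).toNat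
  let w : Fin m → Fin d → ℂ[X] := fun e k => C (B.dir e k : ℂ)
  have heval : ∀ (τ : ℂˣ) (s : Fin n × Fin d → Fin m),
      eval (τ : ℂ) ((B.rigidityMatrix u v w).submatrix s id).det =
        ((B.rigidityMatrix (fun e => (τ : ℂ) ^ (-a e).toNat *
          (torusChar (κ * torusCurve τ c) (B.color e) : ℂ)) (fun e => (τ : ℂ) ^ (-a e).toNat)
            (fun e k => (B.dir e k : ℂ))).submatrix s id).det := by
    intro τ s
    have h1 := B.map_det_rigidityMatrix (evalRingHom (τ : ℂ)) u v w s
    rw [coe_evalRingHom] at h1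
    rw [h1]
    have hu : ∀ e, eval (τ : ℂ) (u e) = (τ : ℂ) ^ (-a e).toNat *
        (torusChar (κ * torusCurve τ c) (B.color e) : ℂ) := by
      intro e
      have h2 : τ ^ (a e).toNat = τ ^ (-a e).toNat * τ ^ a e := by
        rw [← zpow_natCast, ← zpow_natCast, ← zpow_add]
        congr 1
        omega
      have h3 : (τ : ℂ) ^ (a e).toNat = (τ : ℂ) ^ (-a e).toNat * ((τ ^ a e : ℂˣ) : ℂ) := by
        exact_mod_cast congrArg Units.val h2
      simp only [u, eval_mul, eval_C, eval_pow, eval_X]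
      rw [h3, torusChar_mul, torusChar_torusCurve, Units.val_mul]
      ring
    simp only [hu]
    simp [v, w]
  have hdeg : ∀ s, ((B.rigidityMatrix u v w).submatrix s id).det.natDegree ≤
      n * d * (Y * B.colorSize) := by
    intro s
    apply natDegree_det_rigidityMatrix_le
    · intro e
      refine (natDegree_C_mul_X_pow_le _ _).trans ?_
      have := B.natAbs_sum_mul_color_le hX e
      simp only [a]
      omega
    · intro e
      refine (natDegree_X_pow_le _).trans ?_
      have := B.natAbs_sum_mul_color_le hX e
      simp only [a]
      omega
    · intro e k
      exact natDegree_C _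
  have hzero : ∀ s, ((B.rigidityMatrix u v w).submatrix s id).det = 0 := by
    intro s
    apply eq_zero_of_natDegree_lt_card_of_eval_eq_zero' _
      (S.map ⟨(Units.val : ℂˣ → ℂ), Units.val_injective⟩)
    · intro x hx
      obtain ⟨τ, hτ, rfl⟩ := Finset.mem_map.mp hx
      have h1 := (B.mem_flexLocus_iff (fun e => (τ : ℂ) ^ (-a e).toNat)
        (fun e => pow_ne_zero _ τ.ne_zero)).mp (hmem τ hτ) s
      exact (heval τ s).trans h1
    · rw [Finset.card_map]
      refine lt_of_le_of_lt (hdeg s) (lt_of_le_of_lt (le_of_eq ?_) hS)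
      ring
  rw [B.mem_flexLocus_iff (fun e => (τ : ℂ) ^ (-a e).toNat) (fun e => pow_ne_zero _ τ.ne_zero)]
  intro s
  rw [← heval, hzero, eval_zero]

/-- At a torsion point all characters are powers of one root of unity `ζ`, so the minors are
polynomials over `K` evaluated at `ζ`, and their vanishing survives the Galois substitutions of
`aeval_pow_factorial_eq_zero`. -/
theorem powerClosed_flexLocus {K : IntermediateField ℚ ℝ} (hdir : ∀ e k, B.dir e k ∈ K) {D : ℕ}
    (hD : ∀ (N : ℕ) (ζ : ℂ), 0 < N → IsPrimitiveRoot ζ N →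
      N.totient ≤ D * (minpoly K ζ).natDegree) : PowerClosed B.flexLocus D.factorial := by
  intro N hN ω hω hωN g hg
  obtain ⟨ζ, hζ⟩ := exists_isPrimitiveRoot_units N hN.ne'
  obtain ⟨t, rfl⟩ := exists_zpow_eq_of_pow_eq_one hN.ne' hζ hωN
  have hζ' : IsPrimitiveRoot (ζ : ℂ) N := IsPrimitiveRoot.coe_units_iff.mpr hζ
  -- Exponents of `ζ` matter only modulo `N`, so nonnegative ones can be chosen.
  let b : Fin m → ℕ := fun e => ((∑ l, t l * B.color e l) % (N : ℤ)).toNat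
  have hb : ∀ e, torusChar (torusCurve ζ t) (B.color e) = ζ ^ b e := by
    intro e
    rw [torusChar_torusCurve, ← zpow_natCast, ← mul_inv_eq_one, ← zpow_neg, ← zpow_add,
      hζ.zpow_eq_one_iff_dvd]
    have h1 : ((b e : ℕ) : ℤ) = (∑ l, t l * B.color e l) % (N : ℤ) :=
      Int.toNat_of_nonneg (Int.emod_nonneg _ (by exact_mod_cast hN.ne'))
    rw [h1, ← sub_eq_add_neg]
    exact Int.dvd_self_sub_emod
  let u : Fin m → K[X] := fun e => X ^ b e
  let v : Fin m → K[X] := fun _ => 1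
  let w : Fin m → Fin d → K[X] := fun e k => C ⟨B.dir e k, hdir e k⟩
  have heval : ∀ (j : ℕ) (s : Fin n × Fin d → Fin m),
      aeval ((ζ : ℂ) ^ j) ((B.rigidityMatrix u v w).submatrix s id).det =
        ((B.rigidityMatrix (fun e => 1 * (torusChar (torusCurve ζ t ^ j) (B.color e) : ℂ))
          (fun _ => 1) (fun e k => (B.dir e k : ℂ))).submatrix s id).det := by
    intro j s
    have h1 := B.map_det_rigidityMatrix (aeval (R := K) ((ζ : ℂ) ^ j)).toRingHom u v w s
    refine h1.trans ?_
    have hu : ∀ e, (aeval (R := K) ((ζ : ℂ) ^ j)).toRingHom (u e) =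
        1 * (torusChar (torusCurve ζ t ^ j) (B.color e) : ℂ) := by
      intro e
      simp only [u, AlgHom.toRingHom_eq_coe, RingHom.coe_coe, map_pow, aeval_X]
      rw [torusChar_pow, hb]
      push_cast
      ring
    have hw : ∀ e k, (aeval (R := K) ((ζ : ℂ) ^ j)).toRingHom (w e k) = (B.dir e k : ℂ) := by
      intro e k
      simp only [w, AlgHom.toRingHom_eq_coe, RingHom.coe_coe, aeval_C]
      rfl
    simp only [hu, hw]
    simp [v]
  rw [B.mem_flexLocus_iff (fun _ => 1) (fun _ => one_ne_zero)] at hω ⊢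
  intro s
  rw [← heval]
  apply aeval_pow_factorial_eq_zero hN hζ' (hD N ζ hN hζ') hg
  have h1 := heval 1 s
  rw [pow_one, pow_one] at h1
  rw [h1]
  exact hω s

end ColoredBars

/-! ## Motions that are periodic with respect to a sublattice -/

/-- The subgroup `N ℤ^d` of `ℤ^d`. -/
def scaledLattice (d N : ℕ) : AddSubgroup (Fin d → ℤ) where
  carrier := {γ | ∀ l, (N : ℤ) ∣ γ l}
  zero_mem' := fun _ => dvd_zero _
  add_mem' := fun ha hb l => dvd_add (ha l) (hb l)
  neg_mem' := fun ha l => (dvd_neg).mpr (ha l)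

theorem mem_scaledLattice {d N : ℕ} {γ : Fin d → ℤ} :
    γ ∈ scaledLattice d N ↔ ∀ l, (N : ℤ) ∣ γ l := Iff.rfl

theorem scaledLattice_one (d : ℕ) : scaledLattice d 1 = ⊤ := by
  ext γ
  simp [mem_scaledLattice]

theorem scaledLattice_finiteIndex (d : ℕ) {N : ℕ} (hN : 0 < N) :
    (scaledLattice d N).FiniteIndex := by
  have : NeZero N := ⟨hN.ne'⟩
  let f : (Fin d → ℤ) →+ (Fin d → ZMod N) :=
    { toFun := fun γ l => (γ l : ZMod N)
      map_zero' := by ext; simp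
      map_add' := fun a b => by ext; simp }
  have h : scaledLattice d N = f.ker := by
    ext γ
    rw [mem_scaledLattice, AddMonoidHom.mem_ker, funext_iff]
    exact forall_congr' fun l => (ZMod.intCast_zmod_eq_zero_iff_dvd _ _).symm
  rw [h]
  exact AddSubgroup.finiteIndex_ker f

/-- The index annihilates the quotient group, so it is a modulus that works for every subgroup of
finite index. -/
theorem scaledLattice_index_le {d : ℕ} (Λ : AddSubgroup (Fin d → ℤ)) :
    scaledLattice d Λ.index ≤ Λ := by
  intro γ hγ
  choose a ha using mem_scaledLattice.mp hγ
  have h : γ = Λ.index • a := by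
    ext l
    simpa using ha l
  rw [h]
  exact Λ.nsmul_index_mem a

namespace ColoredBars

variable {d n m : ℕ} (B : ColoredBars d n m)

/-- Infinitesimal motions of the periodic framework coded by `B` that are periodic with respect to
`Λ`; the velocity of the vertex `δ + i` is `x.1 i δ` plus the velocity prescribed by the lattice
motion `x.2`. -/
def motions (Λ : AddSubgroup (Fin d → ℤ)) :
    Submodule ℝ ((Fin n → (Fin d → ℤ) → Fin d → ℝ) × Matrix (Fin d) (Fin d) ℝ) where
  carrier := {x | (∀ γ ∈ Λ, ∀ i δ, x.1 i (γ + δ) = x.1 i δ) ∧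
    ∀ e δ, ∑ k, B.dir e k * (x.1 (B.tgt e) (δ + B.color e) k - x.1 (B.src e) δ k +
      ∑ l, x.2 k l * B.color e l) = 0}
  zero_mem' := by simp
  add_mem' := by
    rintro x y ⟨hx, hx'⟩ ⟨hy, hy'⟩
    refine ⟨fun γ hγ i δ => by simp [hx γ hγ, hy γ hγ], fun e δ => ?_⟩
    have h := congrArg₂ (· + ·) (hx' e δ) (hy' e δ)
    simp only [← Finset.sum_add_distrib, add_zero] at h
    rw [← h]
    refine Finset.sum_congr rfl fun k _ => ?_
    simp only [Prod.fst_add, Prod.snd_add, Pi.add_apply, Matrix.add_apply, add_mul,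
      Finset.sum_add_distrib]
    ring
  smul_mem' := by
    rintro c x ⟨hx, hx'⟩
    refine ⟨fun γ hγ i δ => by simp [hx γ hγ], fun e δ => ?_⟩
    have h := congrArg (c * ·) (hx' e δ)
    simp only [mul_zero, Finset.mul_sum] at h
    rw [← h]
    refine Finset.sum_congr rfl fun k _ => ?_
    simp only [Prod.smul_fst, Prod.smul_snd, Pi.smul_apply, Matrix.smul_apply, smul_eq_mul, mul_add,
      Finset.mul_sum, mul_sub]
    congr 1
    · ring
    · exact Finset.sum_congr rfl fun l _ => by ring

theorem motions_antitone {Λ Λ' : AddSubgroup (Fin d → ℤ)} (h : Λ ≤ Λ') :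
    B.motions Λ' ≤ B.motions Λ :=
  fun _ hx => ⟨fun γ hγ => hx.1 γ (h hγ), hx.2⟩

/-- The unknowns of the linear system for motions periodic with respect to `N ℤ^d`. -/
abbrev Unknown (d n N : ℕ) := (Fin n × (Fin d → ZMod N) × Fin d) ⊕ (Fin d × Fin d)

/-- The reduction of a vector modulo `N`. -/
def residue (N : ℕ) (γ : Fin d → ℤ) : Fin d → ZMod N := fun l => (γ l : ZMod N)

theorem residue_add (N : ℕ) (γ δ : Fin d → ℤ) :
    residue N (γ + δ) = residue N γ + residue N δ := by
  ext
  simp [residue]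

theorem residue_surjective (N : ℕ) (ρ : Fin d → ZMod N) : ∃ γ : Fin d → ℤ, residue N γ = ρ := by
  choose γ hγ using fun l => ZMod.intCast_surjective (ρ l)
  exact ⟨γ, funext hγ⟩

theorem residue_eq_zero {N : ℕ} {γ : Fin d → ℤ} : residue N γ = 0 ↔ γ ∈ scaledLattice d N := by
  rw [funext_iff, mem_scaledLattice]
  exact forall_congr' fun l => ZMod.intCast_zmod_eq_zero_iff_dvd _ _

/-- The coefficients of the linear equation at the edge `e` in the residue class `ρ`. -/
noncomputable def equation (N : ℕ) (e : Fin m) (ρ : Fin d → ZMod N) : Unknown d n N → ℝ :=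
  ∑ k, B.dir e k • (Pi.single (Sum.inl (B.tgt e, ρ + residue N (B.color e), k)) 1 -
    Pi.single (Sum.inl (B.src e, ρ, k)) 1 +
      ∑ l, (B.color e l : ℝ) • Pi.single (Sum.inr (k, l)) 1)

variable {N : ℕ}

theorem equation_dotProduct [NeZero N] (e : Fin m) (ρ : Fin d → ZMod N) (y : Unknown d n N → ℝ) :
    dotProduct (B.equation N e ρ) y = ∑ k, B.dir e k *
      (y (Sum.inl (B.tgt e, ρ + residue N (B.color e), k)) - y (Sum.inl (B.src e, ρ, k)) +
        ∑ l, y (Sum.inr (k, l)) * B.color e l) := by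
  simp only [equation, sum_dotProduct, smul_dotProduct, add_dotProduct, sub_dotProduct,
    single_dotProduct, one_mul, smul_eq_mul]
  refine Finset.sum_congr rfl fun k _ => ?_
  congr 2
  exact Finset.sum_congr rfl fun l _ => by ring

/-- The solutions of the linear system. -/
noncomputable def solutions (N : ℕ) [NeZero N] : Submodule ℝ (Unknown d n N → ℝ) :=
  LinearMap.ker (Matrix.mulVecLin (Matrix.of fun c : Fin m × (Fin d → ZMod N) =>
    B.equation N c.1 c.2))

theorem mem_solutions [NeZero N] {y : Unknown d n N → ℝ} : y ∈ B.solutions N ↔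
    ∀ e ρ, dotProduct (B.equation N e ρ) y = 0 := by
  rw [solutions, LinearMap.mem_ker, funext_iff, Prod.forall]
  rfl

theorem finrank_solutions_add [NeZero N] : Module.finrank ℝ (B.solutions N) +
    Module.finrank ℝ (Submodule.span ℝ
      (Set.range fun c : Fin m × (Fin d → ZMod N) => B.equation N c.1 c.2)) =
      n * (N ^ d * d) + d * d := by
  have h := LinearMap.finrank_range_add_finrank_ker (Matrix.mulVecLin
    (Matrix.of fun c : Fin m × (Fin d → ZMod N) => B.equation N c.1 c.2))
  have h2 := Matrix.rank_eq_finrank_span_row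
    (Matrix.of fun c : Fin m × (Fin d → ZMod N) => B.equation N c.1 c.2)
  rw [Matrix.rank] at h2
  rw [h2, Module.finrank_fintype_fun_eq_card] at h
  rw [add_comm]
  refine h.trans ?_
  simp [ZMod.card]

/-- The motion given by a solution of the linear system. -/
def unfold (N : ℕ) : (Unknown d n N → ℝ) →ₗ[ℝ]
    (Fin n → (Fin d → ℤ) → Fin d → ℝ) × Matrix (Fin d) (Fin d) ℝ where
  toFun y := (fun i δ k => y (Sum.inl (i, residue N δ, k)), fun k l => y (Sum.inr (k, l)))
  map_add' _ _ := rfl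
  map_smul' _ _ := rfl

@[simp]
theorem unfold_fst (y : Unknown d n N → ℝ) (i : Fin n) (δ : Fin d → ℤ) (k : Fin d) :
    (unfold N y).1 i δ k = y (Sum.inl (i, residue N δ, k)) := rfl

@[simp]
theorem unfold_snd (y : Unknown d n N → ℝ) (k l : Fin d) :
    (unfold N y).2 k l = y (Sum.inr (k, l)) := rfl

theorem unfold_injective : Function.Injective (unfold (d := d) (n := n) N) := by
  intro y y' h
  rw [Prod.ext_iff] at h
  funext u
  rcases u with ⟨i, ρ, k⟩ | ⟨k, l⟩
  · obtain ⟨δ, rfl⟩ := residue_surjective N ρ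
    exact congrFun (congrFun (congrFun h.1 i) δ) k
  · exact congrFun (congrFun h.2 k) l

theorem map_solutions [NeZero N] : (B.solutions N).map (unfold N) = B.motions (scaledLattice d N) := by
  ext x
  constructor
  · rintro ⟨y, hy, rfl⟩
    replace hy := B.mem_solutions.mp hy
    refine ⟨fun γ hγ i δ => ?_, fun e δ => ?_⟩
    · funext k
      rw [unfold_fst, unfold_fst, residue_add, residue_eq_zero.mpr hγ, zero_add]
    · have h := hy e (residue N δ)
      rw [equation_dotProduct] at h
      simpa only [unfold_fst, unfold_snd, residue_add] using h
  · intro hx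
    -- Periodicity makes the velocity depend on the residue class only, so any choice of lifts reads
    -- off a solution.
    choose lift hlift using residue_surjective (d := d) N
    have hx1 : ∀ i δ, x.1 i (lift (residue N δ)) = x.1 i δ := by
      intro i δ
      have h : lift (residue N δ) - δ ∈ scaledLattice d N := by
        rw [← residue_eq_zero, sub_eq_add_neg, residue_add, hlift, ← residue_add]
        simp [residue, funext_iff]
      have := hx.1 _ h i δ
      rwa [sub_add_cancel] at this
    refine ⟨Sum.elim (fun c => x.1 c.1 (lift c.2.1) c.2.2) (fun c => x.2 c.1 c.2), ?_, ?_⟩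
    · refine B.mem_solutions.mpr fun e ρ => ?_
      obtain ⟨δ, rfl⟩ := residue_surjective N ρ
      rw [equation_dotProduct]
      simp only [Sum.elim_inl, Sum.elim_inr, ← residue_add, hx1]
      exact hx.2 e δ
    · refine Prod.ext ?_ rfl
      funext i δ k
      simp only [unfold_fst, Sum.elim_inl, hx1]

instance [NeZero N] : FiniteDimensional ℝ (B.motions (scaledLattice d N)) := by
  rw [← map_solutions]
  infer_instance

theorem finrank_motions [NeZero N] : Module.finrank ℝ (B.motions (scaledLattice d N)) =
    Module.finrank ℝ (B.solutions N) := by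
  rw [← map_solutions]
  exact (LinearEquiv.finrank_eq (Submodule.equivMapOfInjective _ unfold_injective _)).symm

/-- The torus point belonging to a character of `(ℤ/N)^d`. -/
noncomputable def torusPoint (χ : AddChar (Fin d → ZMod N) ℂ) : Fin d → ℂˣ :=
  fun l => (χ.val_isUnit (Pi.single l 1)).unit

theorem torusChar_torusPoint (χ : AddChar (Fin d → ZMod N) ℂ) (γ : Fin d → ℤ) :
    (torusChar (torusPoint χ) γ : ℂ) = χ (residue N γ) := by
  have h : residue N γ = ∑ l, γ l • Pi.single l (1 : ZMod N) := by
    ext j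
    simp [residue, Finset.sum_apply, Pi.single_apply]
  have hsum : ∀ (s : Finset (Fin d)) (f : Fin d → Fin d → ZMod N),
      χ (∑ l ∈ s, f l) = ∏ l ∈ s, χ (f l) := by
    intro s f
    induction s using Finset.cons_induction with
    | empty => simp
    | cons a s ha ih => rw [Finset.sum_cons, Finset.prod_cons, AddChar.map_add_eq_mul, ih]
  rw [h, hsum, torusChar, Units.coe_prod]
  refine Finset.prod_congr rfl fun l _ => ?_
  rw [AddChar.map_zsmul_eq_zpow, Units.val_zpow_eq_zpow_val]
  rfl

theorem torusPoint_pow (χ : AddChar (Fin d → ZMod N) ℂ) : torusPoint χ ^ N = 1 := by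
  funext l
  apply Units.ext
  change χ (Pi.single l 1) ^ N = 1
  rw [← AddChar.map_nsmul_eq_pow]
  have : N • Pi.single l (1 : ZMod N) = (0 : Fin d → ZMod N) := by
    ext j
    simp
  rw [this, AddChar.map_zero_eq_one]

theorem torusPoint_ne_one {χ : AddChar (Fin d → ZMod N) ℂ} (hχ : χ ≠ 1) : torusPoint χ ≠ 1 := by
  intro h
  apply hχ
  ext ρ
  obtain ⟨γ, rfl⟩ := residue_surjective N ρ
  rw [← torusChar_torusPoint, h]
  simp [torusChar]

/-- The Fourier coefficient of a solution at a nontrivial character solves the equations defining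
`flexLocus` at the corresponding torsion point, hence vanishes. Only the trivial character survives,
so the solution is constant in the residue class. -/
theorem solution_eq_of_flexLocus [NeZero N] (h : ∀ ω ∈ B.flexLocus, ω ^ N = 1 → ω = 1)
    {y : Unknown d n N → ℝ} (hy : y ∈ B.solutions N) (i : Fin n) (ρ : Fin d → ZMod N) (k : Fin d) :
    y (Sum.inl (i, ρ, k)) = y (Sum.inl (i, 0, k)) := by
  classical
  rw [mem_solutions] at hy
  let z : AddChar (Fin d → ZMod N) ℂ → Fin n × Fin d → ℂ :=
    fun χ c => ∑ ρ, χ (-ρ) * (y (Sum.inl (c.1, ρ, c.2)) : ℂ)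
  have hz : ∀ χ, χ ≠ 1 → z χ = 0 := by
    intro χ hχ
    by_contra hzχ
    refine torusPoint_ne_one hχ (h _ ⟨z χ, hzχ, fun e => ?_⟩ (torusPoint_pow χ))
    -- The lattice velocity enters each equation independently of `ρ`, so orthogonality to the
    -- trivial character removes it.
    have hneg : ∑ ρ, χ (-ρ) = 0 := by
      rw [← AddChar.sum_eq_zero_iff_ne_zero.mpr (show χ ≠ 0 from hχ)]
      exact Fintype.sum_equiv (Equiv.neg _) _ _ fun _ => rfl
    have hshift : ∀ k, ∑ ρ, χ (-ρ) * (y (Sum.inl (B.tgt e, ρ + residue N (B.color e), k)) : ℂ) =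
        χ (residue N (B.color e)) * z χ (B.tgt e, k) := by
      intro k
      simp only [z, Finset.mul_sum]
      refine Fintype.sum_equiv (Equiv.addRight (residue N (B.color e))) _ _ fun ρ => ?_
      rw [← mul_assoc, ← AddChar.map_add_eq_mul]
      simp
    have heq : ∑ ρ, χ (-ρ) * ((dotProduct (B.equation N e ρ) y : ℝ) : ℂ) = 0 :=
      Finset.sum_eq_zero fun ρ _ => by rw [hy]; simp
    rw [← heq]
    simp only [equation_dotProduct, torusChar_torusPoint, ← hshift]
    push_cast
    simp only [Finset.mul_sum]
    rw [Finset.sum_comm]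
    refine Finset.sum_congr rfl fun k _ => ?_
    have h1 : ∀ ρ, χ (-ρ) * ((B.dir e k : ℂ) *
        ((y (Sum.inl (B.tgt e, ρ + residue N (B.color e), k)) : ℂ) - y (Sum.inl (B.src e, ρ, k)) +
          ∑ l, (y (Sum.inr (k, l)) : ℂ) * (B.color e l : ℂ))) =
        (B.dir e k : ℂ) * (χ (-ρ) * y (Sum.inl (B.tgt e, ρ + residue N (B.color e), k)) -
          χ (-ρ) * y (Sum.inl (B.src e, ρ, k)) +
          χ (-ρ) * ∑ l, (y (Sum.inr (k, l)) : ℂ) * (B.color e l : ℂ)) := fun ρ => by ring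
    rw [Finset.sum_congr rfl fun ρ _ => h1 ρ, ← Finset.mul_sum, Finset.sum_add_distrib,
      Finset.sum_sub_distrib, ← Finset.sum_mul, hneg, zero_mul, add_zero]
  -- Fourier inversion, with all nontrivial coefficients already known to vanish.
  have hinv : ∀ ρ, (Fintype.card (Fin d → ZMod N) : ℂ) * (y (Sum.inl (i, ρ, k)) : ℂ) =
      z 1 (i, k) := by
    intro ρ
    have h1 : ∑ χ : AddChar (Fin d → ZMod N) ℂ, χ ρ * z χ (i, k) = z 1 (i, k) := by
      rw [Finset.sum_eq_single 1]
      · simp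
      · intro χ _ hχ
        rw [hz χ hχ]
        simp
      · simp
    rw [← h1]
    simp only [z, Finset.mul_sum]
    rw [Finset.sum_comm]
    have h2 : ∀ σ : Fin d → ZMod N, ∑ χ : AddChar (Fin d → ZMod N) ℂ,
        χ ρ * (χ (-σ) * (y (Sum.inl (i, σ, k)) : ℂ)) =
        if σ = ρ then (Fintype.card (Fin d → ZMod N) : ℂ) * (y (Sum.inl (i, σ, k)) : ℂ) else 0 := by
      intro σ
      simp only [← mul_assoc, ← AddChar.map_add_eq_mul]
      rw [← Finset.sum_mul, AddChar.sum_apply_eq_ite]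
      by_cases hσ : σ = ρ
      · simp [hσ]
      · have : ρ + -σ ≠ 0 := by
          rw [← sub_eq_add_neg, sub_ne_zero]
          exact fun h => hσ h.symm
        simp [hσ, this]
    simp only [h2]
    simp
  have h3 := (hinv ρ).trans (hinv 0).symm
  have hc : (Fintype.card (Fin d → ZMod N) : ℂ) ≠ 0 := Nat.cast_ne_zero.mpr Fintype.card_ne_zero
  exact_mod_cast mul_left_cancel₀ hc h3

theorem motions_le_of_flexLocus [NeZero N] (h : ∀ ω ∈ B.flexLocus, ω ^ N = 1 → ω = 1) :
    B.motions (scaledLattice d N) ≤ B.motions ⊤ := by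
  intro x hx
  refine ⟨?_, hx.2⟩
  rw [← map_solutions] at hx
  obtain ⟨y, hy, rfl⟩ := hx
  intro γ _ i δ
  funext k
  rw [unfold_fst, unfold_fst, B.solution_eq_of_flexLocus h hy, ← B.solution_eq_of_flexLocus h hy i (residue N δ)]

/-- A kernel vector `z` at `ω` extends to the complex velocity `ω ^ δ * z` with fixed lattice. Every
real functional `f` of it, in particular its real and imaginary parts, is `N ℤ^d`-periodic and so by
assumption `ℤ^d`-periodic; at a nonzero entry of `z` this forces `ω l = 1`. -/
theorem eq_one_of_mem_flexLocus (h : B.motions (scaledLattice d N) ≤ B.motions ⊤)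
    {ω : Fin d → ℂˣ} (hω : ω ∈ B.flexLocus) (hωN : ω ^ N = 1) : ω = 1 := by
  obtain ⟨z, hz, hzω⟩ := hω
  have key : ∀ f : ℂ →ₗ[ℝ] ℝ, ((fun i δ k => f ((torusChar ω δ : ℂ) * z (i, k)), 0) :
      (Fin n → (Fin d → ℤ) → Fin d → ℝ) × Matrix (Fin d) (Fin d) ℝ) ∈ B.motions ⊤ := by
    intro f
    apply h
    refine ⟨fun γ hγ i δ => ?_, fun e δ => ?_⟩
    · funext k
      simp only [torusChar_add, torusChar_eq_one hωN hγ, one_mul]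
    · have h1 : ∀ k, B.dir e k * (f ((torusChar ω (δ + B.color e) : ℂ) * z (B.tgt e, k)) -
          f ((torusChar ω δ : ℂ) * z (B.src e, k)) + ∑ l, (0 : Matrix (Fin d) (Fin d) ℝ) k l *
            (B.color e l : ℝ)) = f ((torusChar ω δ : ℂ) * ((B.dir e k : ℂ) *
              ((torusChar ω (B.color e) : ℂ) * z (B.tgt e, k) - z (B.src e, k)))) := by
        intro k
        rw [← map_sub]
        simp only [Matrix.zero_apply, zero_mul, Finset.sum_const_zero, add_zero]
        rw [← smul_eq_mul, ← map_smul, torusChar_add]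
        congr 1
        rw [Complex.real_smul]
        push_cast
        ring
      simp only [h1]
      rw [← map_sum, ← Finset.mul_sum, hzω, mul_zero, map_zero]
  obtain ⟨⟨i, k⟩, hik⟩ := Function.ne_iff.mp hz
  funext l
  have h2 : ∀ f : ℂ →ₗ[ℝ] ℝ, f ((ω l : ℂ) * z (i, k)) = f (z (i, k)) := by
    intro f
    have h3 := congrFun ((key f).1 (Pi.single l 1) trivial i 0) k
    simpa [torusChar_single, torusChar_zero] using h3
  have h4 : (ω l : ℂ) * z (i, k) = 1 * z (i, k) := by
    rw [one_mul]
    exact Complex.ext (h2 Complex.reLm) (h2 Complex.imLm)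
  exact Units.ext (mul_right_cancel₀ hik h4)

/-- Periodic rigidity for all sublattices follows from rigidity for the full lattice and for a single
sublattice. -/
theorem forall_finrank_motions_iff {K : IntermediateField ℚ ℝ} (hdir : ∀ e k, B.dir e k ∈ K) {D : ℕ}
    (hD : ∀ (N : ℕ) (ζ : ℂ), 0 < N → IsPrimitiveRoot ζ N →
      N.totient ≤ D * (minpoly K ζ).natDegree) (c : ℕ) :
    (∀ Λ : AddSubgroup (Fin d → ℤ), Λ.FiniteIndex → Module.finrank ℝ (B.motions Λ) = c) ↔
      Module.finrank ℝ (B.motions (scaledLattice d 1)) = c ∧ Module.finrank ℝ (B.motions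
        (scaledLattice d (torsionBound d (n * d * B.colorSize) D.factorial))) = c := by
  set N₀ := torsionBound d (n * d * B.colorSize) D.factorial with hN₀
  have hN₀pos : 0 < N₀ := torsionBound_pos _ _ _
  have : NeZero N₀ := ⟨hN₀pos.ne'⟩
  constructor
  · intro h
    exact ⟨h _ (scaledLattice_finiteIndex d one_pos), h _ (scaledLattice_finiteIndex d hN₀pos)⟩
  · rintro ⟨h1, h2⟩ Λ hΛ
    have hle : B.motions ⊤ ≤ B.motions (scaledLattice d N₀) := B.motions_antitone le_top
    rw [scaledLattice_one] at h1
    have heq := Submodule.eq_of_le_of_finrank_eq hle (h1.trans h2.symm)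
    -- A nontrivial torsion point of any order would produce one killed by `N₀`, contradicting the
    -- equality of motion spaces for `N₀ ℤ^d` and `ℤ^d`.
    have hflex : ∀ ω ∈ B.flexLocus, ω ^ Λ.index = 1 → ω = 1 := by
      intro ω hω hωN
      by_contra hω1
      obtain ⟨ω', hω', hω'1, hω'N⟩ := exists_torsion_of_bounded_order B.curveClosed_flexLocus
        (B.powerClosed_flexLocus hdir hD) (Nat.factorial_pos D)
        (Nat.pos_of_ne_zero hΛ.index_ne_zero) hω hω1 hωN
      exact hω'1 (B.eq_one_of_mem_flexLocus heq.ge hω' hω'N)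
    have : NeZero Λ.index := ⟨hΛ.index_ne_zero⟩
    have h3 : B.motions Λ = B.motions ⊤ :=
      le_antisymm ((B.motions_antitone (scaledLattice_index_le Λ)).trans
        (B.motions_le_of_flexLocus hflex)) (B.motions_antitone le_top)
    rw [h3, h1]

end ColoredBars

/-! ## From periodic frameworks to colored quotient graphs -/

namespace ColoredBars

variable {d n m : ℕ} {V : Type*} [AddAction (Fin d → ℤ) V]

/-- The colored graph `B` is a quotient of the framework `Φ`, for the vertex representatives
`rep`. -/
structure IsQuotientOf (B : ColoredBars d n m) (Φ : PeriodicFramework d V) (rep : Fin n → V) :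
    Prop where
  bijective : Function.Bijective fun x : Fin n × (Fin d → ℤ) => x.2 +ᵥ rep x.1
  adj_iff : ∀ u v : V, Φ.graph.Adj u v ↔ ∃ e δ,
    (u = δ +ᵥ rep (B.src e) ∧ v = (δ + B.color e) +ᵥ rep (B.tgt e)) ∨
    (v = δ +ᵥ rep (B.src e) ∧ u = (δ + B.color e) +ᵥ rep (B.tgt e))
  dir_eq : ∀ e k, B.dir e k = Φ.p (rep (B.tgt e)) k +
    (∑ l, Φ.L k l * B.color e l) - Φ.p (rep (B.src e)) k

variable {B : ColoredBars d n m} {Φ : PeriodicFramework d V} {rep : Fin n → V}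

namespace IsQuotientOf

/-- The velocities of all vertices in terms of those of the representatives. -/
noncomputable def velocities (h : B.IsQuotientOf Φ rep) :
    (Fin n → (Fin d → ℤ) → Fin d → ℝ) × Matrix (Fin d) (Fin d) ℝ →ₗ[ℝ]
      (V → EuclideanSpace ℝ (Fin d)) × Matrix (Fin d) (Fin d) ℝ where
  toFun x := (fun u => WithLp.toLp 2 fun k =>
    x.1 ((Equiv.ofBijective _ h.bijective).symm u).1 ((Equiv.ofBijective _ h.bijective).symm u).2 k +
      ∑ l, x.2 k l * ((Equiv.ofBijective _ h.bijective).symm u).2 l, x.2)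
  map_add' x y := by
    refine Prod.ext ?_ rfl
    funext u
    ext k
    simp only [Prod.fst_add, Prod.snd_add, Pi.add_apply, PiLp.add_apply, Matrix.add_apply, add_mul,
      Finset.sum_add_distrib]
    ring
  map_smul' c x := by
    refine Prod.ext ?_ rfl
    funext u
    ext k
    simp only [Prod.smul_fst, Prod.smul_snd, Pi.smul_apply, PiLp.smul_apply, Matrix.smul_apply,
      smul_eq_mul, mul_add, Finset.mul_sum, mul_assoc, RingHom.id_apply]

theorem velocities_fst (h : B.IsQuotientOf Φ rep)
    (x : (Fin n → (Fin d → ℤ) → Fin d → ℝ) × Matrix (Fin d) (Fin d) ℝ) (i : Fin n)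
    (δ : Fin d → ℤ) (k : Fin d) :
    (h.velocities x).1 (δ +ᵥ rep i) k = x.1 i δ k + ∑ l, x.2 k l * δ l := by
  have e : (Equiv.ofBijective _ h.bijective).symm (δ +ᵥ rep i) = (i, δ) :=
    (Equiv.ofBijective _ h.bijective).symm_apply_apply (i, δ)
  change x.1 ((Equiv.ofBijective _ h.bijective).symm (δ +ᵥ rep i)).1
    ((Equiv.ofBijective _ h.bijective).symm (δ +ᵥ rep i)).2 k +
      ∑ l, x.2 k l * ((Equiv.ofBijective _ h.bijective).symm (δ +ᵥ rep i)).2 l = _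
  rw [e]

theorem velocities_snd (h : B.IsQuotientOf Φ rep)
    (x : (Fin n → (Fin d → ℤ) → Fin d → ℝ) × Matrix (Fin d) (Fin d) ℝ) :
    (h.velocities x).2 = x.2 := rfl

theorem velocities_injective (h : B.IsQuotientOf Φ rep) : Function.Injective h.velocities := by
  intro x y hxy
  have h2 : (h.velocities x).2 = (h.velocities y).2 := by rw [hxy]
  rw [velocities_snd, velocities_snd] at h2
  refine Prod.ext ?_ h2
  funext i δ k
  have h1 : (h.velocities x).1 (δ +ᵥ rep i) k = (h.velocities y).1 (δ +ᵥ rep i) k := by rw [hxy]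
  rw [velocities_fst, velocities_fst, h2] at h1
  exact add_right_cancel h1

theorem velocities_surjective (h : B.IsQuotientOf Φ rep) : Function.Surjective h.velocities := by
  intro w
  refine ⟨(fun i δ k => w.1 (δ +ᵥ rep i) k - ∑ l, w.2 k l * δ l, w.2), ?_⟩
  refine Prod.ext ?_ rfl
  funext u
  obtain ⟨⟨i, δ⟩, rfl⟩ := h.bijective.2 u
  ext k
  exact (h.velocities_fst _ i δ k).trans (sub_add_cancel _ _)

theorem position_sub (h : B.IsQuotientOf Φ rep) (e : Fin m) (δ : Fin d → ℤ) (k : Fin d) :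
    Φ.p ((δ + B.color e) +ᵥ rep (B.tgt e)) k - Φ.p (δ +ᵥ rep (B.src e)) k = B.dir e k := by
  rw [h.dir_eq, Φ.p_vadd, Φ.p_vadd]
  simp only [PiLp.add_apply, Matrix.mulVec, dotProduct, Pi.add_apply, Int.cast_add, mul_add,
    Finset.sum_add_distrib]
  ring

/-- Subtracting the velocity that the lattice motion prescribes turns equivariance under `Λ` into
invariance, and leaves one bar equation for each quotient edge and translation. -/
theorem velocities_mem_iff (h : B.IsQuotientOf Φ rep) (Λ : AddSubgroup (Fin d → ℤ))
    (x : (Fin n → (Fin d → ℤ) → Fin d → ℝ) × Matrix (Fin d) (Fin d) ℝ) :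
    h.velocities x ∈ Φ.infinitesimalMotions Λ ↔ x ∈ B.motions Λ := by
  have h1 : (∀ γ ∈ Λ, ∀ u : V, (h.velocities x).1 (γ +ᵥ u) = (h.velocities x).1 u +
      WithLp.toLp 2 ((h.velocities x).2.mulVec fun k => (γ k : ℝ))) ↔
      ∀ γ ∈ Λ, ∀ i δ, x.1 i (γ + δ) = x.1 i δ := by
    refine forall₂_congr fun γ _ => ?_
    have key : ∀ i δ, ((h.velocities x).1 (γ +ᵥ (δ +ᵥ rep i)) = (h.velocities x).1 (δ +ᵥ rep i) +
        WithLp.toLp 2 ((h.velocities x).2.mulVec fun k => (γ k : ℝ))) ↔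
        x.1 i (γ + δ) = x.1 i δ := by
      intro i δ
      rw [PiLp.ext_iff, funext_iff]
      refine forall_congr' fun k => ?_
      rw [vadd_vadd, velocities_fst, PiLp.add_apply, velocities_fst, velocities_snd]
      simp only [Matrix.mulVec, dotProduct, Pi.add_apply, Int.cast_add, mul_add,
        Finset.sum_add_distrib]
      constructor <;> intro h' <;> linarith
    constructor
    · exact fun h' i δ => (key i δ).mp (h' _)
    · intro h' u
      obtain ⟨⟨i, δ⟩, rfl⟩ := h.bijective.2 u
      exact (key i δ).mpr (h' i δ)
  have hinner : ∀ e δ, inner ℝ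
      (Φ.p ((δ + B.color e) +ᵥ rep (B.tgt e)) - Φ.p (δ +ᵥ rep (B.src e)))
      ((h.velocities x).1 ((δ + B.color e) +ᵥ rep (B.tgt e)) -
        (h.velocities x).1 (δ +ᵥ rep (B.src e))) =
      ∑ k, B.dir e k * (x.1 (B.tgt e) (δ + B.color e) k - x.1 (B.src e) δ k +
        ∑ l, x.2 k l * B.color e l) := by
    intro e δ
    rw [PiLp.inner_apply]
    refine Finset.sum_congr rfl fun k _ => ?_
    rw [PiLp.sub_apply, PiLp.sub_apply, h.position_sub, velocities_fst, velocities_fst]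
    simp only [Pi.add_apply, Int.cast_add, mul_add, Finset.sum_add_distrib, RCLike.inner_apply,
      conj_trivial]
    ring
  have h2 : (∀ u v : V, Φ.graph.Adj u v →
      inner ℝ (Φ.p v - Φ.p u) ((h.velocities x).1 v - (h.velocities x).1 u) = 0) ↔
      ∀ e δ, ∑ k, B.dir e k * (x.1 (B.tgt e) (δ + B.color e) k - x.1 (B.src e) δ k +
        ∑ l, x.2 k l * B.color e l) = 0 := by
    constructor
    · intro h' e δ
      rw [← hinner]
      exact h' _ _ ((h.adj_iff _ _).mpr ⟨e, δ, Or.inl ⟨rfl, rfl⟩⟩)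
    · intro h' u v huv
      obtain ⟨e, δ, ⟨rfl, rfl⟩ | ⟨rfl, rfl⟩⟩ := (h.adj_iff u v).mp huv
      · rw [hinner, h']
      · rw [← neg_sub (Φ.p _), ← neg_sub ((h.velocities x).1 _), inner_neg_neg, hinner, h']
  exact and_congr h1 h2

theorem finrank_infinitesimalMotions (h : B.IsQuotientOf Φ rep) (Λ : AddSubgroup (Fin d → ℤ)) :
    Module.finrank ℝ (Φ.infinitesimalMotions Λ) = Module.finrank ℝ (B.motions Λ) := by
  have : (B.motions Λ).map h.velocities = Φ.infinitesimalMotions Λ := by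
    ext w
    obtain ⟨x, rfl⟩ := h.velocities_surjective w
    rw [velocities_mem_iff, Submodule.mem_map]
    constructor
    · rintro ⟨x', hx', h'⟩
      rwa [← h.velocities_injective h']
    · exact fun hx => ⟨x, hx, rfl⟩
  rw [← this]
  exact (LinearEquiv.finrank_eq
    (Submodule.equivMapOfInjective _ h.velocities_injective _)).symm

end IsQuotientOf

end ColoredBars

/-! ## Fraction-free orthogonalization of lists of real polynomials -/

/-- The inner product for which the monomials are orthonormal. -/
noncomputable def polyDot (p q : ℝ[X]) : ℝ := p.sum fun k c => c * q.coeff k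

theorem polyDot_add_left (p p' q : ℝ[X]) : polyDot (p + p') q = polyDot p q + polyDot p' q :=
  Polynomial.sum_add_index _ _ _ (fun _ => zero_mul _) fun _ _ _ => add_mul _ _ _

theorem polyDot_smul_left (a : ℝ) (p q : ℝ[X]) : polyDot (a • p) q = a * polyDot p q := by
  rw [polyDot, Polynomial.sum_smul_index _ _ _ fun _ => zero_mul _, polyDot, Polynomial.sum_def,
    Polynomial.sum_def, Finset.mul_sum]
  exact Finset.sum_congr rfl fun _ _ => mul_assoc _ _ _

theorem polyDot_eq_sum {p : ℝ[X]} {s : Finset ℕ} (hs : p.support ⊆ s) (q : ℝ[X]) :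
    polyDot p q = ∑ k ∈ s, p.coeff k * q.coeff k := by
  rw [polyDot, Polynomial.sum_def]
  refine Finset.sum_subset hs fun k _ hk => ?_
  rw [notMem_support_iff.mp hk, zero_mul]

theorem polyDot_comm (p q : ℝ[X]) : polyDot p q = polyDot q p := by
  rw [polyDot_eq_sum (Finset.subset_union_left (s₂ := q.support)),
    polyDot_eq_sum (Finset.subset_union_right (s₁ := p.support))]
  exact Finset.sum_congr rfl fun _ _ => mul_comm _ _

theorem polyDot_add_right (p q q' : ℝ[X]) : polyDot p (q + q') = polyDot p q + polyDot p q' := by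
  rw [polyDot_comm, polyDot_add_left, polyDot_comm q, polyDot_comm q']

theorem polyDot_smul_right (a : ℝ) (p q : ℝ[X]) : polyDot p (a • q) = a * polyDot p q := by
  rw [polyDot_comm, polyDot_smul_left, polyDot_comm]

theorem polyDot_zero_left (q : ℝ[X]) : polyDot 0 q = 0 := by
  simp [polyDot]

theorem polyDot_zero_right (q : ℝ[X]) : polyDot q 0 = 0 := by
  rw [polyDot_comm, polyDot_zero_left]

theorem polyDot_self_eq_zero {p : ℝ[X]} : polyDot p p = 0 ↔ p = 0 := by
  constructor
  · intro h
    rw [polyDot_eq_sum subset_rfl, Finset.sum_eq_zero_iff_of_nonneg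
      (fun k _ => mul_self_nonneg _)] at h
    ext k
    by_cases hk : k ∈ p.support
    · exact mul_self_eq_zero.mp (h k hk)
    · exact notMem_support_iff.mp hk
  · rintro rfl
    exact polyDot_zero_left _

/-- A multiple of the component of `a` orthogonal to `b`. -/
noncomputable def polyProject (b a : ℝ[X]) : ℝ[X] := polyDot b b • a - polyDot a b • b

theorem polyDot_polyProject (b a : ℝ[X]) : polyDot (polyProject b a) b = 0 := by
  rw [polyProject, sub_eq_add_neg, ← neg_smul, polyDot_add_left, polyDot_smul_left,
    polyDot_smul_left]
  ring

/-- The span of the entries of a list. -/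
noncomputable def listSpan (l : List ℝ[X]) : Submodule ℝ ℝ[X] := Submodule.span ℝ {p | p ∈ l}

instance (l : List ℝ[X]) : FiniteDimensional ℝ (listSpan l) :=
  FiniteDimensional.span_of_finite ℝ l.finite_toSet

theorem mem_listSpan {l : List ℝ[X]} {p : ℝ[X]} (hp : p ∈ l) : p ∈ listSpan l :=
  Submodule.subset_span hp

theorem listSpan_nil : listSpan [] = ⊥ := by
  simp [listSpan]

theorem listSpan_zero_cons (l : List ℝ[X]) : listSpan (0 :: l) = listSpan l := by
  apply le_antisymm
  · rw [listSpan, Submodule.span_le]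
    intro p hp
    rcases List.mem_cons.mp hp with rfl | hp
    · exact zero_mem _
    · exact mem_listSpan hp
  · exact Submodule.span_mono fun p hp => List.mem_cons_of_mem _ hp

theorem finrank_listSpan_le (l : List ℝ[X]) : Module.finrank ℝ (listSpan l) ≤ l.length := by
  classical
  have h : {p | p ∈ l} = (l.toFinset : Set ℝ[X]) := by ext; simp
  rw [listSpan, h]
  exact (finrank_span_finset_le_card _).trans (List.toFinset_card_le l)

/-- The projections of the tail are orthogonal to `b`, and together with `b` they span the same
space because `polyDot b b` is invertible. -/
theorem finrank_listSpan_cons {b : ℝ[X]} (hb : b ≠ 0) (l : List ℝ[X]) :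
    Module.finrank ℝ (listSpan (b :: l)) =
      Module.finrank ℝ (listSpan (l.map (polyProject b))) + 1 := by
  have hbb : polyDot b b ≠ 0 := fun h => hb (polyDot_self_eq_zero.mp h)
  have horth : ∀ p ∈ listSpan (l.map (polyProject b)), polyDot p b = 0 := by
    intro p hp
    induction hp using Submodule.span_induction with
    | mem p hp =>
      obtain ⟨a, -, rfl⟩ := List.mem_map.mp hp
      exact polyDot_polyProject b a
    | zero => exact polyDot_zero_left b
    | add p q _ _ hp hq => rw [polyDot_add_left, hp, hq, add_zero]
    | smul c p _ hp => rw [polyDot_smul_left, hp, mul_zero]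
  have hsup : listSpan (l.map (polyProject b)) ⊔ Submodule.span ℝ {b} = listSpan (b :: l) := by
    apply le_antisymm
    · refine sup_le ?_ ?_
      · rw [listSpan, Submodule.span_le]
        intro p hp
        obtain ⟨a, ha, rfl⟩ := List.mem_map.mp hp
        exact Submodule.sub_mem _ (Submodule.smul_mem _ _ (mem_listSpan (List.mem_cons_of_mem _ ha)))
          (Submodule.smul_mem _ _ (mem_listSpan List.mem_cons_self))
      · rw [Submodule.span_singleton_le_iff_mem]
        exact mem_listSpan List.mem_cons_self
    · rw [listSpan, Submodule.span_le]
      intro p hp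
      have hbmem : b ∈ listSpan (l.map (polyProject b)) ⊔ Submodule.span ℝ {b} :=
        Submodule.mem_sup_right (Submodule.mem_span_singleton_self b)
      rcases List.mem_cons.mp hp with rfl | hp
      · exact hbmem
      · have h1 : polyProject b p ∈ listSpan (l.map (polyProject b)) ⊔ Submodule.span ℝ {b} :=
          Submodule.mem_sup_left (mem_listSpan (List.mem_map_of_mem hp))
        have h2 : p = (polyDot b b)⁻¹ • (polyProject b p + polyDot p b • b) := by
          rw [polyProject, sub_add_cancel, smul_smul, inv_mul_cancel₀ hbb, one_smul]
        rw [h2]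
        exact Submodule.smul_mem _ _ (Submodule.add_mem _ h1 (Submodule.smul_mem _ _ hbmem))
  have hinf : listSpan (l.map (polyProject b)) ⊓ Submodule.span ℝ {b} = ⊥ := by
    rw [Submodule.eq_bot_iff]
    rintro p ⟨h1, h2⟩
    obtain ⟨c, rfl⟩ := Submodule.mem_span_singleton.mp h2
    have h3 := horth _ h1
    rw [polyDot_smul_left] at h3
    rw [(mul_eq_zero.mp h3).resolve_right hbb, zero_smul]
  have h := Submodule.finrank_sup_add_finrank_inf_eq (listSpan (l.map (polyProject b)))
    (Submodule.span ℝ {b})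
  rwa [hsup, hinf, finrank_bot, add_zero, finrank_span_singleton hb] at h

/-- One orthogonalization step. -/
noncomputable def orthoStep : List ℝ[X] → List ℝ[X]
  | [] => []
  | b :: l => l.map (polyProject b)

/-- Independence of `l` ensures that every head is nonzero when it is used, so each step lowers the
dimension by exactly one. What is left of `g` at the end vanishes iff `g` adds no dimension. -/
theorem orthoStep_iterate_eq_zero_iff (l : List ℝ[X])
    (hl : Module.finrank ℝ (listSpan l) = l.length) (g : ℝ[X]) :
    (orthoStep^[l.length] (l ++ [g])).headI = 0 ↔ g ∈ listSpan l := by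
  have key : ∀ (k : ℕ) (l : List ℝ[X]) (g : ℝ[X]), l.length = k →
      Module.finrank ℝ (listSpan l) = l.length →
      ((orthoStep^[l.length] (l ++ [g])).headI ≠ 0 ↔
        Module.finrank ℝ (listSpan (l ++ [g])) = l.length + 1) := by
    intro k
    induction k with
    | zero =>
      intro l g hk _
      obtain rfl := List.length_eq_zero_iff.mp hk
      simp only [List.length_nil, Function.iterate_zero, id, List.nil_append, List.headI_cons,
        zero_add]
      constructor
      · intro hg
        rw [finrank_listSpan_cons hg]
        simp [listSpan_nil]
      · rintro h rfl
        change Module.finrank ℝ (listSpan [0]) = 1 at h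
        rw [listSpan_zero_cons, listSpan_nil, finrank_bot] at h
        exact zero_ne_one h
    | succ k ih =>
      intro l g hk hl
      cases l with
      | nil => simp at hk
      | cons b l =>
        have hb : b ≠ 0 := by
          rintro rfl
          have := finrank_listSpan_le l
          rw [listSpan_zero_cons] at hl
          simp only [List.length_cons] at hl
          omega
        have hl' : Module.finrank ℝ (listSpan (l.map (polyProject b))) =
            (l.map (polyProject b)).length := by
          rw [finrank_listSpan_cons hb] at hl
          simpa using hl
        have h := ih (l.map (polyProject b)) (polyProject b g) (by simpa using hk) hl'
        rw [List.cons_append, finrank_listSpan_cons hb, List.map_append, List.map_singleton,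
          List.length_cons, Function.iterate_succ_apply]
        have e : orthoStep (b :: (l ++ [g])) = l.map (polyProject b) ++ [polyProject b g] := by
          simp [orthoStep]
        rw [e]
        rw [List.length_map] at h
        rw [h]
        omega
  rw [← not_iff_not, ← ne_eq, key _ l g rfl hl]
  have hmono : listSpan l ≤ listSpan (l ++ [g]) :=
    Submodule.span_mono fun p hp => List.mem_append_left _ hp
  constructor
  · intro h hg
    have h1 : listSpan (l ++ [g]) = listSpan l := by
      refine le_antisymm ?_ hmono
      rw [listSpan, Submodule.span_le]
      intro p hp
      rcases List.mem_append.mp hp with hp | hp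
      · exact mem_listSpan hp
      · rw [List.mem_singleton.mp hp]
        exact hg
    rw [h1] at h
    omega
  · intro hg
    have h1 : listSpan l < listSpan (l ++ [g]) := by
      refine lt_of_le_of_ne hmono fun h => hg ?_
      rw [h]
      exact mem_listSpan (by simp)
    have h2 := Submodule.finrank_lt_finrank_of_lt h1
    have h3 := finrank_listSpan_le (l ++ [g])
    rw [List.length_append, List.length_singleton] at h3
    omega

theorem finrank_listSpan_shifts {f : ℝ[X]} (hf : f ≠ 0) (n : ℕ) :
    Module.finrank ℝ (listSpan ((List.range n).map fun k => X ^ k * f)) = n := by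
  have h1 : LinearIndependent ℝ fun k : Fin n => X ^ (k : ℕ) * f := by
    have h2 : LinearIndependent ℝ fun k : Fin n => (X ^ (k : ℕ) : ℝ[X]) := by
      have h3 := (Polynomial.basisMonomials ℝ).linearIndependent.comp (fun k : Fin n => (k : ℕ))
        Fin.val_injective
      convert h3 using 1
      funext k
      simp [Polynomial.coe_basisMonomials, X_pow_eq_monomial]
    have h3 : LinearMap.ker (LinearMap.mulRight ℝ f) = ⊥ := by
      rw [LinearMap.ker_eq_bot']
      intro p hp
      exact (mul_eq_zero.mp hp).resolve_right hf
    exact h2.map' (LinearMap.mulRight ℝ f) h3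
  have h2 := finrank_span_eq_card h1
  rw [Fintype.card_fin] at h2
  have e : {p | p ∈ (List.range n).map fun k => X ^ k * f} =
      Set.range fun k : Fin n => X ^ (k : ℕ) * f := by
    ext p
    simp only [Set.mem_ofPred_eq, List.mem_map, List.mem_range, Set.mem_range]
    constructor
    · rintro ⟨k, hk, rfl⟩
      exact ⟨⟨k, hk⟩, rfl⟩
    · rintro ⟨k, rfl⟩
      exact ⟨k, k.2, rfl⟩
  rw [listSpan, e, h2]

/-- This turns divisibility into linear algebra: the quotient has degree below `n`, so the first `n`
shifts of `f` suffice. -/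
theorem mem_listSpan_shifts_iff {f g : ℝ[X]} (hf : f ≠ 0) {n : ℕ} (hg : g.natDegree < n) :
    g ∈ listSpan ((List.range n).map fun k => X ^ k * f) ↔ f ∣ g := by
  constructor
  · intro h
    clear hg
    induction h using Submodule.span_induction with
    | mem p hp =>
      obtain ⟨k, -, rfl⟩ := List.mem_map.mp hp
      exact Dvd.intro_left _ rfl
    | zero => exact dvd_zero f
    | add p q _ _ hp hq => exact dvd_add hp hq
    | smul c p _ hp => exact (smul_eq_C_mul (p := p) c) ▸ hp.mul_left _
  · rintro ⟨q, rfl⟩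
    by_cases hq : q = 0
    · subst hq
      rw [mul_zero]
      exact zero_mem _
    have hdeg : q.natDegree < n := by
      rw [natDegree_mul hf hq] at hg
      omega
    rw [q.as_sum_range' n hdeg, Finset.mul_sum]
    refine Submodule.sum_mem _ fun k hk => ?_
    have e : f * monomial k (q.coeff k) = q.coeff k • (X ^ k * f) := by
      rw [← C_mul_X_pow_eq_monomial, smul_eq_C_mul]
      ring
    rw [e]
    exact Submodule.smul_mem _ _ (mem_listSpan (List.mem_map.mpr ⟨k, by simpa using hk, rfl⟩))

/-! ## Arithmetic of coded polynomials -/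

/-- Indexing by the values with default exponent `0` removes the dependence on the length of the
exponent list, so that addition of exponents is multiplicative. -/
theorem prod_zipWith_pow_eq {R : Type*} [CommRing R] (z : List R) (es : List ℕ) :
    (List.zipWith (fun a e => a ^ e) z es).prod =
      ∏ i ∈ Finset.range z.length, z.getD i 1 ^ es.getD i 0 := by
  induction z generalizing es with
  | nil => simp
  | cons a z ih =>
    rw [List.length_cons, Finset.prod_range_succ']
    cases es with
    | nil => simp
    | cons e es =>
      rw [List.zipWith_cons_cons, List.prod_cons, ih, mul_comm]
      simp

/-- Addition of exponent vectors of possibly different lengths. -/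
def addExponents (a b : List ℕ) : List ℕ :=
  -- The sum of the lengths is an upper bound for both; trailing zero exponents are harmless.
  (List.range (a.length + b.length)).map fun i => a.getD i 0 + b.getD i 0

theorem getD_addExponents (a b : List ℕ) (i : ℕ) :
    (addExponents a b).getD i 0 = a.getD i 0 + b.getD i 0 := by
  by_cases hi : i < a.length + b.length
  · simp [addExponents, List.getD_eq_getElem?_getD, hi]
  · have h1 : a.length ≤ i := by omega
    have h2 : b.length ≤ i := by omega
    simp [addExponents, List.getD_eq_getElem?_getD, hi, h1, h2]

theorem prod_zipWith_pow_addExponents {R : Type*} [CommRing R] (z : List R) (a b : List ℕ) :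
    (List.zipWith (fun x e => x ^ e) z (addExponents a b)).prod =
      (List.zipWith (fun x e => x ^ e) z a).prod * (List.zipWith (fun x e => x ^ e) z b).prod := by
  simp only [prod_zipWith_pow_eq, getD_addExponents, pow_add, Finset.prod_mul_distrib]

namespace PolyCode

section Eval

variable {R : Type*} [CommRing R] (z : List R)

theorem eval_nil : eval ([] : PolyCode) z = 0 := by
  simp [eval]

theorem eval_cons (t : ℤ × List ℕ) (f : PolyCode) :
    eval (t :: f : PolyCode) z =
      (t.1 : R) * (List.zipWith (fun a e => a ^ e) z t.2).prod + eval f z := by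
  simp [eval]

theorem eval_append (f g : PolyCode) : eval (f ++ g : PolyCode) z = eval f z + eval g z := by
  simp [eval]

theorem eval_flatMap {α : Type*} (l : List α) (f : α → PolyCode) :
    eval (l.flatMap f : PolyCode) z = (l.map fun a => eval (f a) z).sum := by
  induction l with
  | nil => simp [eval_nil]
  | cons a l ih => rw [List.flatMap_cons, eval_append, ih, List.map_cons, List.sum_cons]

theorem map_eval {S : Type*} [CommRing S] (φ : R →+* S) (f : PolyCode) :
    φ (eval f z) = eval f (z.map φ) := by
  have h : ∀ es : List ℕ, φ (List.zipWith (fun a e => a ^ e) z es).prod =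
      (List.zipWith (fun a e => a ^ e) (z.map φ) es).prod := by
    intro es
    rw [map_list_prod, List.map_zipWith, List.zipWith_map_left]
    simp only [map_pow]
  induction f with
  | nil => rw [eval_nil, eval_nil, map_zero]
  | cons t f ih => rw [eval_cons, eval_cons, map_add, map_mul, map_intCast, h, ih]

end Eval

/-- A coded polynomial as a polynomial in its first variable. -/
noncomputable def toPoly (f : PolyCode) (y : List ℝ) : ℝ[X] :=
  eval f ((X : ℝ[X]) :: y.map fun r => C r)

/-- The value of a monomial. -/
def monomialValue (y : List ℝ) (es : List ℕ) : ℝ := (List.zipWith (fun a e => a ^ e) y es).prod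

theorem toPoly_nil (y : List ℝ) : toPoly [] y = 0 := eval_nil _

theorem toPoly_cons (t : ℤ × List ℕ) (f : PolyCode) (y : List ℝ) :
    toPoly (t :: f) y = ((t.1 : ℝ) * monomialValue y t.2.tail) • X ^ t.2.headI + toPoly f y := by
  rw [toPoly, eval_cons, toPoly]
  congr 1
  rw [smul_eq_C_mul, C_mul, map_intCast, mul_assoc]
  congr 1
  obtain ⟨c, es⟩ := t
  cases es with
  | nil => simp [monomialValue]
  | cons e es =>
    have h := prod_zipWith_pow_C y es
    simp only [List.zipWith_cons_cons, List.prod_cons, List.tail_cons, List.headI_cons,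
      monomialValue]
    rw [h, mul_comm]

theorem toPoly_append (f g : PolyCode) (y : List ℝ) :
    toPoly (f ++ g) y = toPoly f y + toPoly g y := eval_append _ _ _

theorem toPoly_flatMap {α : Type*} (l : List α) (f : α → PolyCode) (y : List ℝ) :
    toPoly (l.flatMap f) y = (l.map fun a => toPoly (f a) y).sum := eval_flatMap _ _ _

theorem eval_cons_eq_eval_toPoly (f : PolyCode) (x : ℝ) (y : List ℝ) :
    eval f (x :: y) = Polynomial.eval x (toPoly f y) := by
  rw [toPoly, ← coe_evalRingHom, map_eval]
  congr 1
  simp [Function.comp_def]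

theorem eval_cons' (t : ℤ × List ℕ) (f : PolyCode) (y : List ℝ) :
    eval (t :: f : PolyCode) y = (t.1 : ℝ) * monomialValue y t.2 + eval f y := eval_cons _ _ _

/-- The inner product of two coded polynomials with respect to their first variable. -/
def dot (f g : PolyCode) : PolyCode :=
  f.flatMap fun s => g.flatMap fun t =>
    if s.2.headI = t.2.headI then [(s.1 * t.1, addExponents s.2.tail t.2.tail)] else []

theorem monomialValue_addExponents (y : List ℝ) (a b : List ℕ) :
    monomialValue y (addExponents a b) = monomialValue y a * monomialValue y b :=
  prod_zipWith_pow_addExponents _ _ _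

theorem polyDot_X_pow (a b : ℕ) : polyDot (X ^ a) (X ^ b) = if a = b then 1 else 0 := by
  rw [polyDot, ← monomial_one_right_eq_X_pow, Polynomial.sum_monomial_index _ _ (by simp),
    coeff_X_pow, one_mul]

theorem eval_dot (f g : PolyCode) (y : List ℝ) :
    eval (dot f g) y = polyDot (toPoly f y) (toPoly g y) := by
  induction f with
  | nil => rw [toPoly_nil, polyDot_zero_left]; exact eval_nil y
  | cons s f ih =>
    have e : dot (s :: f) g = (g.flatMap fun t =>
      if s.2.headI = t.2.headI then [(s.1 * t.1, addExponents s.2.tail t.2.tail)] else []) ++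
        dot f g := by simp [dot]
    rw [e, eval_append, ih, toPoly_cons, polyDot_add_left]
    congr 1
    clear ih e
    induction g with
    | nil => rw [toPoly_nil, polyDot_zero_right]; exact eval_nil y
    | cons t g ih =>
      rw [List.flatMap_cons, eval_append, ih, toPoly_cons, polyDot_add_right, polyDot_smul_left,
        polyDot_smul_left, polyDot_smul_right, polyDot_X_pow]
      congr 1
      split_ifs with h
      · rw [eval_cons', eval_nil, monomialValue_addExponents]
        push_cast
        ring
      · rw [eval_nil]
        ring

/-- The product of a coded polynomial that does not involve the first variable with another coded
polynomial. -/
def scale (a f : PolyCode) : PolyCode :=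
  a.flatMap fun s => f.map fun t => (s.1 * t.1, t.2.headI :: addExponents s.2 t.2.tail)

theorem toPoly_scale (a f : PolyCode) (y : List ℝ) :
    toPoly (scale a f) y = eval a y • toPoly f y := by
  induction a with
  | nil => rw [eval_nil, zero_smul]; exact toPoly_nil y
  | cons s a ih =>
    have e : scale (s :: a) f =
      (f.map fun t => (s.1 * t.1, t.2.headI :: addExponents s.2 t.2.tail)) ++ scale a f := by
      simp [scale]
    rw [e, toPoly_append, ih, eval_cons', add_smul]
    congr 1
    clear ih e
    induction f with
    | nil => rw [toPoly_nil, smul_zero]; exact toPoly_nil y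
    | cons t f ih =>
      rw [List.map_cons, toPoly_cons, ih, toPoly_cons, smul_add, smul_smul]
      simp only [List.tail_cons, List.headI_cons, monomialValue_addExponents]
      congr 2
      push_cast
      ring

/-- The negative of a coded polynomial. -/
def neg (f : PolyCode) : PolyCode := f.map fun t => (-t.1, t.2)

theorem toPoly_neg (f : PolyCode) (y : List ℝ) : toPoly (neg f) y = -toPoly f y := by
  induction f with
  | nil => rw [toPoly_nil, neg_zero]; exact toPoly_nil y
  | cons t f ih =>
    have e : neg (t :: f) = (-t.1, t.2) :: neg f := rfl
    rw [e, toPoly_cons, ih, toPoly_cons, neg_add, ← neg_smul]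
    push_cast
    rw [neg_mul]

/-- Fraction-free orthogonal projection. -/
def project (b a : PolyCode) : PolyCode := scale (dot b b) a ++ neg (scale (dot a b) b)

theorem toPoly_project (b a : PolyCode) (y : List ℝ) :
    toPoly (project b a) y = polyProject (toPoly b y) (toPoly a y) := by
  rw [project, toPoly_append, toPoly_neg, toPoly_scale, toPoly_scale, eval_dot, eval_dot,
    polyProject, sub_eq_add_neg]

/-- Multiplication by a power of the first variable. -/
def shift (f : PolyCode) (k : ℕ) : PolyCode := f.map fun t => (t.1, (k + t.2.headI) :: t.2.tail)

theorem toPoly_shift (f : PolyCode) (k : ℕ) (y : List ℝ) :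
    toPoly (shift f k) y = X ^ k * toPoly f y := by
  induction f with
  | nil => rw [toPoly_nil, mul_zero]; exact toPoly_nil y
  | cons t f ih =>
    have e : shift (t :: f) k = (t.1, (k + t.2.headI) :: t.2.tail) :: shift f k := rfl
    rw [e, toPoly_cons, ih, toPoly_cons, mul_add, mul_smul_comm, ← pow_add]
    rfl

/-- One orthogonalization step on coded polynomials. -/
def orthoStepCode : List PolyCode → List PolyCode
  | [] => []
  | b :: l => l.map (project b)

theorem map_orthoStepCode (l : List PolyCode) (y : List ℝ) :
    (orthoStepCode l).map (toPoly · y) = orthoStep (l.map (toPoly · y)) := by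
  cases l with
  | nil => rfl
  | cons b l => simp [orthoStepCode, orthoStep, toPoly_project]

theorem map_orthoStepCode_iterate (l : List PolyCode) (k : ℕ) (y : List ℝ) :
    (orthoStepCode^[k] l).map (toPoly · y) = orthoStep^[k] (l.map (toPoly · y)) := by
  induction k generalizing l with
  | zero => rfl
  | succ k ih => rw [Function.iterate_succ_apply, ih, Function.iterate_succ_apply, map_orthoStepCode]

/-- The component of `g` orthogonal to the multiples of `f` of bounded degree. -/
def remainder (f g : PolyCode) : PolyCode :=
  (orthoStepCode^[headDegree g + 1]
    ((List.range (headDegree g + 1)).map (shift f) ++ [g])).headI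

theorem natDegree_toPoly_le (f : PolyCode) (y : List ℝ) :
    (toPoly f y).natDegree ≤ f.headDegree := natDegree_eval_le f y

theorem toPoly_headI (l : List PolyCode) (y : List ℝ) :
    toPoly l.headI y = (l.map (toPoly · y)).headI := by
  cases l with
  | nil => exact toPoly_nil y
  | cons _ _ => rfl

/-- The shifts of `f` up to the degree bound of `g` are independent, and `g` lies in their span iff
it is a multiple of `f`. Gram–Schmidt thus replaces Euclidean division and needs no inverses. -/
theorem toPoly_remainder_eq_zero_iff {f : PolyCode} {y : List ℝ} (hf : toPoly f y ≠ 0)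
    (g : PolyCode) : toPoly (remainder f g) y = 0 ↔ toPoly f y ∣ toPoly g y := by
  have h1 : ((List.range (headDegree g + 1)).map (shift f) ++ [g]).map (toPoly · y) =
      ((List.range (headDegree g + 1)).map fun k => X ^ k * toPoly f y) ++ [toPoly g y] := by
    simp [toPoly_shift, Function.comp_def]
  have h2 := orthoStep_iterate_eq_zero_iff
    ((List.range (headDegree g + 1)).map fun k => X ^ k * toPoly f y)
    (by rw [finrank_listSpan_shifts hf]; simp) (toPoly g y)
  rw [mem_listSpan_shifts_iff hf (Nat.lt_succ_of_le (natDegree_toPoly_le g y)), List.length_map,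
    List.length_range] at h2
  rw [remainder, toPoly_headI, map_orthoStepCode_iterate, h1, h2]

/-- Elimination of the first variable from the condition that a coded polynomial vanishes. -/
def eliminate (g : PolyCode) (o : Option PolyCode) : PolyCode :=
  o.elim (dot g g) fun f => dot (remainder f g) (remainder f g)

theorem eval_dot_self_eq_zero_iff (g : PolyCode) (y : List ℝ) :
    eval (dot g g) y = 0 ↔ toPoly g y = 0 := by
  rw [eval_dot, polyDot_self_eq_zero]

/-- The test whether a coded polynomial vanishes at the numbers presented by a field code. -/
def isZero (F : FieldCode) (g : PolyCode) : Bool :=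
  decide (((F.foldl eliminate g).map Prod.fst).sum = 0)

/-- Transcendence and minimality are statements over the field generated by `y`, so the coefficients
have to be seen in it. -/
theorem exists_lift_toPoly (g : PolyCode) (y : List ℝ) :
    ∃ G : (IntermediateField.adjoin ℚ {z : ℝ | z ∈ y})[X],
      toPoly g y = G.map (algebraMap (IntermediateField.adjoin ℚ {z : ℝ | z ∈ y}) ℝ) := by
  set K := IntermediateField.adjoin ℚ {z : ℝ | z ∈ y} with hK
  have hy : ∀ z ∈ y, z ∈ K := fun z hz => IntermediateField.subset_adjoin ℚ _ hz
  clear_value K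
  lift y to List K using hy
  refine ⟨eval g ((X : K[X]) :: y.map fun r => C r), ?_⟩
  rw [← coe_mapRingHom, map_eval, toPoly]
  congr 1
  simp [Function.comp_def]

/-- Consider `g` as a polynomial in the last generator `x`. It vanishes at a transcendental `x` iff
it is zero, and at an algebraic `x` iff the minimal polynomial divides it, iff the remainder is
zero. Either condition says that a sum of squares of coefficients, an integer polynomial in the
earlier generators, vanishes; with no generators left it is an equation between integers. -/
theorem isZero_iff {F : FieldCode} {y : List ℝ} (h : F.Presents y) (g : PolyCode) :
    isZero F g = true ↔ eval g y = 0 := by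
  induction F generalizing g y with
  | nil =>
    cases y with
    | nil =>
      have e : eval g ([] : List ℝ) = (((g.map Prod.fst).sum : ℤ) : ℝ) := by
        induction g with
        | nil => simp [eval_nil]
        | cons t g ih => rw [eval_cons, ih]; simp
      rw [e, isZero, decide_eq_true_iff, List.foldl_nil, Int.cast_eq_zero]
    | cons _ _ => exact h.elim
  | cons o F ih =>
    cases y with
    | nil => cases o <;> exact h.elim
    | cons x y =>
      have e : isZero (o :: F) g = isZero F (eliminate g o) := rfl
      rw [e]
      obtain ⟨G, hG⟩ := exists_lift_toPoly g y
      have hx : eval g (x :: y) = aeval x G := by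
        rw [eval_cons_eq_eval_toPoly, hG, eval_map_algebraMap]
      cases o with
      | none =>
        obtain ⟨hF, hx'⟩ := h
        rw [ih hF, eliminate, Option.elim_none, eval_dot_self_eq_zero_iff, hx]
        constructor
        · intro h0
          rw [hG, Polynomial.map_eq_zero] at h0
          rw [h0, map_zero]
        · intro h0
          rw [hG, transcendental_iff.mp hx' G h0, Polynomial.map_zero]
      | some f =>
        obtain ⟨hF, hx', a, ha, hf⟩ := h
        have hf0 : toPoly f y ≠ 0 := by
          rw [toPoly, hf]
          refine mul_ne_zero (C_ne_zero.mpr ha) ?_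
          rw [Polynomial.map_ne_zero_iff (RingHom.injective _)]
          exact minpoly.ne_zero hx'.isIntegral
        rw [ih hF, eliminate, Option.elim_some, eval_dot_self_eq_zero_iff,
          toPoly_remainder_eq_zero_iff hf0, hx, hG, toPoly, hf,
          (isUnit_C.mpr ha.isUnit).mul_left_dvd, Polynomial.map_dvd_map' ,
          minpoly.dvd_iff]

/-- One step of the rank computation: the head of the list is discarded if it vanishes; otherwise it
is counted, and the remaining vectors are projected. -/
def rankStep (F : FieldCode) (s : ℕ × List PolyCode) : ℕ × List PolyCode :=
  if isZero F (dot s.2.headI s.2.headI) then (s.1, s.2.tail)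
  else (s.1 + 1, s.2.tail.map (project s.2.headI))

/-- The rank of a list of coded vectors over the field presented by a field code. -/
def rank (F : FieldCode) (l : List PolyCode) : ℕ := ((rankStep F)^[l.length] (0, l)).1

/-- The counter plus the dimension of the span of the remaining list is invariant: a zero head
contributes nothing, a nonzero one exactly one dimension. -/
theorem rank_eq {F : FieldCode} {y : List ℝ} (h : F.Presents y) (l : List PolyCode) :
    rank F l = Module.finrank ℝ (listSpan (l.map (toPoly · y))) := by
  have key : ∀ (k : ℕ) (c : ℕ) (l : List PolyCode), l.length = k →
      ((rankStep F)^[k] (c, l)).1 = c + Module.finrank ℝ (listSpan (l.map (toPoly · y))) := by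
    intro k
    induction k with
    | zero =>
      intro c l hl
      obtain rfl := List.length_eq_zero_iff.mp hl
      have h0 : Module.finrank ℝ (listSpan []) = 0 := by
        rw [listSpan_nil, finrank_bot]
      exact h0.symm ▸ rfl
    | succ k ih =>
      intro c l hl
      cases l with
      | nil => simp at hl
      | cons b l =>
        rw [List.length_cons, Nat.succ.injEq] at hl
        rw [Function.iterate_succ_apply, List.map_cons]
        by_cases hb : toPoly b y = 0
        · have e : rankStep F (c, b :: l) = (c, l) := by
            rw [rankStep, if_pos]
            · rfl
            · rw [isZero_iff h, eval_dot_self_eq_zero_iff]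
              exact hb
          rw [e, ih _ _ hl, hb, listSpan_zero_cons]
        · have e : rankStep F (c, b :: l) = (c + 1, l.map (project b)) := by
            rw [rankStep, if_neg]
            · rfl
            · rw [isZero_iff h, eval_dot_self_eq_zero_iff]
              exact hb
          rw [e, ih _ _ (by rw [List.length_map, hl]), finrank_listSpan_cons hb]
          have e2 : (l.map (project b)).map (toPoly · y) =
              (l.map (toPoly · y)).map (polyProject (toPoly b y)) := by
            simp [toPoly_project]
          rw [e2]
          omega
  rw [rank, key _ _ _ rfl, zero_add]

end PolyCode

/-! ## The linear system as a list of coded polynomials -/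

theorem sum_map_range {α : Type*} [AddCommMonoid α] (n : ℕ) (f : ℕ → α) :
    ((List.range n).map f).sum = ∑ i : Fin n, f i := by
  rw [← Finset.sum_range]
  rfl

/-- The lists of `d` numbers less than `N`. -/
def residueBox (N d : ℕ) : List (List ℕ) :=
  (fun L : List (List ℕ) => L.flatMap fun r => (List.range N).map fun a => a :: r)^[d] [[]]

theorem mem_residueBox {N d : ℕ} {r : List ℕ} :
    r ∈ residueBox N d ↔ r.length = d ∧ ∀ a ∈ r, a < N := by
  induction d generalizing r with
  | zero => simp [residueBox, List.length_eq_zero_iff]; rintro rfl; simp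
  | succ d ih =>
    rw [residueBox, Function.iterate_succ_apply', ← residueBox]
    simp only [List.mem_flatMap, List.mem_map, List.mem_range, ih]
    constructor
    · rintro ⟨r, ⟨rfl, hr⟩, a, ha, rfl⟩
      simpa using ⟨ha, hr⟩
    · rintro ⟨h1, h2⟩
      cases r with
      | nil => simp at h1
      | cons a r =>
        simp only [List.length_cons, Nat.succ.injEq] at h1
        exact ⟨r, ⟨h1, fun b hb => h2 b (List.mem_cons_of_mem _ hb)⟩, a, h2 a List.mem_cons_self, rfl⟩

/-- The residue of an integer modulo a positive number. -/
def intResidue (N : ℕ) (z : ℤ) : ℕ := (z.toNat + (N - 1) * (-z).toNat) % N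

theorem intResidue_lt {N : ℕ} (hN : 0 < N) (z : ℤ) : intResidue N z < N := Nat.mod_lt _ hN

/-- The factor `N - 1` represents `-1` modulo `N`, so only the natural positive and negative parts
of `z` enter. -/
theorem cast_intResidue {N : ℕ} (hN : 0 < N) (z : ℤ) : (intResidue N z : ZMod N) = z := by
  rw [intResidue, ZMod.natCast_mod, Nat.cast_add, Nat.cast_mul, Nat.cast_sub hN, ZMod.natCast_self]
  have h : (z : ZMod N) = ((z.toNat : ℤ) : ZMod N) - (((-z).toNat : ℤ) : ZMod N) := by
    rw [← Int.cast_sub]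
    congr 1
    omega
  rw [h]
  push_cast
  ring

/-- The exponent that stands for a coordinate of the velocity of a vertex. -/
def vertexLabel (i k : ℕ) (r : List ℕ) : ℕ := Encodable.encode (0 :: i :: k :: r)

/-- The exponent that stands for an entry of the velocity of the lattice. -/
def latticeLabel (k l : ℕ) : ℕ := Encodable.encode [1, k, l]

namespace EdgeCode

/-- The residues of the translate by the color of an edge. -/
def translate (N d : ℕ) (e : EdgeCode) (r : List ℕ) : List ℕ :=
  (List.range d).map fun l => (r.getD l 0 + intResidue N (e.2.2.getD l 0)) % N

/-- The terms of the `k`-th coordinate of the direction of an edge: coefficients and places in the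
list of generators. -/
def directionTerms (d : ℕ) (P A : List (List ℕ)) (e : EdgeCode) (k : ℕ) : List (ℤ × ℕ) :=
  (1, (P.getD e.2.1 []).getD k 0) :: (-1, (P.getD e.1 []).getD k 0) ::
    (List.range d).map fun l => (e.2.2.getD l 0, (A.getD k []).getD l 0)

/-- The terms of the `k`-th coordinate of the velocity of an edge: coefficients and labels. -/
def velocityTerms (N d : ℕ) (e : EdgeCode) (r : List ℕ) (k : ℕ) : List (ℤ × ℕ) :=
  (1, vertexLabel e.2.1 k (translate N d e r)) :: (-1, vertexLabel e.1 k r) ::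
    (List.range d).map fun l => (e.2.2.getD l 0, latticeLabel k l)

end EdgeCode

/-- The exponents of a single variable. -/
def variableExponents (t : ℕ) : List ℕ := ((List.range t).map fun _ => 0) ++ [1]

theorem monomialValue_variableExponents {y : List ℝ} {t : ℕ} (ht : t < y.length) :
    PolyCode.monomialValue y (variableExponents t) = y[t] := by
  rw [PolyCode.monomialValue, prod_zipWith_pow_eq, Finset.prod_eq_single t]
  · simp [variableExponents, ht, List.getD_eq_getElem?_getD]
  · intro i _ hi
    rcases lt_or_gt_of_ne hi with h | h
    · simp [variableExponents, List.getD_eq_getElem?_getD, List.getElem?_append, h]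
    · have h2 : i - t ≠ 0 := by omega
      simp [variableExponents, List.getD_eq_getElem?_getD, List.getElem?_append, h.le, h2]
  · simp [ht]

/-- The product of two linear forms, one in the generators and one in the labelled unknowns. -/
def productTerms (S U : List (ℤ × ℕ)) : PolyCode :=
  S.flatMap fun s => U.map fun u => (s.1 * u.1, u.2 :: variableExponents s.2)

/-- The range condition is essential: beyond the end of `y` the variable would evaluate to the empty
product `1`, while the table lookup defaults to `0`. -/
theorem toPoly_productTerms {y : List ℝ} (S U : List (ℤ × ℕ)) (hS : ∀ s ∈ S, s.2 < y.length) :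
    PolyCode.toPoly (productTerms S U) y =
      (S.map fun s => (s.1 : ℝ) * y.getD s.2 0).sum •
        (U.map fun u => (u.1 : ℝ) • (X : ℝ[X]) ^ u.2).sum := by
  induction S with
  | nil => simpa [productTerms] using PolyCode.toPoly_nil y
  | cons s S ih =>
    have hs := hS s (by simp)
    have e : productTerms (s :: S) U =
      (U.map fun u => (s.1 * u.1, u.2 :: variableExponents s.2)) ++ productTerms S U := by
      simp [productTerms]
    rw [e, PolyCode.toPoly_append, ih fun t ht => hS t (List.mem_cons_of_mem _ ht), List.map_cons,
      List.sum_cons, add_smul]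
    congr 1
    clear e ih
    induction U with
    | nil => simpa using PolyCode.toPoly_nil y
    | cons u U ih =>
      rw [List.map_cons, PolyCode.toPoly_cons, ih, List.map_cons, List.sum_cons, smul_add, smul_smul]
      congr 2
      simp only [List.tail_cons, monomialValue_variableExponents hs]
      rw [List.getD_eq_getElem _ _ hs]
      push_cast
      ring

/-- The coded equation of an edge in a residue class. -/
def EdgeCode.row (N d : ℕ) (P A : List (List ℕ)) (e : EdgeCode) (r : List ℕ) : PolyCode :=
  (List.range d).flatMap fun k => productTerms (e.directionTerms d P A k) (e.velocityTerms N d r k)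

/-- The coded linear system for motions periodic with respect to `N ℤ^d`. -/
def FrameworkCode.rows (c : FrameworkCode) (N : ℕ) : List PolyCode :=
  c.2.2.1.flatMap fun e => (residueBox N c.1).map fun r =>
    EdgeCode.row N c.1 c.2.2.2.2.1 c.2.2.2.2.2 e r

/-- The total size of the colors of a code. -/
def FrameworkCode.colorSize (c : FrameworkCode) : ℕ :=
  (c.2.2.1.map fun e => ((List.range c.1).map fun l => (e.2.2.getD l 0).natAbs).sum).sum

/-! ### Agreement of the coded rows with the linear system -/

namespace ColoredBars

/-- The label of an unknown. -/
def label {d n N : ℕ} : Unknown d n N → ℕ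
  | Sum.inl (i, r, k) => vertexLabel i k (List.ofFn fun l => (r l).val)
  | Sum.inr (k, l) => latticeLabel k l

/-- The leading entries `0` and `1` separate the two kinds of unknowns, and lists are encoded
injectively. Distinct unknowns thus become distinct, hence independent, monomials. -/
theorem label_injective {d n N : ℕ} [NeZero N] :
    Function.Injective (label : Unknown d n N → ℕ) := by
  rintro (⟨i, r, k⟩ | ⟨k, l⟩) (⟨i', r', k'⟩ | ⟨k', l'⟩) h
  · have h := Encodable.encode_injective (α := List ℕ) h
    simp only [List.cons.injEq, true_and, Fin.val_inj] at h
    obtain ⟨rfl, rfl, h2⟩ := h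
    have : r = r' := by
      funext l
      exact ZMod.val_injective N (congrFun (List.ofFn_injective h2) l)
    rw [this]
  · have h := Encodable.encode_injective h
    simp at h
  · have h := Encodable.encode_injective h
    simp at h
  · have h := Encodable.encode_injective h
    simp only [List.cons.injEq, true_and, Fin.val_inj, and_true] at h
    rw [h.1, h.2]

/-- Linear forms in the unknowns as polynomials. -/
noncomputable def toPolynomial (d n N : ℕ) [NeZero N] : (Unknown d n N → ℝ) →ₗ[ℝ] ℝ[X] :=
  Fintype.linearCombination ℝ fun u => (X : ℝ[X]) ^ label u

theorem toPolynomial_single {d n N : ℕ} [NeZero N] (u : Unknown d n N) :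
    toPolynomial d n N (Pi.single u 1) = X ^ label u := by
  rw [toPolynomial, Fintype.linearCombination_apply_single, one_smul]

theorem toPolynomial_injective (d n N : ℕ) [NeZero N] :
    Function.Injective (toPolynomial d n N) := by
  rw [toPolynomial, ← linearIndependent_iff_injective_fintypeLinearCombination]
  have h3 := (Polynomial.basisMonomials ℝ).linearIndependent.comp (label : Unknown d n N → ℕ)
    label_injective
  convert h3 using 1
  funext k
  simp [Polynomial.coe_basisMonomials, X_pow_eq_monomial]

variable {d n : ℕ}

/-- The code `c` spells out the colored graph `B`, with the generators `y`. -/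
structure IsCodedBy (c : FrameworkCode) (B : ColoredBars d n c.2.2.1.length) (y : List ℝ) :
    Prop where
  dim : c.1 = d
  src : ∀ e, (B.src e : ℕ) = c.2.2.1[e].1
  tgt : ∀ e, (B.tgt e : ℕ) = c.2.2.1[e].2.1
  color : ∀ e l, B.color e l = c.2.2.1[e].2.2.getD l 0
  lt_length : ∀ (e : Fin c.2.2.1.length) (k : Fin d), ∀ s ∈
    EdgeCode.directionTerms d c.2.2.2.2.1 c.2.2.2.2.2 c.2.2.1[e] k, s.2 < y.length
  dir : ∀ e (k : Fin d), B.dir e k =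
    ((EdgeCode.directionTerms d c.2.2.2.2.1 c.2.2.2.2.2 c.2.2.1[e] k).map
      fun s => (s.1 : ℝ) * y.getD s.2 0).sum

namespace IsCodedBy

variable {c : FrameworkCode} {B : ColoredBars d n c.2.2.1.length} {y : List ℝ}

theorem colorSize_eq (h : B.IsCodedBy c y) : B.colorSize = c.colorSize := by
  rw [FrameworkCode.colorSize, ColoredBars.colorSize, h.dim]
  have e : c.2.2.1.map (fun e => ((List.range d).map fun l => (e.2.2.getD l 0).natAbs).sum) =
      List.ofFn fun e => ∑ l, (B.color e l).natAbs := by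
    apply List.ext_getElem
    · simp
    · intro i h1 h2
      rw [List.getElem_map, sum_map_range, List.getElem_ofFn]
      exact Finset.sum_congr rfl fun l _ => by rw [h.color]; rfl
  rw [e, List.sum_ofFn]

theorem translate_eq (h : B.IsCodedBy c y) {N : ℕ} [NeZero N] (e : Fin c.2.2.1.length)
    (ρ : Fin d → ZMod N) :
    EdgeCode.translate N d c.2.2.1[e] (List.ofFn fun l => (ρ l).val) =
      List.ofFn fun l => ((ρ + residue N (B.color e)) l).val := by
  apply List.ext_getElem
  · simp [EdgeCode.translate]
  · intro l h1 h2
    have hl : l < d := by simpa using h2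
    simp only [EdgeCode.translate, List.getElem_map, List.getElem_range, List.getElem_ofFn,
      Pi.add_apply, residue]
    rw [ZMod.val_add, h.color, ← cast_intResidue (NeZero.pos N), ZMod.val_natCast,
      Nat.mod_eq_of_lt (intResidue_lt (NeZero.pos N) _)]
    simp [List.getD_eq_getElem?_getD, hl]

theorem toPoly_row (h : B.IsCodedBy c y) {N : ℕ} [NeZero N] (e : Fin c.2.2.1.length)
    (ρ : Fin d → ZMod N) :
    PolyCode.toPoly (EdgeCode.row N d c.2.2.2.2.1 c.2.2.2.2.2 c.2.2.1[e]
      (List.ofFn fun l => (ρ l).val)) y = toPolynomial d n N (B.equation N e ρ) := by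
  rw [EdgeCode.row, PolyCode.toPoly_flatMap, sum_map_range, equation, map_sum]
  refine Finset.sum_congr rfl fun k _ => ?_
  rw [toPoly_productTerms _ _ (h.lt_length e k), ← h.dir, map_smul]
  congr 1
  simp only [map_add, map_sub, map_sum, map_smul, toPolynomial_single]
  rw [EdgeCode.velocityTerms, h.translate_eq, List.map_cons, List.map_cons, List.sum_cons,
    List.sum_cons, List.map_map, sum_map_range]
  simp only [label, h.src, h.tgt, h.color, Function.comp_apply]
  push_cast
  rw [one_smul, neg_one_smul]
  abel

/-- The coded rows are the images of the equations under the injective map `toPolynomial`, which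
preserves the dimension of the span; repetitions and order in the list do not matter. -/
theorem rank_rows_eq (h : B.IsCodedBy c y) (hF : FieldCode.Presents c.2.2.2.1 y) {N : ℕ}
    [NeZero N] : PolyCode.rank c.2.2.2.1 (c.rows N) = Module.finrank ℝ (Submodule.span ℝ
      (Set.range fun p : Fin c.2.2.1.length × (Fin d → ZMod N) => B.equation N p.1 p.2)) := by
  rw [PolyCode.rank_eq hF, LinearEquiv.finrank_eq (Submodule.equivMapOfInjective
    (toPolynomial d n N) (toPolynomial_injective d n N) (Submodule.span ℝ
      (Set.range fun p : Fin c.2.2.1.length × (Fin d → ZMod N) => B.equation N p.1 p.2))),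
    Submodule.map_span, listSpan, ← Set.range_comp]
  suffices hs : {p | p ∈ (c.rows N).map fun f => PolyCode.toPoly f y} = Set.range
      (toPolynomial d n N ∘ fun p : Fin c.2.2.1.length × (Fin d → ZMod N) =>
        B.equation N p.1 p.2) by rw [hs]
  ext p
  simp only [Set.mem_ofPred_eq, List.mem_map, FrameworkCode.rows, List.mem_flatMap, Set.mem_range,
    Function.comp_apply, h.dim, mem_residueBox]
  constructor
  · rintro ⟨f, ⟨e, he, r, ⟨hd, hr⟩, rfl⟩, rfl⟩
    obtain ⟨i, hi, rfl⟩ := List.getElem_of_mem he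
    refine ⟨(⟨i, hi⟩, fun l => (r[(l : ℕ)] : ZMod N)), ?_⟩
    rw [← h.toPoly_row]
    congr 2
    apply List.ext_getElem
    · simp [hd]
    · intro l h1 h2
      rw [List.getElem_ofFn, ZMod.val_natCast, Nat.mod_eq_of_lt (hr _ (List.getElem_mem _))]
  · rintro ⟨⟨e, ρ⟩, rfl⟩
    exact ⟨_, ⟨_, List.getElem_mem _, List.ofFn fun l => (ρ l).val, ⟨by simp, by
      simp [List.mem_ofFn, ZMod.val_lt]⟩, rfl⟩, h.toPoly_row e ρ⟩

end IsCodedBy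

end ColoredBars

/-! ### The decision procedure and its correctness -/

namespace FrameworkCode

/-- The test for infinitesimal rigidity with respect to `N ℤ^d`. -/
def RigidTest (c : FrameworkCode) (N : ℕ) : Prop :=
  (c.1 + 1) * c.1 / 2 + PolyCode.rank c.2.2.2.1 (c.rows N) =
    c.2.1 * (N ^ c.1 * c.1) + c.1 * c.1

/-- The modulus such that rigidity with respect to its multiples implies ultrarigidity. -/
def modulus (c : FrameworkCode) : ℕ :=
  torsionBound c.1 (c.2.1 * c.1 * c.colorSize) (FieldCode.degreeBound c.2.2.2.1).factorial

/-- The test for infinitesimal ultrarigidity. -/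
def UltrarigidTest (c : FrameworkCode) : Prop := RigidTest c 1 ∧ RigidTest c (modulus c)

/-- Rank–nullity for the system modulo `N`, with `n * N ^ d * d + d * d` unknowns; the test is
written additively to avoid truncated subtraction. -/
theorem rigidTest_iff {d : ℕ} {c : FrameworkCode} {B : ColoredBars d c.2.1 c.2.2.1.length}
    {y : List ℝ} (h : B.IsCodedBy c y) (hF : FieldCode.Presents c.2.2.2.1 y) {N : ℕ} (hN : 0 < N) :
    RigidTest c N ↔ Module.finrank ℝ (B.motions (scaledLattice d N)) = (d + 1).choose 2 := by
  have : NeZero N := ⟨hN.ne'⟩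
  have h1 := B.finrank_solutions_add (N := N)
  rw [B.finrank_motions, RigidTest, h.rank_rows_eq hF, h.dim, Nat.choose_two_right,
    Nat.add_sub_cancel]
  omega

/-- The description yields a colored graph that is both a quotient of the framework and spelled out
by the code. The edge directions lie in the presented field, whose degree bound supplies the
constant `D` for the reduction to two lattices. -/
theorem ultrarigidTest_iff {d : ℕ} {V : Type*} [AddAction (Fin d → ℤ) V]
    {Φ : PeriodicFramework d V} {c : FrameworkCode} (hc : Describes c Φ) :
    UltrarigidTest c ↔ Φ.InfinitesimallyUltrarigid := by
  obtain ⟨d', n, E, F, P, A⟩ := c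
  obtain ⟨rfl, rep, hbij, hE, hadj, y, hF, hP, hA⟩ := hc
  have hE' : ∀ e : Fin E.length, E[e].1 < n ∧ E[e].2.1 < n ∧ E[e].2.2.length = d' :=
    fun e => hE _ (List.getElem_mem _)
  let B : ColoredBars d' n E.length :=
    { src := fun e => ⟨E[e].1, (hE' e).1⟩
      tgt := fun e => ⟨E[e].2.1, (hE' e).2.1⟩
      color := fun e => EdgeCode.color E[e] d'
      dir := fun e k => Φ.p (rep ⟨E[e].2.1, (hE' e).2.1⟩) k +
        (∑ l, Φ.L k l * EdgeCode.color E[e] d' l) - Φ.p (rep ⟨E[e].1, (hE' e).1⟩) k }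
  -- Where the optional lookup succeeds, the default values used by the algorithm are never reached.
  have hlook : ∀ {T : List (List ℕ)} {i k : ℕ} {x : ℝ}, lookupReal y T i k = some x →
      (T.getD i []).getD k 0 < y.length ∧ y.getD ((T.getD i []).getD k 0) 0 = x := by
    intro T i k x hx
    simp only [lookupReal, Option.bind_eq_some_iff] at hx
    obtain ⟨row, h1, t, h2, h3⟩ := hx
    have h4 : (T.getD i []).getD k 0 = t := by
      simp [List.getD_eq_getElem?_getD, h1, h2]
    rw [h4]
    obtain ⟨h5, h6⟩ := List.getElem?_eq_some_iff.mp h3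
    exact ⟨h5, by rw [List.getD_eq_getElem _ _ h5, h6]⟩
  have hquot : B.IsQuotientOf Φ rep := by
    refine ⟨hbij, fun u v => (hadj u v).trans ⟨?_, ?_⟩, fun _ _ => rfl⟩
    · rintro ⟨i, j, e, he, hi, hj, δ, h⟩
      obtain ⟨k, hk, rfl⟩ := List.getElem_of_mem he
      have h1 : i = B.src ⟨k, hk⟩ := Fin.ext hi.symm
      have h2 : j = B.tgt ⟨k, hk⟩ := Fin.ext hj.symm
      exact ⟨⟨k, hk⟩, δ, h1 ▸ h2 ▸ h⟩
    · rintro ⟨e, δ, h⟩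
      exact ⟨_, _, _, List.getElem_mem _, rfl, rfl, δ, h⟩
  have hcode : B.IsCodedBy (d', n, E, F, P, A) y := by
    refine ⟨rfl, fun _ => rfl, fun _ => rfl, fun _ _ => rfl, fun e k s hs => ?_, fun e k => ?_⟩
    · simp only [EdgeCode.directionTerms, List.mem_cons, List.mem_map, List.mem_range] at hs
      rcases hs with rfl | rfl | ⟨l, hl, rfl⟩
      · exact (hlook (hP ⟨_, (hE' e).2.1⟩ k)).1
      · exact (hlook (hP ⟨_, (hE' e).1⟩ k)).1
      · exact (hlook (hA k ⟨l, hl⟩)).1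
    · simp only [EdgeCode.directionTerms, List.map_cons, List.sum_cons, List.map_map, sum_map_range,
        Function.comp_apply]
      rw [(hlook (hP ⟨_, (hE' e).2.1⟩ k)).2, (hlook (hP ⟨_, (hE' e).1⟩ k)).2]
      simp only [(hlook (hA k _)).2, B, EdgeCode.color]
      push_cast
      have e1 : ∀ l : Fin d', Φ.L k l * ((E[e].2.2.getD l 0 : ℤ) : ℝ) =
        ((E[e].2.2.getD l 0 : ℤ) : ℝ) * Φ.L k l := fun l => mul_comm _ _
      simp only [e1]
      ring
  have hmem : ∀ {T : List (List ℕ)} {i k : ℕ} {x : ℝ}, lookupReal y T i k = some x →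
      x ∈ IntermediateField.adjoin ℚ {z : ℝ | z ∈ y} := by
    intro T i k x hx
    obtain ⟨h1, h2⟩ := hlook hx
    rw [← h2, List.getD_eq_getElem _ _ h1]
    exact IntermediateField.subset_adjoin ℚ _ (List.getElem_mem _)
  have hdir : ∀ e k, B.dir e k ∈ IntermediateField.adjoin ℚ {z : ℝ | z ∈ y} := by
    intro e k
    refine sub_mem (add_mem (hmem (hP _ k)) (sum_mem fun l _ => mul_mem (hmem (hA k l)) ?_))
      (hmem (hP _ k))
    exact intCast_mem _ _
  have hmod : 0 < modulus (d', n, E, F, P, A) := torsionBound_pos _ _ _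
  have key := B.forall_finrank_motions_iff hdir
    (fun N ζ hN hζ => hF.totient_le hN hζ) ((d' + 1).choose 2)
  rw [hcode.colorSize_eq] at key
  rw [UltrarigidTest, rigidTest_iff hcode hF one_pos, rigidTest_iff hcode hF hmod]
  refine key.symm.trans ?_
  simp only [PeriodicFramework.InfinitesimallyUltrarigid, PeriodicFramework.InfinitesimallyRigidFor,
    hquot.finrank_infinitesimalMotions]

end FrameworkCode

/-! ## Primitive recursiveness -/

namespace Primrec

section

variable {α β : Type*} [Primcodable α] [Primcodable β]

theorem list_sum_nat : Primrec (List.sum : List ℕ → ℕ) :=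
  (list_foldr Primrec.id (const 0)
    ((nat_add.comp (fst.comp snd) (snd.comp snd)).to₂)).of_eq fun l => by
      induction l with
      | nil => rfl
      | cons a l ih => simpa using ih

theorem list_prod_nat : Primrec (List.prod : List ℕ → ℕ) :=
  (list_foldr Primrec.id (const 1)
    ((nat_mul.comp (fst.comp snd) (snd.comp snd)).to₂)).of_eq fun l => by
      induction l with
      | nil => rfl
      | cons a l ih => rw [List.prod_cons, ← ih]; rfl

theorem nat_power : Primrec₂ fun a b : ℕ => a ^ b :=
  (nat_rec (const 1) ((nat_mul.comp (snd.comp snd) fst).to₂)).of_eq fun a b => by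
    induction b with
    | zero => rfl
    | succ b ih => rw [pow_succ, ← ih]

theorem nat_factorial : Primrec Nat.factorial :=
  (nat_rec₁ 1 ((nat_mul.comp (succ.comp fst) snd).to₂)).of_eq fun n => by
    induction n with
    | zero => rfl
    | succ n ih => simp only [Nat.factorial_succ, ← ih]

/-- Nonnegative integers have even codes and negative ones odd codes; sign and size are read off
from the code by parity and halving. -/
theorem encode_int (z : ℤ) :
    Encodable.encode z = if 0 ≤ z then 2 * z.toNat else 2 * ((-z).toNat - 1) + 1 := by
  cases z with
  | ofNat n => exact (if_pos (Int.natCast_nonneg n)).symm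
  | negSucc n =>
    rw [if_neg (by omega), Int.neg_negSucc]
    rfl

theorem int_toNat : Primrec Int.toNat :=
  (ite (Primrec.eq.comp (nat_mod.comp Primrec.encode (const 2)) (const 1)) (const 0)
    (nat_div.comp Primrec.encode (const 2))).of_eq fun z => by
      rw [encode_int]
      split_ifs <;> omega

theorem int_toNat_neg : Primrec fun z : ℤ => (-z).toNat :=
  (ite (Primrec.eq.comp (nat_mod.comp Primrec.encode (const 2)) (const 1))
    (succ.comp (nat_div.comp Primrec.encode (const 2))) (const 0)).of_eq fun z => by
      rw [encode_int]
      split_ifs <;> omega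

/-- All integer operations below are computed on positive and negative parts as natural numbers, and
reassembled by this difference. -/
theorem int_sub_nat : Primrec₂ fun a b : ℕ => (a : ℤ) - b := by
  refine Primrec₂.encode_iff.mp ?_
  refine (ite (nat_le.comp snd fst) (nat_double.comp (nat_sub.comp fst snd))
    (nat_double_succ.comp (nat_sub.comp (nat_sub.comp snd fst) (const 1)))).of_eq fun p => ?_
  obtain ⟨a, b⟩ := p
  dsimp only
  rw [encode_int]
  split_ifs <;> omega

variable {f g : α → ℤ}

theorem int_neg (hf : Primrec f) : Primrec fun a => -f a :=
  (int_sub_nat.comp (int_toNat_neg.comp hf) (int_toNat.comp hf)).of_eq fun a => by omega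

theorem int_add (hf : Primrec f) (hg : Primrec g) : Primrec fun a => f a + g a :=
  (int_sub_nat.comp (nat_add.comp (int_toNat.comp hf) (int_toNat.comp hg))
    (nat_add.comp (int_toNat_neg.comp hf) (int_toNat_neg.comp hg))).of_eq fun a => by omega

theorem int_mul (hf : Primrec f) (hg : Primrec g) : Primrec fun a => f a * g a :=
  (int_sub_nat.comp
    (nat_add.comp (nat_mul.comp (int_toNat.comp hf) (int_toNat.comp hg))
      (nat_mul.comp (int_toNat_neg.comp hf) (int_toNat_neg.comp hg)))
    (nat_add.comp (nat_mul.comp (int_toNat.comp hf) (int_toNat_neg.comp hg))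
      (nat_mul.comp (int_toNat_neg.comp hf) (int_toNat.comp hg)))).of_eq fun a => by
      have h1 : f a = (f a).toNat - (-f a).toNat := by omega
      have h2 : g a = (g a).toNat - (-g a).toNat := by omega
      conv_rhs => rw [h1, h2]
      push_cast
      ring

theorem int_natAbs (hf : Primrec f) : Primrec fun a => (f a).natAbs :=
  (nat_add.comp (int_toNat.comp hf) (int_toNat_neg.comp hf)).of_eq fun a => by omega

theorem list_sum_int : Primrec (List.sum : List ℤ → ℤ) :=
  (list_foldr Primrec.id (const 0)
    ((int_add (fst.comp snd) (snd.comp snd)).to₂)).of_eq fun l => by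
      induction l with
      | nil => rfl
      | cons a l ih => simpa using ih

end

variable {α : Type*} [Primcodable α]

theorem list_singleton {β : Type*} [Primcodable β] {f : α → β} (hf : Primrec f) :
    Primrec fun a => [f a] := list_cons.comp hf (const [])

theorem addExponents {f g : α → List ℕ} (hf : Primrec f) (hg : Primrec g) :
    Primrec fun a => addExponents (f a) (g a) :=
  list_map (list_range.comp (nat_add.comp (list_length.comp hf) (list_length.comp hg)))
    (nat_add.comp ((list_getD 0).comp (hf.comp fst) snd) ((list_getD 0).comp (hg.comp fst) snd)).to₂

/-! ### Primitive recursiveness of the polynomial and rank computations -/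

section PolyCode

variable {f g : α → PolyCode}

theorem polyCode_dot (hf : Primrec f) (hg : Primrec g) :
    Primrec fun a => PolyCode.dot (f a) (g a) := by
  refine list_flatMap hf ?_
  unfold Primrec₂
  refine list_flatMap (hg.comp fst) ?_
  refine ite (Primrec.eq.comp (list_headI.comp (snd.comp (snd.comp fst)))
    (list_headI.comp (snd.comp snd))) ?_ (const [])
  exact list_singleton (Primrec.pair (int_mul (fst.comp (snd.comp fst)) (fst.comp snd))
    (addExponents (list_tail.comp (snd.comp (snd.comp fst))) (list_tail.comp (snd.comp snd))))

theorem polyCode_scale (hf : Primrec f) (hg : Primrec g) :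
    Primrec fun a => PolyCode.scale (f a) (g a) := by
  refine list_flatMap hf ?_
  unfold Primrec₂
  refine list_map (hg.comp fst) ?_
  exact Primrec.pair (int_mul (fst.comp (snd.comp fst)) (fst.comp snd))
    (list_cons.comp (list_headI.comp (snd.comp snd))
      (addExponents (snd.comp (snd.comp fst)) (list_tail.comp (snd.comp snd))))

theorem polyCode_neg (hf : Primrec f) : Primrec fun a => PolyCode.neg (f a) :=
  list_map hf (Primrec.pair (int_neg (fst.comp snd)) (snd.comp snd)).to₂

theorem polyCode_project (hf : Primrec f) (hg : Primrec g) :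
    Primrec fun a => PolyCode.project (f a) (g a) :=
  list_append.comp (polyCode_scale (polyCode_dot hf hf) hg)
    (polyCode_neg (polyCode_scale (polyCode_dot hg hf) hf))

theorem polyCode_shift {k : α → ℕ} (hf : Primrec f) (hk : Primrec k) :
    Primrec fun a => PolyCode.shift (f a) (k a) :=
  list_map hf (Primrec.pair (fst.comp snd) (list_cons.comp
    (nat_add.comp (hk.comp fst) (list_headI.comp (snd.comp snd)))
    (list_tail.comp (snd.comp snd)))).to₂

theorem polyCode_orthoStep : Primrec PolyCode.orthoStepCode := by
  -- The empty list needs no case distinction, because its tail is empty.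
  refine (list_map list_tail (polyCode_project (list_headI.comp fst) snd).to₂).of_eq fun l => ?_
  cases l <;> rfl

theorem polyCode_headDegree (hf : Primrec f) : Primrec fun a => PolyCode.headDegree (f a) :=
  list_sum_nat.comp (list_map hf (list_headI.comp (snd.comp snd)).to₂)

theorem polyCode_remainder (hf : Primrec f) (hg : Primrec g) :
    Primrec fun a => PolyCode.remainder (f a) (g a) := by
  have h := succ.comp (polyCode_headDegree hg)
  exact list_headI.comp (nat_iterate h (list_append.comp
    (list_map (list_range.comp h) (polyCode_shift (hf.comp fst) snd).to₂) (list_singleton hg))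
    (polyCode_orthoStep.comp snd).to₂)

theorem polyCode_eliminate {o : α → Option PolyCode} (hg : Primrec g) (ho : Primrec o) :
    Primrec fun a => PolyCode.eliminate (g a) (o a) := by
  have h := polyCode_remainder (f := fun p : α × PolyCode => p.2) snd (hg.comp fst)
  refine (option_casesOn ho (polyCode_dot hg hg) (polyCode_dot h h).to₂).of_eq fun a => ?_
  rw [PolyCode.eliminate]
  cases o a <;> rfl

theorem polyCode_isZero {F : α → FieldCode} (hF : Primrec F) (hg : Primrec g) :
    PrimrecPred fun a => PolyCode.isZero (F a) (g a) = true := by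
  refine PrimrecPred.of_eq (p := fun a =>
    (((F a).foldl PolyCode.eliminate (g a)).map Prod.fst).sum = 0) ?_ fun a => ?_
  · refine Primrec.eq.comp (list_sum_int.comp (list_map (list_foldl (h := fun _ s => PolyCode.eliminate s.1 s.2) hF hg ?_) (fst.comp snd).to₂))
      (const 0)
    exact (polyCode_eliminate (fst.comp snd) (snd.comp snd)).to₂
  · rw [PolyCode.isZero, decide_eq_true_iff]

theorem polyCode_rank {F : α → FieldCode} {l : α → List PolyCode} (hF : Primrec F)
    (hl : Primrec l) : Primrec fun a => PolyCode.rank (F a) (l a) := by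
  refine fst.comp (nat_iterate (list_length.comp hl) (Primrec.pair (const 0) hl) ?_)
  have h : Primrec fun p : α × ℕ × List PolyCode => p.2.2.headI :=
    list_headI.comp (snd.comp snd)
  refine ite (polyCode_isZero (hF.comp fst) (polyCode_dot h h))
    (Primrec.pair (fst.comp snd) (list_tail.comp (snd.comp snd)))
    (Primrec.pair (succ.comp (fst.comp snd)) (list_map (list_tail.comp (snd.comp snd)) ?_))
  exact (polyCode_project (h.comp fst) snd).to₂

theorem fieldCode_degreeBound : Primrec fun F : FieldCode => FieldCode.degreeBound F := by
  refine list_prod_nat.comp (list_map Primrec.id ?_)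
  refine (option_casesOn (snd (α := FieldCode) (β := Option PolyCode)) (const 1)
    (succ.comp (polyCode_headDegree snd)).to₂).of_eq fun p => ?_
  obtain ⟨_, _ | _⟩ := p <;> rfl

end PolyCode

/-! ### Primitive recursiveness of the linear system and the modulus -/

section FrameworkCode

theorem torsionBound {d W k : α → ℕ} (hd : Primrec d) (hW : Primrec W) (hk : Primrec k) :
    Primrec fun a => torsionBound (d a) (W a) (k a) :=
  nat_power.comp (nat_factorial.comp (nat_power.comp (nat_add.comp (nat_mul.comp (const 2)
    (nat_mul.comp hW hk)) (const 2)) hd)) (const 3)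

theorem residueBox : Primrec₂ residueBox := by
  refine nat_iterate snd (const [[]]) ?_
  unfold Primrec₂
  refine list_flatMap snd ?_
  unfold Primrec₂
  exact list_map (list_range.comp (fst.comp (fst.comp fst)))
    (list_cons.comp snd (snd.comp fst)).to₂

theorem intResidue {N : α → ℕ} {z : α → ℤ} (hN : Primrec N) (hz : Primrec z) :
    Primrec fun a => intResidue (N a) (z a) :=
  nat_mod.comp (nat_add.comp (int_toNat.comp hz) (nat_mul.comp (nat_sub.comp hN (const 1))
    (int_toNat_neg.comp hz))) hN

theorem vertexLabel {i k : α → ℕ} {r : α → List ℕ} (hi : Primrec i) (hk : Primrec k)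
    (hr : Primrec r) : Primrec fun a => vertexLabel (i a) (k a) (r a) :=
  Primrec.encode.comp (list_cons.comp (const 0) (list_cons.comp hi (list_cons.comp hk hr)))

theorem latticeLabel {k l : α → ℕ} (hk : Primrec k) (hl : Primrec l) :
    Primrec fun a => latticeLabel (k a) (l a) :=
  Primrec.encode.comp (list_cons.comp (const 1) (list_cons.comp hk (list_singleton hl)))

theorem variableExponents : Primrec variableExponents :=
  list_append.comp (list_map list_range (const 0).to₂) (const [1])

theorem productTerms {S U : α → List (ℤ × ℕ)} (hS : Primrec S) (hU : Primrec U) :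
    Primrec fun a => productTerms (S a) (U a) := by
  refine list_flatMap hS ?_
  unfold Primrec₂
  refine list_map (hU.comp fst) (Primrec.pair (int_mul (fst.comp (snd.comp fst)) (fst.comp snd))
    (list_cons.comp (snd.comp snd) (variableExponents.comp (snd.comp (snd.comp fst))))).to₂

variable {N d k : α → ℕ} {P A : α → List (List ℕ)} {e : α → EdgeCode} {r : α → List ℕ}

theorem edgeCode_color (he : Primrec e) (hk : Primrec k) :
    Primrec fun a => (e a).2.2.getD (k a) 0 :=
  (list_getD 0).comp (snd.comp (snd.comp he)) hk

theorem table (hP : Primrec P) {i : α → ℕ} (hi : Primrec i) (hk : Primrec k) :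
    Primrec fun a => ((P a).getD (i a) []).getD (k a) 0 :=
  (list_getD 0).comp ((list_getD []).comp hP hi) hk

theorem edgeCode_translate (hN : Primrec N) (hd : Primrec d) (he : Primrec e) (hr : Primrec r) :
    Primrec fun a => EdgeCode.translate (N a) (d a) (e a) (r a) :=
  list_map (list_range.comp hd) (nat_mod.comp (nat_add.comp ((list_getD 0).comp (hr.comp fst) snd)
    (intResidue (hN.comp fst) (edgeCode_color (he.comp fst) snd))) (hN.comp fst)).to₂

theorem edgeCode_directionTerms (hd : Primrec d) (hP : Primrec P) (hA : Primrec A)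
    (he : Primrec e) (hk : Primrec k) :
    Primrec fun a => EdgeCode.directionTerms (d a) (P a) (A a) (e a) (k a) :=
  list_cons.comp (Primrec.pair (const 1) (table hP (fst.comp (snd.comp he)) hk))
    (list_cons.comp (Primrec.pair (const (-1)) (table hP (fst.comp he) hk))
      (list_map (list_range.comp hd) (Primrec.pair (edgeCode_color (he.comp fst) snd)
        (table (hA.comp fst) (hk.comp fst) snd)).to₂))

theorem edgeCode_velocityTerms (hN : Primrec N) (hd : Primrec d) (he : Primrec e)
    (hr : Primrec r) (hk : Primrec k) :
    Primrec fun a => EdgeCode.velocityTerms (N a) (d a) (e a) (r a) (k a) :=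
  list_cons.comp (Primrec.pair (const 1) (vertexLabel (fst.comp (snd.comp he)) hk
    (edgeCode_translate hN hd he hr)))
    (list_cons.comp (Primrec.pair (const (-1)) (vertexLabel (fst.comp he) hk hr))
      (list_map (list_range.comp hd) (Primrec.pair (edgeCode_color (he.comp fst) snd)
        (latticeLabel (hk.comp fst) snd)).to₂))

theorem edgeCode_row (hN : Primrec N) (hd : Primrec d) (hP : Primrec P) (hA : Primrec A)
    (he : Primrec e) (hr : Primrec r) :
    Primrec fun a => EdgeCode.row (N a) (d a) (P a) (A a) (e a) (r a) :=
  list_flatMap (list_range.comp hd) (productTerms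
    (edgeCode_directionTerms (hd.comp fst) (hP.comp fst) (hA.comp fst) (he.comp fst) snd)
    (edgeCode_velocityTerms (hN.comp fst) (hd.comp fst) (he.comp fst) (hr.comp fst) snd)).to₂

variable {c : α → FrameworkCode}

theorem frameworkCode_rows (hc : Primrec c) (hN : Primrec N) :
    Primrec fun a => FrameworkCode.rows (c a) (N a) := by
  have h1 : Primrec fun a => (c a).1 := fst.comp hc
  have h2 : Primrec fun a => (c a).2.2.1 := fst.comp (snd.comp (snd.comp hc))
  have h3 : Primrec fun a => (c a).2.2.2.2.1 :=
    fst.comp (snd.comp (snd.comp (snd.comp (snd.comp hc))))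
  have h4 : Primrec fun a => (c a).2.2.2.2.2 :=
    snd.comp (snd.comp (snd.comp (snd.comp (snd.comp hc))))
  refine list_flatMap h2 ?_
  unfold Primrec₂
  exact list_map (residueBox.comp (hN.comp fst) (h1.comp fst))
    (edgeCode_row (hN.comp (fst.comp fst)) (h1.comp (fst.comp fst)) (h3.comp (fst.comp fst))
      (h4.comp (fst.comp fst)) (snd.comp fst) snd).to₂

theorem frameworkCode_colorSize (hc : Primrec c) :
    Primrec fun a => FrameworkCode.colorSize (c a) := by
  refine list_sum_nat.comp (list_map (fst.comp (snd.comp (snd.comp hc))) ?_)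
  unfold Primrec₂
  exact list_sum_nat.comp (list_map (list_range.comp (fst.comp (hc.comp fst)))
    (int_natAbs (edgeCode_color (snd.comp fst) snd)).to₂)

theorem frameworkCode_modulus (hc : Primrec c) :
    Primrec fun a => FrameworkCode.modulus (c a) := by
  have h1 : Primrec fun a => (c a).1 := fst.comp hc
  exact torsionBound h1 (nat_mul.comp (nat_mul.comp (fst.comp (snd.comp hc)) h1)
    (frameworkCode_colorSize hc)) (nat_factorial.comp
      (fieldCode_degreeBound.comp (fst.comp (snd.comp (snd.comp (snd.comp hc))))))

end FrameworkCode

end Primrec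

namespace PrimrecPred

theorem frameworkCode_rigidTest {α : Type*} [Primcodable α] {c : α → FrameworkCode} {N : α → ℕ}
    (hc : Primrec c) (hN : Primrec N) : PrimrecPred fun a => FrameworkCode.RigidTest (c a) (N a) := by
  have h1 : Primrec fun a => (c a).1 := Primrec.fst.comp hc
  have h2 : Primrec fun a => (c a).2.2.2.1 :=
    Primrec.fst.comp (Primrec.snd.comp (Primrec.snd.comp (Primrec.snd.comp hc)))
  exact Primrec.eq.comp
    (Primrec.nat_add.comp (Primrec.nat_div.comp (Primrec.nat_mul.comp (Primrec.succ.comp h1) h1)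
      (Primrec.const 2)) (Primrec.polyCode_rank h2 (Primrec.frameworkCode_rows hc hN)))
    (Primrec.nat_add.comp (Primrec.nat_mul.comp (Primrec.fst.comp (Primrec.snd.comp hc))
      (Primrec.nat_mul.comp (Primrec.nat_power.comp hN h1) h1)) (Primrec.nat_mul.comp h1 h1))

theorem frameworkCode_ultrarigidTest : PrimrecPred FrameworkCode.UltrarigidTest :=
  (frameworkCode_rigidTest Primrec.id (Primrec.const 1)).and
    (frameworkCode_rigidTest Primrec.id (Primrec.frameworkCode_modulus Primrec.id))

end PrimrecPred

/-! ## Existence of finite descriptions -/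

namespace PolyCode

/-- The product of coded polynomials. -/
def mul (f g : PolyCode) : PolyCode :=
  f.flatMap fun s => g.map fun t => (s.1 * t.1, addExponents s.2 t.2)

theorem eval_mul (f g : PolyCode) (y : List ℝ) : eval (mul f g) y = eval f y * eval g y := by
  induction f with
  | nil => rw [eval_nil, zero_mul]; exact eval_nil y
  | cons s f ih =>
    have e : mul (s :: f) g = (g.map fun t => (s.1 * t.1, addExponents s.2 t.2)) ++ mul f g := by
      simp [mul]
    rw [e, eval_append, ih, eval_cons', add_mul]
    congr 1
    clear ih e
    induction g with
    | nil => rw [eval_nil, mul_zero]; exact eval_nil y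
    | cons t g ih =>
      rw [List.map_cons, eval_cons', ih, eval_cons', monomialValue_addExponents]
      push_cast
      ring

theorem eval_const (c : ℤ) (y : List ℝ) : eval ([(c, [])] : PolyCode) y = c := by
  rw [eval_cons', eval_nil]
  simp [monomialValue]

theorem eval_variable {y : List ℝ} {t : ℕ} (ht : t < y.length) :
    eval ([(1, variableExponents t)] : PolyCode) y = y[t] := by
  rw [eval_cons', eval_nil, monomialValue_variableExponents ht]
  simp

/-- Quotients of integer polynomials in the generators contain the generators and `ℚ` and are closed
under the field operations. -/
theorem exists_fraction {y : List ℝ} {x : ℝ}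
    (hx : x ∈ IntermediateField.adjoin ℚ {z : ℝ | z ∈ y}) :
    ∃ g h : PolyCode, eval h y ≠ 0 ∧ x * eval h y = eval g y := by
  induction hx using IntermediateField.adjoin_induction with
  | mem x hx =>
    obtain ⟨t, ht, rfl⟩ := List.getElem_of_mem hx
    refine ⟨[(1, variableExponents t)], [(1, [])], ?_, ?_⟩
    · rw [eval_const]
      simp
    · rw [eval_const, eval_variable ht]
      simp
  | algebraMap q =>
    refine ⟨[(q.num, [])], [(q.den, [])], ?_, ?_⟩
    · rw [eval_const]
      simp
    · rw [eval_const, eval_const]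
      have := Rat.mul_den_eq_num q
      simp only [eq_ratCast, Int.cast_natCast]
      exact_mod_cast this
  | add a b _ _ iha ihb =>
    obtain ⟨g, h, h0, e⟩ := iha
    obtain ⟨g', h', h0', e'⟩ := ihb
    refine ⟨mul g h' ++ mul g' h, mul h h', ?_, ?_⟩
    · rw [eval_mul]
      exact mul_ne_zero h0 h0'
    · rw [eval_append, eval_mul, eval_mul, eval_mul, ← e, ← e']
      ring
  | inv a _ ih =>
    obtain ⟨g, h, h0, e⟩ := ih
    by_cases ha : a = 0
    · subst ha
      refine ⟨[], [(1, [])], ?_, ?_⟩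
      · rw [eval_const]
        simp
      · rw [eval_nil]
        simp
    · refine ⟨h, g, e ▸ mul_ne_zero ha h0, ?_⟩
      rw [← e, inv_mul_cancel_left₀ ha]
  | mul a b _ _ iha ihb =>
    obtain ⟨g, h, h0, e⟩ := iha
    obtain ⟨g', h', h0', e'⟩ := ihb
    refine ⟨mul g g', mul h h', ?_, ?_⟩
    · rw [eval_mul]
      exact mul_ne_zero h0 h0'
    · rw [eval_mul, eval_mul, ← e, ← e']
      ring

/-- Common denominators of the coefficients are cleared term by term; the product of the
denominators remains as the nonzero factor. -/
theorem exists_toPoly_eq {y : List ℝ} (p : (IntermediateField.adjoin ℚ {z : ℝ | z ∈ y})[X]) :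
    ∃ f h : PolyCode, eval h y ≠ 0 ∧ toPoly f y = C (eval h y) *
      p.map (algebraMap (IntermediateField.adjoin ℚ {z : ℝ | z ∈ y}) ℝ) := by
  induction p using Polynomial.induction_on' with
  | add p q hp hq =>
    obtain ⟨f, h, h0, e⟩ := hp
    obtain ⟨f', h', h0', e'⟩ := hq
    refine ⟨scale h' f ++ scale h f', mul h h', ?_, ?_⟩
    · rw [eval_mul]
      exact mul_ne_zero h0 h0'
    · rw [toPoly_append, toPoly_scale, toPoly_scale, e, e', eval_mul, Polynomial.map_add,
        smul_eq_C_mul, smul_eq_C_mul, C_mul]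
      ring
  | monomial n c =>
    obtain ⟨g, h, h0, e⟩ := exists_fraction c.2
    refine ⟨scale g [(1, [n])], h, h0, ?_⟩
    rw [toPoly_scale, toPoly_cons, toPoly_nil, ← e, map_monomial, ← C_mul_X_pow_eq_monomial,
      ← mul_assoc, ← C_mul, smul_eq_C_mul]
    simp [monomialValue, mul_comm]

end PolyCode

namespace FieldCode

/-- No independence of the numbers is needed: each is algebraic or transcendental over the field of
the numbers after it, and its minimal polynomial in the first case has a denominator-free multiple.
-/
theorem exists_presents (y : List ℝ) : ∃ F : FieldCode, F.Presents y := by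
  induction y with
  | nil => exact ⟨[], trivial⟩
  | cons x y ih =>
    obtain ⟨F, hF⟩ := ih
    by_cases hx : IsAlgebraic (IntermediateField.adjoin ℚ {z : ℝ | z ∈ y}) x
    · obtain ⟨f, h, h0, e⟩ := PolyCode.exists_toPoly_eq
        (minpoly (IntermediateField.adjoin ℚ {z : ℝ | z ∈ y}) x)
      exact ⟨some f :: F, hF, hx, _, h0, e⟩
    · exact ⟨none :: F, hF, hx⟩

end FieldCode

theorem exists_lookupReal {n d : ℕ} {y : List ℝ} {a : Fin n → Fin d → ℝ}
    (ha : ∀ i k, a i k ∈ y) :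
    ∃ T : List (List ℕ), ∀ (i : Fin n) (k : Fin d), lookupReal y T i k = some (a i k) := by
  choose t ht using fun i k => List.getElem?_of_mem (ha i k)
  refine ⟨List.ofFn fun i => List.ofFn fun k => t i k, fun i k => ?_⟩
  simp [lookupReal, ht]

namespace PeriodicFramework

variable {d : ℕ} {V : Type*} [AddAction (Fin d → ℤ) V]

/-- One vertex is chosen from each of the finitely many orbits; freeness makes the translation that
reaches a given vertex unique. -/
theorem exists_representatives (Φ : PeriodicFramework d V) : ∃ (n : ℕ) (rep : Fin n → V),
    Function.Bijective fun x : Fin n × (Fin d → ℤ) => x.2 +ᵥ rep x.1 := by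
  have := Φ.finite_vertex_orbits
  let e := Finite.equivFin (AddAction.orbitRel.Quotient (Fin d → ℤ) V)
  have hout : ∀ i, (Quotient.mk'' (e.symm i).out : AddAction.orbitRel.Quotient (Fin d → ℤ) V) =
    e.symm i := fun i => Quotient.out_eq' _
  refine ⟨_, fun i => (e.symm i).out, ?_, ?_⟩
  · rintro ⟨i, γ⟩ ⟨j, δ⟩ h
    dsimp only at h
    have h1 : i = j := by
      apply e.symm.injective
      rw [← hout i, ← hout j]
      refine Quotient.sound' ?_
      rw [AddAction.orbitRel_apply]
      refine ⟨-γ + δ, ?_⟩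
      change (-γ + δ) +ᵥ _ = _
      rw [add_vadd, ← h, neg_vadd_vadd]
    subst h1
    have h2 : (-δ + γ) +ᵥ (e.symm i).out = (e.symm i).out := by
      rw [add_vadd, h, neg_vadd_vadd]
    have h3 := Φ.free _ _ h2
    rw [neg_add_eq_zero] at h3
    rw [h3]
  · intro v
    have h1 : (e.symm (e (Quotient.mk'' v))).out ∈ AddAction.orbit (Fin d → ℤ) v := by
      rw [← AddAction.orbitRel_apply]
      apply Quotient.exact'
      rw [hout, e.symm_apply_apply]
    obtain ⟨γ, hγ⟩ := h1
    refine ⟨(e (Quotient.mk'' v), -γ), ?_⟩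
    dsimp only at hγ ⊢
    rw [← hγ, neg_vadd_vadd]

theorem exists_edgeCodes (Φ : PeriodicFramework d V) {n : ℕ} {rep : Fin n → V}
    (hrep : Function.Bijective fun x : Fin n × (Fin d → ℤ) => x.2 +ᵥ rep x.1) :
    ∃ E : List EdgeCode, (∀ e ∈ E, e.1 < n ∧ e.2.1 < n ∧ e.2.2.length = d) ∧
      (∀ u v : V, Φ.graph.Adj u v ↔
        ∃ i j : Fin n, ∃ e ∈ E, e.1 = i ∧ e.2.1 = j ∧ ∃ δ : Fin d → ℤ,
          (u = δ +ᵥ rep i ∧ v = (δ + EdgeCode.color e d) +ᵥ rep j) ∨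
          (v = δ +ᵥ rep i ∧ u = (δ + EdgeCode.color e d) +ᵥ rep j)) := by
  classical
  obtain ⟨T, hT, hadj⟩ := Φ.finite_edge_orbits
  choose s hs using hrep.surjective
  dsimp only at hs
  -- The color is the difference of the translations of the two endpoints, so it does not change
  -- when the edge is translated.
  let code : V × V → EdgeCode := fun t =>
    ((s t.1).1, (s t.2).1, List.ofFn ((s t.2).2 - (s t.1).2))
  have hcolor : ∀ t, EdgeCode.color (code t) d = (s t.2).2 - (s t.1).2 := by
    intro t
    funext k
    simp [EdgeCode.color, code, List.getD_eq_getElem?_getD]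
  -- The finite set `T` only covers the edges up to translation and may contain other pairs, which
  -- must not be listed.
  have hfin : {t ∈ T | Φ.graph.Adj t.1 t.2}.Finite := hT.subset (Set.sep_subset _ _)
  have hmem : ∀ e, e ∈ hfin.toFinset.toList.map code ↔
      ∃ t, (t ∈ T ∧ Φ.graph.Adj t.1 t.2) ∧ code t = e := by
    intro e
    simp
  refine ⟨hfin.toFinset.toList.map code, ?_, fun u v => ?_⟩
  · intro e he
    obtain ⟨t, -, rfl⟩ := (hmem e).mp he
    exact ⟨(s t.1).1.2, (s t.2).1.2, by simp [code]⟩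
  · constructor
    · intro h
      obtain ⟨t, ht, γ, rfl, rfl⟩ := hadj u v h
      rw [Φ.adj_vadd] at h
      refine ⟨_, _, code t, (hmem _).mpr ⟨t, ⟨ht, h⟩, rfl⟩, rfl, rfl, γ + (s t.1).2, Or.inl ⟨?_, ?_⟩⟩
      · rw [add_vadd, hs]
      · rw [hcolor, add_assoc, add_sub_cancel, add_vadd, hs]
    · rintro ⟨i, j, e, he, hi, hj, δ, h⟩
      obtain ⟨t, ⟨-, ht⟩, rfl⟩ := (hmem e).mp he
      obtain rfl : (s t.1).1 = i := Fin.ext hi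
      obtain rfl : (s t.2).1 = j := Fin.ext hj
      have key : Φ.graph.Adj (δ +ᵥ rep (s t.1).1) ((δ + EdgeCode.color (code t) d) +ᵥ
          rep (s t.2).1) := by
        rw [← Φ.adj_vadd (-(δ - (s t.1).2)), ← add_vadd, ← add_vadd, hcolor]
        have e1 : -(δ - (s t.1).2) + δ = (s t.1).2 := by abel
        have e2 : -(δ - (s t.1).2) + (δ + ((s t.2).2 - (s t.1).2)) = (s t.2).2 := by abel
        rw [e1, e2, hs, hs]
        exact ht
      rcases h with ⟨rfl, rfl⟩ | ⟨rfl, rfl⟩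
      · exact key
      · exact key.symm

/-- The generators can be taken to be all coordinates of the representatives and all lattice
entries, so that the tables merely record positions. -/
theorem exists_describes (Φ : PeriodicFramework d V) :
    ∃ c : FrameworkCode, FrameworkCode.Describes c Φ := by
  obtain ⟨n, rep, hrep⟩ := Φ.exists_representatives
  obtain ⟨E, hE, hadj⟩ := Φ.exists_edgeCodes hrep
  let y : List ℝ := (List.ofFn fun i => List.ofFn fun k => Φ.p (rep i) k).flatten ++
    (List.ofFn fun i => List.ofFn fun k => Φ.L i k).flatten
  obtain ⟨F, hF⟩ := FieldCode.exists_presents y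
  obtain ⟨P, hP⟩ := exists_lookupReal (y := y) (a := fun i k => Φ.p (rep i) k) fun i k =>
    List.mem_append_left _ (List.mem_flatten.mpr
      ⟨_, (List.mem_ofFn).mpr ⟨i, rfl⟩, (List.mem_ofFn).mpr ⟨k, rfl⟩⟩)
  obtain ⟨A, hA⟩ := exists_lookupReal (y := y) (a := fun i k => Φ.L i k) fun i k =>
    List.mem_append_right _ (List.mem_flatten.mpr
      ⟨_, (List.mem_ofFn).mpr ⟨i, rfl⟩, (List.mem_ofFn).mpr ⟨k, rfl⟩⟩)
  exact ⟨(d, n, E, F, P, A), rfl, rep, hrep, hE, hadj, y, hF, hP, hA⟩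

end PeriodicFramework

theorem corollary1p1 :
    -- every periodic framework has a finite description,
    (∀ (d : ℕ) (V : Type*) [AddAction (Fin d → ℤ) V] (Φ : PeriodicFramework d V),
      ∃ c : FrameworkCode, FrameworkCode.Describes c Φ) ∧
    -- and one algorithm decides infinitesimal ultrarigidity from any such description
    (∃ D : FrameworkCode → Prop, ComputablePred D ∧
      ∀ (d : ℕ) (V : Type*) [AddAction (Fin d → ℤ) V] (Φ : PeriodicFramework d V)
        (c : FrameworkCode), FrameworkCode.Describes c Φ →
          (D c ↔ Φ.InfinitesimallyUltrarigid)) :=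
  ⟨fun _ _ _ Φ => Φ.exists_describes, FrameworkCode.UltrarigidTest,
    PrimrecPred.frameworkCode_ultrarigidTest.computablePred,
    fun _ _ _ _ _ hc => FrameworkCode.ultrarigidTest_iff hc⟩
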